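/- Let $K$ be an algebraically closed field, and let $\Gamma$ be a Brauer tree with multiplicity one, that is, a finite tree with a cyclic ordering of the edges at each vertex. Let $Q$ be its Brauer quiver: the vertices of $Q$ are the edges of $\Gamma$, and for each edge $i$ and each endpoint $v$ of $i$ there is one arrow from $i$ to the edge following $i$ in the cyclic order at $v$ (a loop if $v$ is a leaf); so $Q$ is the union of one oriented cycle for each vertex of $\Gamma$. Let $A=KQ/R$ be the basic Brauer tree algebra of $\Gamma$, where the ideal $R$ is generated by the products of two consecutive arrows from different cycles and by the elements $\alpha^{x_\alpha}-\beta^{x_\beta}$ for each vertex $x$ of $Q$, $\alpha^{x_\alpha}$ and $\beta^{x_\beta}$ being the two full cycles starting at $x$. Paths are composed from left to right, modules are left modules, and $Ae_i$ is the indecomposable projective module of the vertex $i$. An $A$-cycle is a maximal ordered set of nonrepeating arrows of $Q$ in which the product of any two neighbouring arrows is nonzero in $A$. A bounded complex $X$ of finitely generated projective $A$-modules is called partial tilting if $\mathrm{Hom}_{D^b(A)}(X,X[i])=0$ for all $i\neq 0$. Let $T=(P_0\overset{f}{\to}P_1)$, with $P_0=\bigoplus_{i\in I}Ae_i$ in degree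 $0$ and $P_1=\bigoplus_{j\in J}Ae_j$ in degree $1$, be the minimal projective presentation of an indecomposable nonprojective $A$-module (so that the module is $\operatorname{coker} f$). The diagram of $T$ consists of the vertices in $I\cup J$ and of all directed paths along the cycles of $Q$ from $i\in I$ to $j\in J$ such that the component $Ae_i\to Ae_j$ of $f$ is nonzero. The vertices of $T$ are the vertices of this diagram, marked or passed through. A degree one source (resp. sink) of $T$ is a vertex in $I$ (resp. in $J$) that is incident to exactly one arrow of the diagram. Let $P=Ae_p$ be an indecomposable projective module, regarded as a stalk complex. 1) If $P$ is concentrated in degree $0$ and $T\oplus P$ is partial tilting, then $\mathrm{Hom}_{K^b(A)}(T,P)\neq 0$ if and only if there are a degree one source $x$ of $T$ and an $A$-cycle containing both $x$ and $p$ such that $x$ is the only vertex of $T$ belonging to this $A$-cycle. 2) If $P$ is concentrated in degree $1$ and $T\oplus P$ is partial tilting, then $\mathrm{Hom}_{K^b(A)}(T,P)\neq 0$ if and only if there are a degree one sink $x$ of $T$ and an $A$-cycle containing both $x$ and $p$ such that $x$ is the only vertex of $T$ belonging to this $A$-cycle. -/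

import Mathlib

open CategoryTheory Limits

universe u v w

noncomputable section

/-- A Brauer tree (with multiplicity one): a tree together with a cyclic ordering of the edges
incident to each vertex.  A dart `d` of the tree is an edge `d.edge` together with one of its
endpoints `d.fst`; `next d` is the edge following `d.edge` in the cyclic order at `d.fst`. -/
structure BrauerTree (V : Type v) where
  /-- the underlying graph -/
  graph : SimpleGraph V
  isTree : graph.IsTree
  /-- the successor in the cyclic orderings -/
  next : Equiv.Perm graph.Dart
  next_fst : ∀ d, (next d).fst = d.fst
  next_cyclic : ∀ d d' : graph.Dart, d.fst = d'.fst → next.SameCycle d d'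

namespace BrauerTree

variable {V : Type v} (Γ : BrauerTree V)

/-- The edges of the tree; these are the vertices of the Brauer quiver. -/
abbrev Edge : Type v := Γ.graph.edgeSet

/-- The arrows of the Brauer quiver.  For every edge `i` and every endpoint of `i` there is one
arrow, from `i` to the edge that follows `i` in the cyclic order at that endpoint (a loop if the
endpoint is a leaf of the tree). -/
abbrev Arrow : Type v := Γ.graph.Dart

/-- The starting vertex of an arrow of the Brauer quiver. -/
def src (d : Γ.Arrow) : Γ.Edge := ⟨d.edge, d.edge_mem⟩

/-- The end vertex of an arrow of the Brauer quiver. -/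
def tgt (d : Γ.Arrow) : Γ.Edge := Γ.src (Γ.next d)

instance edgeFintype [Fintype V] : Fintype Γ.Edge := Fintype.ofFinite _

section Algebra

variable (K : Type u) [Field K]

/-- The trivial path at a vertex of the Brauer quiver, as a generator. -/
def genVertex (i : Γ.Edge) : FreeAlgebra K (Γ.Edge ⊕ Γ.Arrow) := FreeAlgebra.ι K (Sum.inl i)

/-- An arrow of the Brauer quiver, as a generator. -/
def genArrow (d : Γ.Arrow) : FreeAlgebra K (Γ.Edge ⊕ Γ.Arrow) := FreeAlgebra.ι K (Sum.inr d)

/-- The product of the arrows of the cycle through `d`, each taken once, starting with `d`. -/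
def genCycle (d : Γ.Arrow) : FreeAlgebra K (Γ.Edge ⊕ Γ.Arrow) :=
  ((List.range (Function.minimalPeriod Γ.next d)).map
    (fun k => Γ.genArrow K ((Γ.next ^ k) d))).prod

/-- The relations of the Brauer tree algebra.  The first five present the path algebra of the
Brauer quiver, where the product `a b` is "first `a`, then `b`"; the last two are the relations
`αβ = 0 = βα` and `α ^ x_α = β ^ x_β` at each vertex `x`. -/
inductive Rel [Fintype V] :
    FreeAlgebra K (Γ.Edge ⊕ Γ.Arrow) → FreeAlgebra K (Γ.Edge ⊕ Γ.Arrow) → Prop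
  | idem (i : Γ.Edge) : Rel (Γ.genVertex K i * Γ.genVertex K i) (Γ.genVertex K i)
  | orth (i j : Γ.Edge) (h : i ≠ j) : Rel (Γ.genVertex K i * Γ.genVertex K j) 0
  | one : Rel (∑ i : Γ.Edge, Γ.genVertex K i) 1
  | src_mul (d : Γ.Arrow) : Rel (Γ.genVertex K (Γ.src d) * Γ.genArrow K d) (Γ.genArrow K d)
  | mul_tgt (d : Γ.Arrow) : Rel (Γ.genArrow K d * Γ.genVertex K (Γ.tgt d)) (Γ.genArrow K d)
  | alpha_beta (d : Γ.Arrow) : Rel (Γ.genArrow K d * Γ.genArrow K (Γ.next d).symm) 0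
  | cycle (d : Γ.Arrow) : Rel (Γ.genCycle K d) (Γ.genCycle K d.symm)

variable [Fintype V]

/-- The basic Brauer tree algebra with multiplicity one. -/
def Alg : Type (max u v) := RingQuot (Γ.Rel K)

instance : Ring (Γ.Alg K) := inferInstanceAs (Ring (RingQuot (Γ.Rel K)))

instance : Algebra K (Γ.Alg K) := inferInstanceAs (Algebra K (RingQuot (Γ.Rel K)))

/-- The projection from the free algebra on the vertices and arrows onto the algebra. -/
def toAlg : FreeAlgebra K (Γ.Edge ⊕ Γ.Arrow) →ₐ[K] Γ.Alg K := RingQuot.mkAlgHom K (Γ.Rel K)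

/-- The idempotent of a vertex of the quiver. -/
def e (i : Γ.Edge) : Γ.Alg K := Γ.toAlg K (Γ.genVertex K i)

/-- The class of an arrow of the quiver. -/
def arrow (d : Γ.Arrow) : Γ.Alg K := Γ.toAlg K (Γ.genArrow K d)

/-- The indecomposable projective left module `A e_i`. -/
abbrev Proj (i : Γ.Edge) : Submodule (Γ.Alg K) (Γ.Alg K) := Submodule.span (Γ.Alg K) {Γ.e K i}

/-- An ordered set of nonrepeating arrows in which the product of any two neighbouring arrows is
nonzero. -/
def IsArrowChain (c : List Γ.Arrow) : Prop :=
  c ≠ [] ∧ c.Nodup ∧ c.IsChain (fun d d' => Γ.arrow K d * Γ.arrow K d' ≠ 0)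

/-- An `A`-cycle: a maximal ordered set of nonrepeating arrows such that the product of any two
neighbouring arrows is nonzero. -/
def IsACycle (c : List Γ.Arrow) : Prop :=
  Γ.IsArrowChain K c ∧ ∀ c' : List Γ.Arrow, Γ.IsArrowChain K c' → c <:+: c' → c' = c

end Algebra

/-- The vertex `x` of the quiver belongs to the set `c` of arrows. -/
def OnCycle (c : List Γ.Arrow) (x : Γ.Edge) : Prop := ∃ d ∈ c, Γ.src d = x ∨ Γ.tgt d = x

/-- The arrows of the directed path from `i` to `j`: one starts with an arrow `d` at `i` and
follows the cycle of `d` up to the first arrival at `j`.  (For `i ≠ j` this is possible only along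
the cycle at a common endpoint of `i` and `j`, and there is at most one such endpoint.) -/
def pathArrows (i j : Γ.Edge) : Set Γ.Arrow :=
  {a | ∃ (d : Γ.Arrow) (m : ℕ), Γ.src d = i ∧ Γ.src ((Γ.next ^ m) d) = j ∧
    (∀ k < m, Γ.src ((Γ.next ^ k) d) ≠ j) ∧ ∃ k < m, a = (Γ.next ^ k) d}

end BrauerTree

/-- A homomorphism `P₀ → P₁` with `P₀ = ⨁ₛ A e_{I s}` and `P₁ = ⨁ₜ A e_{J t}` (finite direct
sums, realised as products). -/
structure TwoTerm {V : Type v} [Fintype V] (Γ : BrauerTree V) (K : Type u) [Field K] where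
  /-- number of summands of `P₀` -/
  m : ℕ
  /-- number of summands of `P₁` -/
  n : ℕ
  /-- vertices of the summands of `P₀` -/
  I : Fin m → Γ.Edge
  /-- vertices of the summands of `P₁` -/
  J : Fin n → Γ.Edge
  /-- the homomorphism -/
  f : (∀ s, Γ.Proj K (I s)) →ₗ[Γ.Alg K] (∀ t, Γ.Proj K (J t))

/-- A submodule is superfluous if it is not needed in any sum that is the whole module. -/
def IsSuperfluousSubmodule {R : Type*} [Ring R] {M : Type*} [AddCommGroup M] [Module R M]
    (N : Submodule R M) : Prop := ∀ X : Submodule R M, N ⊔ X = ⊤ → X = ⊤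

/-- Indecomposable modules. -/
def IsIndecomposableModule (R : Type*) [Ring R] (M : Type*) [AddCommGroup M] [Module R M] : Prop :=
  Nontrivial M ∧ ∀ N N' : Submodule R M, IsCompl N N' → N = ⊥ ∨ N' = ⊥

namespace TwoTerm

variable {V : Type v} [Fintype V] {Γ : BrauerTree V} {K : Type u} [Field K] (T : TwoTerm Γ K)

/-- `P₀ → P₁` is the minimal projective presentation of `M`: there is an exact sequence
`P₀ → P₁ → M → 0` in which `P₁ → M` and `P₀ → ker (P₁ → M)` are projective covers. -/
def IsMinimalPresentation (M : Type*) [AddCommGroup M] [Module (Γ.Alg K) M] : Prop :=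
  ∃ p : (∀ t, Γ.Proj K (T.J t)) →ₗ[Γ.Alg K] M,
    Function.Surjective p ∧ LinearMap.range T.f = LinearMap.ker p ∧
      IsSuperfluousSubmodule (LinearMap.ker p) ∧ IsSuperfluousSubmodule (LinearMap.ker T.f)

/-- The component `A e_{I s} → A e_{J t}` of `P₀ → P₁`. -/
def component (s : Fin T.m) (t : Fin T.n) :
    Γ.Proj K (T.I s) →ₗ[Γ.Alg K] Γ.Proj K (T.J t) :=
  LinearMap.proj t ∘ₗ T.f ∘ₗ LinearMap.single (Γ.Alg K) (fun s => Γ.Proj K (T.I s)) s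

/-- The arrows of the diagram of `P₀ → P₁`: those on the paths from `I s` to `J t` for which the
corresponding component is nonzero. -/
def diagramArrows : Set Γ.Arrow :=
  {a | ∃ s t, T.component s t ≠ 0 ∧ a ∈ Γ.pathArrows (T.I s) (T.J t)}

/-- The vertices of the diagram: the marked vertices and the vertices on the marked paths. -/
def diagramVertices : Set Γ.Edge :=
  Set.range T.I ∪ Set.range T.J ∪ {x | ∃ a ∈ T.diagramArrows, Γ.src a = x ∨ Γ.tgt a = x}

/-- `x` is incident to exactly one arrow of the diagram. -/
def HasDegreeOne (x : Γ.Edge) : Prop :=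
  ∃! a, a ∈ T.diagramArrows ∧ (Γ.src a = x ∨ Γ.tgt a = x)

/-- `x` is a source of degree one of the diagram. -/
def IsDegreeOneSource (x : Γ.Edge) : Prop := x ∈ Set.range T.I ∧ T.HasDegreeOne x

/-- `x` is a sink of degree one of the diagram. -/
def IsDegreeOneSink (x : Γ.Edge) : Prop := x ∈ Set.range T.J ∧ T.HasDegreeOne x

/-- The complex `P₀ → P₁`, with `P₀` in degree `0` and `P₁` in degree `1`. -/
def complex : CochainComplex (ModuleCat.{max u v} (Γ.Alg K)) ℤ :=
  HomologicalComplex.double (c := ComplexShape.up ℤ) (i₀ := 0) (i₁ := 1)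
    (ModuleCat.ofHom T.f) rfl

end TwoTerm

/-- The stalk complex of `A e_j` concentrated in degree `k`. -/
def BrauerTree.stalk {V : Type v} [Fintype V] (Γ : BrauerTree V) (K : Type u) [Field K]
    (j : Γ.Edge) (k : ℤ) : CochainComplex (ModuleCat.{max u v} (Γ.Alg K)) ℤ :=
  (HomologicalComplex.single (ModuleCat.{max u v} (Γ.Alg K)) (ComplexShape.up ℤ) k).obj
    (ModuleCat.of (Γ.Alg K) (Γ.Proj K j))

section Complexes

universe r s

variable {R : Type r} [Ring R]

/-- Bounded complexes of finitely generated projective modules. -/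
def IsPerfectComplex (X : CochainComplex (ModuleCat.{s} R) ℤ) : Prop :=
  (∀ k, Module.Finite R (X.X k) ∧ Module.Projective R (X.X k)) ∧
    ∃ a b : ℤ, ∀ k, k < a ∨ b < k → IsZero (X.X k)

/-- Partial tilting complexes: perfect complexes `X` with `Hom(X, X[i]) = 0` in the derived
category for all `i ≠ 0`. -/
def IsPartialTilting [HasDerivedCategory.{w} (ModuleCat.{s} R)]
    (X : CochainComplex (ModuleCat.{s} R) ℤ) : Prop :=
  IsPerfectComplex X ∧
    ∀ i : ℤ, i ≠ 0 → ∀ φ : DerivedCategory.Q.obj X ⟶ (DerivedCategory.Q.obj X)⟦i⟧, φ = 0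

/-- `Hom(X, Y) ≠ 0` in the homotopy category. (The bounded homotopy category is a full
subcategory of it.) -/
def HomotopyHomNonzero (X Y : CochainComplex (ModuleCat.{s} R) ℤ) : Prop :=
  ∃ φ : (HomotopyCategory.quotient (ModuleCat.{s} R) (ComplexShape.up ℤ)).obj X ⟶
    (HomotopyCategory.quotient (ModuleCat.{s} R) (ComplexShape.up ℤ)).obj Y, φ ≠ 0

end Complexes

end

/-! Partial tilting is used through two consequences. First, `T` has no self-extension, so every
homomorphism `P₀ → P₁` has the form `fφ - ψf` (`IsRigidHom`); with minimality this forces the sets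
`I` and `J` to be disjoint (`IsRigidHom.ne`). Second, precomposition with `f`, from `Hom(P₁, P)` to
`Hom(P₀, P)`, is injective in part 1 and surjective in part 2. A nonzero `Hom(T, P)` then means a
strict inequality of dimensions. The dimension of `e_i A e_p` counts the ends of the edge `i` at the
endpoints of `p` (`finrank_corner`). So around `p` there is a surplus of ends of `I`-edges in part
1, and of `J`-edges in part 2.

To exploit the surplus one needs the shape of `T`. Draw each summand of `P₀` and `P₁` as a strand
parallel to its edge, and match ends of `I`-strands with ends of `J`-strands at each tree vertex,
shortest arcs first. The matrix of paths along the matched arcs is rigid (`isRigidHom_hom`): a path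
between unmatched ends either factors through a matched arc or is pushed along two parallel strings
until they separate or end. Two rigid homomorphisms between the same modules over an infinite field
are isomorphic (`exists_equiv_of_rigid`), so `f` is isomorphic to the matching homomorphism, and
indecomposability of the cokernel makes the matching connected (`eq_univ_of_linked_closed`).

The surplus leaves some end unmatched (`exists_free_left`, `exists_free_right`). Followed from this
free end, the string moves steadily away in the tree (`Reach.dist`) and contains every strand. Hence
no other strand touches the free end, and the opposite end meets only the strand itself and its
partner (`free_end_structure`). This gives a degree one vertex of the diagram and an isolated
`A`-cycle.

Conversely, on an isolated cycle through `x` and `p`, a path from `x` to `p` gives the required map: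
for a source, the path (the idempotent if `x = p`) does not factor through `f`; for a sink, the path
(the full cycle if `x = p`) is killed by `f`. Both hold because the entries of `f` are radical and
no other marked vertex lies on the cycle. -/

set_option linter.unusedSectionVars false

noncomputable section

/-! ### Morphisms of two-term complexes and stalk complexes -/

section Homological

open CochainComplex.HomComplex HomologicalComplex

variable {C : Type*} [Category* C] [Abelian C]

/-- If all morphisms `X ⟶ X⟦n⟧` in the derived category vanish and `X` is K-projective, then every
cocycle of degree `n` between retracts of `X` is a coboundary. -/
theorem CochainComplex.exists_cochain_of_retracts [HasDerivedCategory.{w} C]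
    {X Y Z : CochainComplex C ℤ} [X.IsKProjective] {n : ℤ}
    (h : ∀ φ : DerivedCategory.Q.obj X ⟶ (DerivedCategory.Q.obj X)⟦n⟧, φ = 0)
    (i : Y ⟶ X) (r : X ⟶ Y) (hi : i ≫ r = 𝟙 Y) (j : Z ⟶ X) (q : X ⟶ Z) (hj : j ≫ q = 𝟙 Z)
    (z : Cocycle Y Z n) (m : ℤ) (hm : m + 1 = n) :
    ∃ β : Cochain Y Z m, δ m n β = z := by
  have key : ∀ x : Cocycle X X n, x ∈ coboundaries X X n := by
    intro x
    -- For a K-projective source the passage from the homotopy category to the derived category is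
    -- injective on morphisms.
    rw [← CohomologyClass.toHom_mk_eq_zero_iff, CohomologyClass.toHom_mk]
    apply (CochainComplex.IsKProjective.Qh_map_bijective _ _).injective
    rw [Functor.map_zero]
    have h1 := h (DerivedCategory.Q.map (Cocycle.equivHomShift.symm x) ≫
      (DerivedCategory.Q.commShiftIso n).hom.app X)
    have h2 : DerivedCategory.Q.map (Cocycle.equivHomShift.symm x) = 0 := by
      rw [← cancel_mono ((DerivedCategory.Q.commShiftIso n).hom.app X), h1, zero_comp]
    have h3 := DerivedCategory.quotientCompQhIso_hom_naturality (Cocycle.equivHomShift.symm x)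
    rw [h2, comp_zero] at h3
    exact (cancel_mono _).1 (h3.trans zero_comp.symm)
  -- Extend the cocycle to `X` by the retractions, bound it there and restrict the bounding cochain.
  have h1 := key ((z.precomp r).postcomp j)
  rw [mem_coboundaries_iff _ m hm] at h1
  obtain ⟨β, hβ⟩ := h1
  refine ⟨((Cochain.ofHom i).comp β (zero_add m)).comp (Cochain.ofHom q) (add_zero m), ?_⟩
  rw [δ_comp_ofHom, δ_ofHom_comp, hβ]
  ext a b hab
  have hi' : i.f a ≫ r.f a = 𝟙 _ := by rw [← HomologicalComplex.comp_f, hi, id_f]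
  have hj' : j.f b ≫ q.f b = 𝟙 _ := by rw [← HomologicalComplex.comp_f, hj, id_f]
  simp [Cocycle.precomp, Cocycle.postcomp, Cocycle.mk, hj']
  rw [← Category.assoc, hi', Category.id_comp]

variable {X₀ X₁ P : C} (f : X₀ ⟶ X₁)

theorem up_rel_zero_one : (ComplexShape.up ℤ).Rel 0 1 := rfl

/-- A two-term complex in degrees `0` and `1`. -/
abbrev twoTermComplex : CochainComplex C ℤ :=
  HomologicalComplex.double (c := ComplexShape.up ℤ) (i₀ := 0) (i₁ := 1) f up_rel_zero_one

/-- A stalk complex. -/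
abbrev stalkComplex (P : C) (k : ℤ) : CochainComplex C ℤ :=
  (HomologicalComplex.single C (ComplexShape.up ℤ) k).obj P

theorem twoTermComplex_d : (twoTermComplex f).d 0 1 =
    (doubleXIso₀ f up_rel_zero_one).hom ≫ f ≫ (doubleXIso₁ f up_rel_zero_one (by decide)).inv :=
  double_d f up_rel_zero_one (by decide)

/-- Any `g` is a cocycle of degree 1, since the complex vanishes in degrees -1 and 2. The components
of a bounding cochain in degrees 0 and 1 are `φ` and `ψ`. -/
theorem twoTermComplex_rigid
    (h : ∀ z : Cocycle (twoTermComplex f) (twoTermComplex f) 1,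
      ∃ β : Cochain (twoTermComplex f) (twoTermComplex f) 0, δ 0 1 β = z)
    (g : X₀ ⟶ X₁) : ∃ (φ : X₀ ⟶ X₀) (ψ : X₁ ⟶ X₁), g = φ ≫ f - f ≫ ψ := by
  let a := doubleXIso₀ (c := ComplexShape.up ℤ) (i₀ := 0) (i₁ := 1) f up_rel_zero_one
  let b := doubleXIso₁ (c := ComplexShape.up ℤ) (i₀ := 0) (i₁ := 1) f up_rel_zero_one (by decide)
  have d1 : (twoTermComplex f).d 0 1 = a.hom ≫ f ≫ b.inv := twoTermComplex_d f
  let g' : (twoTermComplex f).X 0 ⟶ (twoTermComplex f).X 1 := a.hom ≫ g ≫ b.inv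
  obtain ⟨β, hβ⟩ := h (Cocycle.mk (Cochain.single g' 1) 2 rfl (by
    rw [Cochain.δ_single g' 1 2 rfl (-1) 2 rfl rfl]
    rw [double_d_eq_zero₀ _ _ _ _ (by decide), double_d_eq_zero₀ _ _ _ _ (by decide)]
    simp))
  have h1 := Cochain.congr_v hβ 0 1 rfl
  rw [δ_v 0 1 rfl β 0 1 rfl 0 1 rfl rfl] at h1
  simp only [Cocycle.mk, Cochain.single_v, d1] at h1
  refine ⟨a.inv ≫ β.v 0 0 rfl ≫ a.hom, b.inv ≫ β.v 1 1 rfl ≫ b.hom, ?_⟩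
  have h2 := congrArg (fun t => a.inv ≫ t ≫ b.hom) h1
  simp only [g', Int.negOnePow_one, Preadditive.add_comp, Preadditive.comp_add, Category.assoc,
    Iso.inv_hom_id, Iso.inv_hom_id_assoc, Category.comp_id] at h2
  rw [← h2]
  simp [sub_eq_add_neg]

/-- The condition `f ≫ g = 0` makes `g` a cocycle of degree -1. Coboundaries vanish at this
component, because the differentials of the stalk and out of degree 1 are zero. -/
theorem twoTermComplex_stalk_zero
    (h : ∀ z : Cocycle (twoTermComplex f) (stalkComplex P 0) (-1),
      ∃ β : Cochain (twoTermComplex f) (stalkComplex P 0) (-2), δ (-2) (-1) β = z)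
    (g : X₁ ⟶ P) (hg : f ≫ g = 0) : g = 0 := by
  let b := doubleXIso₁ (c := ComplexShape.up ℤ) (i₀ := 0) (i₁ := 1) f up_rel_zero_one (by decide)
  let c := singleObjXSelf (ComplexShape.up ℤ) 0 P
  let g' : (twoTermComplex f).X 1 ⟶ (stalkComplex P 0).X 0 := b.hom ≫ g ≫ c.inv
  obtain ⟨β, hβ⟩ := h (Cocycle.mk (Cochain.single g' (-1)) 0 rfl (by
    rw [Cochain.δ_single g' (-1) 0 rfl 0 1 rfl rfl, twoTermComplex_d]
    simp [g', b, reassoc_of% hg]))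
  have h1 := Cochain.congr_v hβ 1 0 rfl
  rw [δ_v (-2) (-1) rfl β 1 0 rfl (-1) 2 rfl rfl] at h1
  rw [double_d_eq_zero₀ _ _ _ _ (by decide)] at h1
  simp only [Cocycle.mk, Cochain.single_v, single_obj_d, comp_zero, zero_comp, smul_zero,
    add_zero] at h1
  have h2 := congrArg (fun t => b.inv ≫ t ≫ c.hom) h1
  simpa [g'] using h2.symm

/-- Every `g` is a cocycle, and as the stalk has no differential only the term through `f` of a
coboundary survives, with a sign that the witness absorbs. -/
theorem twoTermComplex_stalk_one
    (h : ∀ z : Cocycle (twoTermComplex f) (stalkComplex P 1) 1,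
      ∃ β : Cochain (twoTermComplex f) (stalkComplex P 1) 0, δ 0 1 β = z)
    (g : X₀ ⟶ P) : ∃ k : X₁ ⟶ P, g = f ≫ k := by
  let a := doubleXIso₀ (c := ComplexShape.up ℤ) (i₀ := 0) (i₁ := 1) f up_rel_zero_one
  let b := doubleXIso₁ (c := ComplexShape.up ℤ) (i₀ := 0) (i₁ := 1) f up_rel_zero_one (by decide)
  have d1 : (twoTermComplex f).d 0 1 = a.hom ≫ f ≫ b.inv := twoTermComplex_d f
  let c := singleObjXSelf (ComplexShape.up ℤ) 1 P
  let g' : (twoTermComplex f).X 0 ⟶ (stalkComplex P 1).X 1 := a.hom ≫ g ≫ c.inv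
  obtain ⟨β, hβ⟩ := h (Cocycle.mk (Cochain.single g' 1) 2 rfl (by
    rw [Cochain.δ_single g' 1 2 rfl (-1) 2 rfl rfl, double_d_eq_zero₀ _ _ _ _ (by decide)]
    simp))
  have h1 := Cochain.congr_v hβ 0 1 rfl
  rw [δ_v 0 1 rfl β 0 1 rfl 0 1 rfl rfl] at h1
  simp only [Cocycle.mk, Cochain.single_v, single_obj_d, comp_zero, zero_add, d1] at h1
  have h2 := congrArg (fun t => a.inv ≫ t ≫ c.hom) h1
  refine ⟨b.inv ≫ (-β.v 1 1 rfl) ≫ c.hom, ?_⟩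
  simp [g', Int.negOnePow_one] at h2 ⊢
  exact h2.symm

theorem quotient_map_eq_zero_iff_exists_cochain {K L : CochainComplex C ℤ} (φ : K ⟶ L) :
    (HomotopyCategory.quotient C (ComplexShape.up ℤ)).map φ = 0 ↔
      ∃ z : Cochain K L (-1), Cochain.ofHom φ = δ (-1) 0 z := by
  rw [HomotopyCategory.quotient_map_eq_zero_iff]
  constructor
  · rintro ⟨h⟩
    obtain ⟨z, hz⟩ := Cochain.equivHomotopy _ _ h
    exact ⟨z, by simpa using hz⟩
  · rintro ⟨z, hz⟩
    exact ⟨(Cochain.equivHomotopy _ _).symm ⟨z, by simpa using hz⟩⟩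

/-- Maps to a stalk in degree 0 are unrestricted maps on `X₀`, and the homotopies are exactly the
maps on `X₁`. -/
theorem homotopy_hom_stalk_zero_iff :
    (∃ φ : (HomotopyCategory.quotient C (ComplexShape.up ℤ)).obj (twoTermComplex f) ⟶
      (HomotopyCategory.quotient C (ComplexShape.up ℤ)).obj (stalkComplex P 0), φ ≠ 0) ↔
      ∃ g : X₀ ⟶ P, ∀ k : X₁ ⟶ P, g ≠ f ≫ k := by
  let a := doubleXIso₀ (c := ComplexShape.up ℤ) (i₀ := 0) (i₁ := 1) f up_rel_zero_one
  let b := doubleXIso₁ (c := ComplexShape.up ℤ) (i₀ := 0) (i₁ := 1) f up_rel_zero_one (by decide)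
  have d1 : (twoTermComplex f).d 0 1 = a.hom ≫ f ≫ b.inv := twoTermComplex_d f
  let c := singleObjXSelf (ComplexShape.up ℤ) 0 P
  have hz : ∀ p : ℤ, p ≠ 0 → IsZero ((stalkComplex P 0).X p) := fun p hp =>
    isZero_single_obj_X _ _ _ _ hp
  constructor
  · rintro ⟨φ, hφ⟩
    obtain ⟨φ, rfl⟩ := (HomotopyCategory.quotient C (ComplexShape.up ℤ)).map_surjective φ
    refine ⟨a.inv ≫ φ.f 0 ≫ c.hom, fun k hk => hφ ?_⟩
    rw [quotient_map_eq_zero_iff_exists_cochain]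
    let k' : (twoTermComplex f).X 1 ⟶ (stalkComplex P 0).X 0 := b.hom ≫ k ≫ c.inv
    refine ⟨Cochain.single k' (-1), ?_⟩
    rw [Cochain.δ_single k' (-1) 0 rfl 0 1 rfl rfl]
    apply Cochain.ext₀
    intro p
    by_cases hp : p = 0
    · subst hp
      have h2 := congrArg (fun t => a.hom ≫ t ≫ c.inv) hk
      simp only [Iso.hom_inv_id_assoc, Category.assoc, Iso.hom_inv_id, Category.comp_id] at h2
      rw [single_obj_d, comp_zero, Cochain.single_zero, zero_add, Cochain.ofHom_v,
        Int.negOnePow_zero, one_smul, Cochain.single_v, h2, d1]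
      simp [k']
    · exact (hz p hp).eq_of_tgt _ _
  · rintro ⟨g, hg⟩
    refine ⟨(HomotopyCategory.quotient C (ComplexShape.up ℤ)).map
      (mkHomFromDouble (K := stalkComplex P 0) (c := ComplexShape.up ℤ) (i₀ := 0) (i₁ := 1) (f := f)
        up_rel_zero_one (by decide) (g ≫ c.inv) 0 (by simp) (by simp)), fun h => ?_⟩
    rw [quotient_map_eq_zero_iff_exists_cochain] at h
    obtain ⟨z, h⟩ := h
    have h1 := Cochain.congr_v h 0 0 rfl
    rw [δ_v (-1) 0 rfl z 0 0 rfl (-1) 1 rfl rfl] at h1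
    simp only [Cochain.ofHom_v, mkHomFromDouble_f₀, single_obj_d, comp_zero, zero_add, d1,
      Int.negOnePow_zero, one_smul] at h1
    have h2 := congrArg (fun t => a.inv ≫ t ≫ c.hom) h1
    refine hg (b.inv ≫ z.v 1 0 rfl ≫ c.hom) ?_
    simpa [a] using h2

/-- Here the chain condition is `f ≫ g = 0`, and there is no room for homotopies. -/
theorem homotopy_hom_stalk_one_iff :
    (∃ φ : (HomotopyCategory.quotient C (ComplexShape.up ℤ)).obj (twoTermComplex f) ⟶
      (HomotopyCategory.quotient C (ComplexShape.up ℤ)).obj (stalkComplex P 1), φ ≠ 0) ↔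
      ∃ g : X₁ ⟶ P, g ≠ 0 ∧ f ≫ g = 0 := by
  let a := doubleXIso₀ (c := ComplexShape.up ℤ) (i₀ := 0) (i₁ := 1) f up_rel_zero_one
  let b := doubleXIso₁ (c := ComplexShape.up ℤ) (i₀ := 0) (i₁ := 1) f up_rel_zero_one (by decide)
  have d1 : (twoTermComplex f).d 0 1 = a.hom ≫ f ≫ b.inv := twoTermComplex_d f
  let c := singleObjXSelf (ComplexShape.up ℤ) 1 P
  have hz : ∀ p : ℤ, p ≠ 1 → IsZero ((stalkComplex P 1).X p) := fun p hp =>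
    isZero_single_obj_X _ _ _ _ hp
  constructor
  · rintro ⟨φ, hφ⟩
    obtain ⟨φ, rfl⟩ := (HomotopyCategory.quotient C (ComplexShape.up ℤ)).map_surjective φ
    refine ⟨b.inv ≫ φ.f 1 ≫ c.hom, fun hk => hφ ?_, ?_⟩
    · have h2 := congrArg (fun t => b.hom ≫ t ≫ c.inv) hk
      simp only [Iso.hom_inv_id_assoc, Category.assoc, Iso.hom_inv_id, Category.comp_id,
        comp_zero, zero_comp] at h2
      have : φ = 0 := by
        apply from_double_hom_ext
        · exact (hz 0 (by decide)).eq_of_tgt _ _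
        · simpa using h2
      rw [this, Functor.map_zero]
    · have h3 : (twoTermComplex f).d 0 1 ≫ φ.f 1 = 0 := by
        rw [← φ.comm 0 1, single_obj_d, comp_zero]
      rw [d1] at h3
      have h2 := congrArg (fun t => a.inv ≫ t ≫ c.hom) h3
      simpa using h2
  · rintro ⟨g, hg, hfg⟩
    refine ⟨(HomotopyCategory.quotient C (ComplexShape.up ℤ)).map
      (mkHomFromDouble (K := stalkComplex P 1) (c := ComplexShape.up ℤ) (i₀ := 0) (i₁ := 1) (f := f)
        up_rel_zero_one (by decide) 0 (g ≫ c.inv) (by simp [reassoc_of% hfg])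
            (by simp)), fun h => hg ?_⟩
    rw [quotient_map_eq_zero_iff_exists_cochain] at h
    obtain ⟨z, h⟩ := h
    have h1 := Cochain.congr_v h 1 1 rfl
    rw [δ_v (-1) 0 rfl z 1 1 rfl 0 2 rfl rfl] at h1
    rw [double_d_eq_zero₀ _ _ _ _ (by decide)] at h1
    simp only [Cochain.ofHom_v, mkHomFromDouble_f₁, single_obj_d, comp_zero, zero_comp, zero_add,
      smul_zero] at h1
    have h2 := congrArg (fun t => b.inv ≫ t ≫ c.hom) h1
    simpa [b] using h2

end Homological

section Perfect

universe r s

variable {R : Type r} [Ring R]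

theorem IsPerfectComplex.isKProjective {X : CochainComplex (ModuleCat.{s} R) ℤ}
    (hX : IsPerfectComplex X) : X.IsKProjective := by
  obtain ⟨h1, a, b, h2⟩ := hX
  have : X.IsStrictlyLE b := by
    rw [CochainComplex.isStrictlyLE_iff]
    exact fun i hi => h2 i (Or.inr hi)
  have : ∀ n, Projective (X.X n) := fun n => by
    have := (h1 n).2
    infer_instance
  exact CochainComplex.isKProjective_of_projective X b

end Perfect

/-! ### Stable matchings and distances in trees -/

section Matching

/-- Stable matchings exist when both sides rank admissible pairs by the same cost function. -/
theorem exists_stable_matching {α β L : Type*} [Finite α] [Finite β] [LinearOrder L]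
    (adm : α → β → Prop) (cost : α → β → L) :
    ∃ M : α → β → Prop, (∀ a b, M a b → adm a b) ∧ (∀ a b b', M a b → M a b' → b = b') ∧
      (∀ a a' b, M a b → M a' b → a = a') ∧
      ∀ a b, adm a b → (∃ b', M a b' ∧ cost a b' ≤ cost a b) ∨
        (∃ a', M a' b ∧ cost a' b ≤ cost a b) := by
  classical
  have key : ∀ (n : ℕ) (E : Set (α × β)), E.ncard = n →
      ∃ M : α → β → Prop, (∀ a b, M a b → (a, b) ∈ E) ∧ (∀ a b b', M a b → M a b' → b = b') ∧
      (∀ a a' b, M a b → M a' b → a = a') ∧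
      ∀ a b, (a, b) ∈ E → (∃ b', M a b' ∧ cost a b' ≤ cost a b) ∨
        (∃ a', M a' b ∧ cost a' b ≤ cost a b) := by
    intro n
    induction n using Nat.strong_induction_on with
    | _ n ih =>
      intro E hE
      rcases E.eq_empty_or_nonempty with rfl | hne
      · exact ⟨fun _ _ => False, by simp⟩
      -- Greedy choice: a cheapest pair is matched, and it blocks every pair in its row and column,
      -- which are then deleted.
      obtain ⟨⟨x, y⟩, hxy, hmin⟩ := Set.exists_min_image E (fun e => cost e.1 e.2) E.toFinite hne
      let E' : Set (α × β) := {e ∈ E | e.1 ≠ x ∧ e.2 ≠ y}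
      have hlt : E'.ncard < n := by
        rw [← hE]
        refine Set.ncard_lt_ncard ⟨fun e he => he.1, fun h => ?_⟩ E.toFinite
        exact (h hxy).2.1 rfl
      obtain ⟨M, h1, h2, h3, h4⟩ := ih _ hlt E' rfl
      refine ⟨fun a b => M a b ∨ (a = x ∧ b = y), ?_, ?_, ?_, ?_⟩
      · rintro a b (h | ⟨rfl, rfl⟩)
        · exact (h1 a b h).1
        · exact hxy
      · rintro a b b' (h | ⟨rfl, rfl⟩) (h' | ⟨h', rfl⟩)
        · exact h2 a b b' h h'
        · exact absurd h' (h1 a b h).2.1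
        · exact absurd rfl (h1 _ b' h').2.1
        · rfl
      · rintro a a' b (h | ⟨rfl, rfl⟩) (h' | ⟨rfl, h'⟩)
        · exact h3 a a' b h h'
        · exact absurd h' (h1 a b h).2.2
        · exact absurd rfl (h1 a' _ h').2.2
        · rfl
      · intro a b hab
        by_cases ha : a = x
        · subst ha
          exact Or.inl ⟨y, Or.inr ⟨rfl, rfl⟩, hmin _ hab⟩
        by_cases hb : b = y
        · subst hb
          exact Or.inr ⟨x, Or.inr ⟨rfl, rfl⟩, hmin _ hab⟩
        rcases h4 a b ⟨hab, ha, hb⟩ with ⟨b', h, h'⟩ | ⟨a', h, h'⟩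
        · exact Or.inl ⟨b', Or.inl h, h'⟩
        · exact Or.inr ⟨a', Or.inl h, h'⟩
  exact key _ {e | adm e.1 e.2} rfl

end Matching

/-- In a tree, a non-backtracking step keeps moving away from the root. -/
theorem SimpleGraph.IsTree.dist_eq_add_one_of_ne {V : Type*} {G : SimpleGraph V} (hG : G.IsTree)
    {r a b c : V} (hab : G.Adj a b) (hbc : G.Adj b c) (hca : c ≠ a)
    (h : G.dist r b = G.dist r a + 1) : G.dist r c = G.dist r b + 1 := by
  rcases hG.dist_eq_dist_add_one_of_adj r hbc with h' | h'
  -- Otherwise geodesics from `r` through `a` and through `c` would be two different paths to `b`.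
  · exfalso
    obtain ⟨p, hp⟩ := (hG.connected r a).exists_walk_length_eq_dist
    obtain ⟨q, hq⟩ := (hG.connected r c).exists_walk_length_eq_dist
    have h1 : (p.concat hab).IsPath :=
      Walk.isPath_of_length_eq_dist _ (by rw [Walk.length_concat, hp, h])
    have h2 : (q.concat hbc.symm).IsPath :=
      Walk.isPath_of_length_eq_dist _ (by rw [Walk.length_concat, hq, h'])
    have h3 := (hG.existsUnique_path r b).unique h1 h2
    obtain ⟨h4, -⟩ := Walk.concat_inj h3
    exact hca h4.symm
  · exact h'

/-! ### Rigid homomorphisms between fixed modules are isomorphic -/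

section Deformation

open Polynomial Module

variable {K R P Q : Type*} [Field K] [Ring R] [Algebra K R]
  [AddCommGroup P] [Module K P] [Module R P] [IsScalarTower K R P] [FiniteDimensional K P]
  [AddCommGroup Q] [Module K Q] [Module R Q] [IsScalarTower K R Q] [FiniteDimensional K Q]

theorem finiteDimensional_linearMap_of_algebra :
    FiniteDimensional K (P →ₗ[R] Q) := by
  refine Module.Finite.of_injective
    (LinearMap.restrictScalarsₗ K R P Q K : (P →ₗ[R] Q) →ₗ[K] (P →ₗ[K] Q)) ?_
  exact LinearMap.restrictScalars_injective K

/-- A polynomial family of endomorphisms that is invertible at `0` is invertible outside the zeros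
of a nonzero polynomial. -/
theorem exists_polynomial_forall_bijective {ι : Type*} [Fintype ι] (y : ι → K[X])
    (b : ι → P →ₗ[R] P) (h0 : ∑ k, (y k).eval 0 • b k = LinearMap.id) :
    ∃ p : K[X], p ≠ 0 ∧ ∀ l : K, p.eval l ≠ 0 →
      Function.Bijective (∑ k, (y k).eval l • b k : P →ₗ[R] P) := by
  classical
  let e := Module.finBasis K P
  let m : ι → Matrix _ _ K := fun k => LinearMap.toMatrix e e ((b k).restrictScalars K)
  -- The determinant of the family, a polynomial with value 1 at 0.
  let p : K[X] := (∑ k, y k • (m k).map (C : K →+* K[X])).det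
  have hp : ∀ l : K, p.eval l =
      LinearMap.det ((∑ k, (y k).eval l • b k : P →ₗ[R] P).restrictScalars K) := by
    intro l
    rw [← LinearMap.det_toMatrix e]
    change (Polynomial.evalRingHom l) p = _
    rw [RingHom.map_det]
    congr 1
    have : ((∑ k, (y k).eval l • b k : P →ₗ[R] P).restrictScalars K) =
        ∑ k, (y k).eval l • ((b k).restrictScalars K) := by
      ext x
      simp
    rw [this, map_sum]
    ext i j
    simp [Matrix.sum_apply, m]
  refine ⟨p, fun h => ?_, fun l hl => ?_⟩
  · have := hp 0
    rw [h0, h] at this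
    have h2 : (LinearMap.id : P →ₗ[R] P).restrictScalars K = LinearMap.id := rfl
    simp [h2] at this
  · rw [hp] at hl
    exact (LinearMap.equivOfDetNeZero _ hl).bijective

/-- Rigid homomorphisms deform trivially along lines. -/
theorem exists_polynomial_forall_equiv_of_rigid (f n : P →ₗ[R] Q)
    (hf : ∀ g : P →ₗ[R] Q, ∃ (φ : P →ₗ[R] P) (ψ : Q →ₗ[R] Q), g = f ∘ₗ φ - ψ ∘ₗ f) :
    ∃ p : K[X], p ≠ 0 ∧ ∀ l : K, p.eval l ≠ 0 →
      ∃ (φ : P ≃ₗ[R] P) (ψ : Q ≃ₗ[R] Q), ψ.toLinearMap ∘ₗ f = (f + l • n) ∘ₗ φ.toLinearMap := by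
  classical
  have : FiniteDimensional K (P →ₗ[R] P) := finiteDimensional_linearMap_of_algebra
  have : FiniteDimensional K (Q →ₗ[R] Q) := finiteDimensional_linearMap_of_algebra
  let D : ((P →ₗ[R] P) × (Q →ₗ[R] Q)) →ₗ[K] (P →ₗ[R] Q) :=
    { toFun := fun x => f ∘ₗ x.1 - x.2 ∘ₗ f
      map_add' := fun x y => by
        ext v
        simp
        abel
      map_smul' := fun c x => by
        ext v
        simp [smul_sub] }
  have hD : LinearMap.range D = ⊤ := by
    rw [LinearMap.range_eq_top]
    intro g
    obtain ⟨φ, ψ, h⟩ := hf g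
    exact ⟨(φ, ψ), h.symm⟩
  -- With a section of `D` the equation `ψ f = (f + l n) φ`, that is `D x + l N x = 0`, follows once
  -- `x + l S (N x)` is a multiple of the identity pair `o`, because `D o = 0`.
  obtain ⟨S, hS⟩ := LinearMap.exists_rightInverse_of_surjective D hD
  let N : ((P →ₗ[R] P) × (Q →ₗ[R] Q)) →ₗ[K] (P →ₗ[R] Q) :=
    { toFun := fun x => n ∘ₗ x.1
      map_add' := fun x y => by
        ext v
        simp
      map_smul' := fun c x => by
        ext v
        simp }
  let B := S ∘ₗ N
  let b := Module.finBasis K ((P →ₗ[R] P) × (Q →ₗ[R] Q))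
  let o : (P →ₗ[R] P) × (Q →ₗ[R] Q) := (LinearMap.id, LinearMap.id)
  let mB := LinearMap.toMatrix b b B
  let A : Matrix _ _ K[X] := 1 + (X : K[X]) • mB.map (C : K →+* K[X])
  -- Cramer's rule: the adjugate replaces the inverse of `1 + l B`, so the solution is polynomial in
  -- `l`, at the price of the determinant in `hgB`.
  let y := A.adjugate.mulVec (fun k => C (b.repr o k))
  let g : K → (P →ₗ[R] P) × (Q →ₗ[R] Q) := fun l => ∑ k, (y k).eval l • b k
  have hA : ∀ l : K, A.map (Polynomial.evalRingHom l) = 1 + l • mB := by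
    intro l
    ext i j
    by_cases hij : i = j <;> simp [A, hij, mul_comm l]
  have hg : ∀ l : K, b.repr (g l) = (1 + l • mB).adjugate.mulVec (b.repr o) := by
    intro l
    ext i
    have h1 : (b.repr (g l)) i = (y i).eval l := by
      simp [g, Finsupp.single_apply]
    rw [h1, ← hA l, ← RingHom.mapMatrix_apply, ← RingHom.map_adjugate]
    simp [y, Matrix.mulVec, dotProduct, Polynomial.eval_finsetSum]
  have hg0 : g 0 = o := by
    apply b.repr.injective
    ext i
    rw [hg]
    simp
  have hgB : ∀ l : K, g l + l • B (g l) = (1 + l • mB).det • o := by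
    intro l
    apply b.repr.injective
    ext i
    have h1 : (b.repr (B (g l)) : _ → K) = mB.mulVec (b.repr (g l)) :=
      (LinearMap.toMatrix_mulVec_repr b b B (g l)).symm
    have h2 : (1 + l • mB).mulVec (b.repr (g l)) = (1 + l • mB).det • (b.repr o : _ → K) := by
      rw [hg, Matrix.mulVec_mulVec, Matrix.mul_adjugate, Matrix.smul_mulVec, Matrix.one_mulVec]
    have h3 := congrFun h2 i
    rw [Matrix.add_mulVec, Matrix.one_mulVec, Matrix.smul_mulVec, ← h1] at h3
    simpa using h3
  have hDo : D o = 0 := by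
    ext v
    simp [D, o]
  have hker : ∀ l : K, (g l).2 ∘ₗ f = (f + l • n) ∘ₗ (g l).1 := by
    intro l
    have h1 := congrArg D (hgB l)
    rw [map_add, map_smul, map_smul, hDo, smul_zero] at h1
    have h2 : D (B (g l)) = N (g l) := LinearMap.congr_fun hS (N (g l))
    rw [h2] at h1
    have h3 : f ∘ₗ (g l).1 - (g l).2 ∘ₗ f + l • (n ∘ₗ (g l).1) = 0 := h1
    rw [LinearMap.add_comp, LinearMap.smul_comp, ← sub_eq_zero, ← neg_eq_zero]
    rw [← h3]
    abel
  have g1 : ∀ l, (g l).1 = ∑ k, (y k).eval l • (b k).1 := by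
    intro l
    simp [g, Prod.fst_sum]
  have g2 : ∀ l, (g l).2 = ∑ k, (y k).eval l • (b k).2 := by
    intro l
    simp [g, Prod.snd_sum]
  obtain ⟨p, hp0, hp⟩ := exists_polynomial_forall_bijective (K := K) y (fun k => (b k).1)
    (by rw [← g1, hg0])
  obtain ⟨q, hq0, hq⟩ := exists_polynomial_forall_bijective (K := K) y (fun k => (b k).2)
    (by rw [← g2, hg0])
  refine ⟨p * q, mul_ne_zero hp0 hq0, fun l hl => ?_⟩
  rw [Polynomial.eval_mul] at hl
  have b1 := hp l (left_ne_zero_of_mul hl)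
  have b2 := hq l (right_ne_zero_of_mul hl)
  rw [← g1] at b1
  rw [← g2] at b2
  exact ⟨LinearEquiv.ofBijective _ b1, LinearEquiv.ofBijective _ b2, hker l⟩

variable (K) in
/-- Two rigid homomorphisms between the same modules are isomorphic. -/
theorem exists_equiv_of_rigid [Infinite K] (f f' : P →ₗ[R] Q)
    (hf : ∀ g : P →ₗ[R] Q, ∃ (φ : P →ₗ[R] P) (ψ : Q →ₗ[R] Q), g = f ∘ₗ φ - ψ ∘ₗ f)
    (hf' : ∀ g : P →ₗ[R] Q, ∃ (φ : P →ₗ[R] P) (ψ : Q →ₗ[R] Q), g = f' ∘ₗ φ - ψ ∘ₗ f') :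
    ∃ (φ : P ≃ₗ[R] P) (ψ : Q ≃ₗ[R] Q), ψ.toLinearMap ∘ₗ f = f' ∘ₗ φ.toLinearMap := by
  classical
  obtain ⟨p, hp0, hp⟩ := exists_polynomial_forall_equiv_of_rigid (K := K) f (f' - f) hf
  obtain ⟨q, hq0, hq⟩ := exists_polynomial_forall_equiv_of_rigid (K := K) f' (f - f') hf'
  -- The line joining `f` and `f'` is deformed from both ends. Away from finitely many parameters
  -- its point at `l` is isomorphic to `f` and to `f'`.
  obtain ⟨l, hl⟩ := Infinite.exists_notMem_finset
    (p.roots.toFinset ∪ q.roots.toFinset.image (fun x => 1 - x))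
  simp only [Finset.mem_union, Multiset.mem_toFinset, Finset.mem_image, not_or, not_exists,
    not_and] at hl
  obtain ⟨φ, ψ, h1⟩ := hp l (fun h => hl.1 ((mem_roots hp0).2 h))
  obtain ⟨φ', ψ', h2⟩ := hq (1 - l) (fun h => hl.2 (1 - l) ((mem_roots hq0).2 h) (by ring))
  have h3 : f' + (1 - l) • (f - f') = f + l • (f' - f) := by
    ext v
    simp only [LinearMap.add_apply, LinearMap.smul_apply, LinearMap.sub_apply, smul_sub, sub_smul,
      one_smul]
    abel
  rw [h3] at h2
  refine ⟨φ.trans φ'.symm, ψ.trans ψ'.symm, ?_⟩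
  ext v
  apply ψ'.injective
  have e1 := LinearMap.congr_fun h1 v
  have e2 := LinearMap.congr_fun h2 (φ'.symm (φ v))
  simp only [LinearMap.comp_apply, LinearEquiv.coe_coe, LinearEquiv.apply_symm_apply,
    LinearEquiv.trans_apply] at e1 e2 ⊢
  rw [e1, e2]

end Deformation

namespace BrauerTree

variable {V : Type v} (Γ : BrauerTree V)

/-! ### Darts and steps around a tree vertex -/

section Combinatorics

theorem src_eq_src_iff {d d' : Γ.Arrow} : Γ.src d = Γ.src d' ↔ d = d' ∨ d = d'.symm := by
  rw [src, src, Subtype.mk.injEq]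
  exact SimpleGraph.dart_edge_eq_iff d d'

theorem src_symm (d : Γ.Arrow) : Γ.src d.symm = Γ.src d :=
  Γ.src_eq_src_iff.2 (Or.inr rfl)

theorem exists_src_eq (i : Γ.Edge) : ∃ d : Γ.Arrow, Γ.src d = i := by
  obtain ⟨i, hi⟩ := i
  induction i using Sym2.ind with
  | _ a b => exact ⟨⟨(a, b), hi⟩, rfl⟩

theorem fst_ne_snd (d : Γ.Arrow) : d.fst ≠ d.snd := d.adj.ne

theorem fst_ne_fst_symm (d : Γ.Arrow) : d.fst ≠ d.symm.fst := d.adj.ne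

theorem ne_symm (d : Γ.Arrow) : d ≠ d.symm := fun h =>
  Γ.fst_ne_fst_symm d (congrArg (fun x : Γ.graph.Dart => x.fst) h)

theorem eq_of_src_eq_of_fst_eq {d d' : Γ.Arrow} (h : Γ.src d = Γ.src d') (h' : d.fst = d'.fst) :
    d = d' := by
  rcases Γ.src_eq_src_iff.1 h with h1 | h1
  · exact h1
  · subst h1
    exact absurd h' (Γ.fst_ne_fst_symm d').symm

theorem eq_of_fst_eq_of_snd_eq {d d' : Γ.Arrow} (h : d.fst = d'.fst) (h' : d.snd = d'.snd) :
    d = d' := SimpleGraph.Dart.ext _ _ (Prod.ext h h')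

theorem next_pow_fst (m : ℕ) (d : Γ.Arrow) : ((Γ.next ^ m) d).fst = d.fst := by
  induction m with
  | zero => rfl
  | succ m ih => rw [pow_succ', Equiv.Perm.mul_apply, Γ.next_fst, ih]

theorem next_pow_succ (m : ℕ) (d : Γ.Arrow) : (Γ.next ^ (m + 1)) d = Γ.next ((Γ.next ^ m) d) := by
  rw [pow_succ', Equiv.Perm.mul_apply]

theorem next_pow_add (m n : ℕ) (d : Γ.Arrow) :
    (Γ.next ^ (m + n)) d = (Γ.next ^ n) ((Γ.next ^ m) d) := by
  rw [add_comm, pow_add, Equiv.Perm.mul_apply]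

instance [Finite V] : Finite Γ.Arrow :=
  Finite.of_injective (fun d : Γ.graph.Dart => d.toProd) (SimpleGraph.Dart.toProd_injective)

/-- The valency of the endpoint of a dart. -/
def per (d : Γ.Arrow) : ℕ := Function.minimalPeriod Γ.next d

theorem next_pow_per (d : Γ.Arrow) : (Γ.next ^ Γ.per d) d = d := by
  rw [← Equiv.Perm.iterate_eq_pow]
  exact Function.iterate_minimalPeriod

theorem per_next_pow [Finite V] (m : ℕ) (d : Γ.Arrow) : Γ.per ((Γ.next ^ m) d) = Γ.per d := by
  rw [← Equiv.Perm.iterate_eq_pow]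
  exact Function.minimalPeriod_apply_iterate (Γ.next.injective.mem_periodicPts d) m

theorem per_pos [Finite V] (d : Γ.Arrow) : 0 < Γ.per d :=
  Function.minimalPeriod_pos_of_mem_periodicPts (Γ.next.injective.mem_periodicPts d)

theorem next_pow_ne {m : ℕ} {d : Γ.Arrow} (h0 : 0 < m) (h : m < Γ.per d) : (Γ.next ^ m) d ≠ d := by
  rw [← Equiv.Perm.iterate_eq_pow]
  exact Function.not_isPeriodicPt_of_pos_of_lt_minimalPeriod h0.ne' h

theorem next_pow_injOn {m n : ℕ} {d : Γ.Arrow} (hm : m < Γ.per d) (hn : n < Γ.per d)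
    (h : (Γ.next ^ m) d = (Γ.next ^ n) d) : m = n := by
  rw [← Equiv.Perm.iterate_eq_pow, ← Equiv.Perm.iterate_eq_pow] at h
  exact Function.iterate_injOn_Iio_minimalPeriod hm hn h

theorem exists_next_pow_eq [Finite V] {d d' : Γ.Arrow} (h : d.fst = d'.fst) :
    ∃ m < Γ.per d, (Γ.next ^ m) d = d' := by
  obtain ⟨n, hn⟩ := (Γ.next_cyclic d d' h).exists_nat_pow_eq
  refine ⟨n % Γ.per d, Nat.mod_lt _ (Γ.per_pos d), ?_⟩
  rw [← Equiv.Perm.iterate_eq_pow, per, Function.iterate_mod_minimalPeriod_eq,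
    Equiv.Perm.iterate_eq_pow, hn]

open Classical in
/-- The number of steps from `d` to `d'` along the cycle at their common endpoint. -/
def steps (d d' : Γ.Arrow) : ℕ := if h : ∃ m, (Γ.next ^ m) d = d' then Nat.find h else 0

variable [Finite V] {Γ}

theorem next_pow_steps {d d' : Γ.Arrow} (h : d.fst = d'.fst) : (Γ.next ^ Γ.steps d d') d = d' := by
  classical
  obtain ⟨m, -, hm⟩ := Γ.exists_next_pow_eq h
  have : ∃ m, (Γ.next ^ m) d = d' := ⟨m, hm⟩
  rw [steps, dif_pos this]
  exact Nat.find_spec this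

theorem steps_lt {d d' : Γ.Arrow} (h : d.fst = d'.fst) : Γ.steps d d' < Γ.per d := by
  classical
  obtain ⟨m, hm', hm⟩ := Γ.exists_next_pow_eq h
  have : ∃ m, (Γ.next ^ m) d = d' := ⟨m, hm⟩
  rw [steps, dif_pos this]
  exact (Nat.find_min' this hm).trans_lt hm'

theorem steps_eq {d : Γ.Arrow} {m : ℕ} (hm : m < Γ.per d) : Γ.steps d ((Γ.next ^ m) d) = m :=
  have h := (Γ.next_pow_fst m d).symm
  Γ.next_pow_injOn (steps_lt h) hm (next_pow_steps h)

theorem steps_pos {d d' : Γ.Arrow} (h : d.fst = d'.fst) (hne : d ≠ d') : 0 < Γ.steps d d' := by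
  rw [Nat.pos_iff_ne_zero]
  intro h0
  have := next_pow_steps h
  rw [h0] at this
  exact hne this

/-- If `d''` comes no later than `d'` on the way round from `d`, then the way to `d'` passes through
it. -/
theorem steps_add_of_le {d d' d'' : Γ.Arrow} (h : d.fst = d'.fst) (h' : d.fst = d''.fst)
    (hle : Γ.steps d d'' ≤ Γ.steps d d') :
    Γ.steps d d' = Γ.steps d d'' + Γ.steps d'' d' := by
  obtain ⟨k, hk⟩ := Nat.exists_eq_add_of_le hle
  have h1 := next_pow_steps h
  rw [hk, next_pow_add, next_pow_steps h'] at h1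
  have h2 : k < Γ.per d'' := by
    rw [← next_pow_steps h', per_next_pow]
    have := steps_lt h
    omega
  have h3 := steps_eq h2
  rw [h1] at h3
  omega

theorem steps_add_of_le' {d d' d'' : Γ.Arrow} (h : d.fst = d'.fst) (h' : d.fst = d''.fst)
    (hle : Γ.steps d'' d' ≤ Γ.steps d d') :
    Γ.steps d d' = Γ.steps d d'' + Γ.steps d'' d' := by
  obtain ⟨k, hk⟩ := Nat.exists_eq_add_of_le' hle
  have h1 := next_pow_steps h
  rw [hk, next_pow_add] at h1
  have h2 : (Γ.next ^ k) d = d'' := by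
    apply (Γ.next ^ Γ.steps d'' d').injective
    rw [h1, next_pow_steps (h'.symm.trans h)]
  have h3 : k < Γ.per d := by
    have := steps_lt h
    omega
  have h4 := steps_eq h3
  rw [h2] at h4
  omega

end Combinatorics

/-! ### Products along a cycle in a monoid -/

section Trail

variable {Γ} {M : Type*} [Monoid M]

/-- The product of the values of `ρ` at the first `m` arrows of the cycle, starting with `d`. -/
def trail (ρ : Γ.Arrow → M) (d : Γ.Arrow) (m : ℕ) : M :=
  ((List.range m).map (fun k => ρ ((Γ.next ^ k) d))).prod

theorem trail_zero (ρ : Γ.Arrow → M) (d : Γ.Arrow) : trail ρ d 0 = 1 := rfl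

theorem trail_succ (ρ : Γ.Arrow → M) (d : Γ.Arrow) (m : ℕ) :
    trail ρ d (m + 1) = trail ρ d m * ρ ((Γ.next ^ m) d) := by
  simp [trail, List.range_succ]

theorem trail_one (ρ : Γ.Arrow → M) (d : Γ.Arrow) : trail ρ d 1 = ρ d := by
  rw [trail_succ, trail_zero, one_mul]
  rfl

theorem trail_add (ρ : Γ.Arrow → M) (d : Γ.Arrow) (m n : ℕ) :
    trail ρ d (m + n) = trail ρ d m * trail ρ ((Γ.next ^ m) d) n := by
  induction n with
  | zero => simp [trail_zero]
  | succ n ih => rw [← add_assoc, trail_succ, ih, trail_succ, mul_assoc, next_pow_add]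

theorem trail_succ' (ρ : Γ.Arrow → M) (d : Γ.Arrow) (m : ℕ) :
    trail ρ d (m + 1) = ρ d * trail ρ (Γ.next d) m := by
  rw [add_comm, trail_add, trail_one, pow_one]

theorem map_trail {N F : Type*} [Monoid N] [FunLike F M N] [MonoidHomClass F M N] (φ : F)
    (ρ : Γ.Arrow → M) (d : Γ.Arrow) (m : ℕ) :
    φ (trail ρ d m) = trail (fun a => φ (ρ a)) d m := by
  rw [trail, map_list_prod, List.map_map]
  rfl

end Trail

/-! ### Paths in the algebra and their products -/

section Relations

theorem genCycle_eq_trail (K : Type u) [Field K] (d : Γ.Arrow) :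
    Γ.genCycle K d = trail (Γ.genArrow K) d (Γ.per d) := rfl

variable (K : Type u) [Field K] [Fintype V]

theorem e_mul_e_self (i : Γ.Edge) : Γ.e K i * Γ.e K i = Γ.e K i := by
  rw [e, ← map_mul]
  exact RingQuot.mkAlgHom_rel K (Rel.idem i)

theorem e_mul_e_of_ne {i j : Γ.Edge} (h : i ≠ j) : Γ.e K i * Γ.e K j = 0 := by
  rw [e, e, ← map_mul]
  exact (RingQuot.mkAlgHom_rel K (Rel.orth i j h)).trans (map_zero _)

theorem sum_e : ∑ i : Γ.Edge, Γ.e K i = 1 := by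
  simp only [e]
  rw [← map_sum]
  exact (RingQuot.mkAlgHom_rel K Rel.one).trans (map_one _)

theorem e_src_mul_arrow (d : Γ.Arrow) : Γ.e K (Γ.src d) * Γ.arrow K d = Γ.arrow K d := by
  rw [e, arrow, ← map_mul]
  exact RingQuot.mkAlgHom_rel K (Rel.src_mul d)

theorem arrow_mul_e_tgt (d : Γ.Arrow) : Γ.arrow K d * Γ.e K (Γ.tgt d) = Γ.arrow K d := by
  rw [e, arrow, ← map_mul]
  exact RingQuot.mkAlgHom_rel K (Rel.mul_tgt d)

theorem arrow_mul_arrow_next_symm (d : Γ.Arrow) :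
    Γ.arrow K d * Γ.arrow K (Γ.next d).symm = 0 := by
  rw [arrow, arrow, ← map_mul]
  exact (RingQuot.mkAlgHom_rel K (Rel.alpha_beta d)).trans (map_zero _)

/-- The class of the path formed by `m` arrows of a cycle, starting with `d`. -/
def path (d : Γ.Arrow) (m : ℕ) : Γ.Alg K := trail (Γ.arrow K) d m

theorem toAlg_genCycle (d : Γ.Arrow) : Γ.toAlg K (Γ.genCycle K d) = Γ.path K d (Γ.per d) :=
  map_trail (Γ.toAlg K) (Γ.genArrow K) d (Γ.per d)

theorem path_per_symm (d : Γ.Arrow) :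
    Γ.path K d.symm (Γ.per d.symm) = Γ.path K d (Γ.per d) := by
  rw [← toAlg_genCycle, ← toAlg_genCycle]
  exact (RingQuot.mkAlgHom_rel K (Rel.cycle d)).symm

variable {Γ} {K}

theorem arrow_mul_e_of_ne {d : Γ.Arrow} {i : Γ.Edge} (h : Γ.tgt d ≠ i) :
    Γ.arrow K d * Γ.e K i = 0 := by
  rw [← arrow_mul_e_tgt, mul_assoc, e_mul_e_of_ne _ _ h, mul_zero]

theorem e_mul_arrow_of_ne {d : Γ.Arrow} {i : Γ.Edge} (h : i ≠ Γ.src d) :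
    Γ.e K i * Γ.arrow K d = 0 := by
  rw [← e_src_mul_arrow, ← mul_assoc, e_mul_e_of_ne _ _ h, zero_mul]

/-- Only two arrows start where `d` ends: `next d` and its reversed dart. The zero relations kill
the product with the second. -/
theorem arrow_mul_arrow_of_ne {d d' : Γ.Arrow} (h : d' ≠ Γ.next d) :
    Γ.arrow K d * Γ.arrow K d' = 0 := by
  by_cases h1 : Γ.tgt d = Γ.src d'
  · rcases Γ.src_eq_src_iff.1 h1.symm with h2 | h2
    · exact absurd h2 h
    · rw [h2, arrow_mul_arrow_next_symm]
  · rw [← e_src_mul_arrow Γ K d', ← mul_assoc, arrow_mul_e_of_ne h1, zero_mul]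

theorem path_one (d : Γ.Arrow) : Γ.path K d 1 = Γ.arrow K d := trail_one _ _

theorem path_succ (d : Γ.Arrow) (m : ℕ) :
    Γ.path K d (m + 1) = Γ.path K d m * Γ.arrow K ((Γ.next ^ m) d) := trail_succ _ _ _

theorem path_succ' (d : Γ.Arrow) (m : ℕ) :
    Γ.path K d (m + 1) = Γ.arrow K d * Γ.path K (Γ.next d) m := trail_succ' _ _ _

theorem path_add (d : Γ.Arrow) (m n : ℕ) :
    Γ.path K d (m + n) = Γ.path K d m * Γ.path K ((Γ.next ^ m) d) n := trail_add _ _ _ _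

theorem path_mul_arrow_of_ne {d a : Γ.Arrow} {m : ℕ} (hm : 0 < m) (h : a ≠ (Γ.next ^ m) d) :
    Γ.path K d m * Γ.arrow K a = 0 := by
  obtain ⟨m, rfl⟩ := Nat.exists_eq_add_of_le' hm
  rw [path_succ, mul_assoc, arrow_mul_arrow_of_ne (by rwa [← next_pow_succ]), mul_zero]

theorem path_mul_path_of_ne {d g : Γ.Arrow} {m n : ℕ} (hm : 0 < m) (hn : 0 < n)
    (h : g ≠ (Γ.next ^ m) d) : Γ.path K d m * Γ.path K g n = 0 := by
  obtain ⟨n, rfl⟩ := Nat.exists_eq_add_of_le' hn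
  rw [path_succ', ← mul_assoc, path_mul_arrow_of_ne hm h, zero_mul]

theorem e_src_mul_path {d : Γ.Arrow} {m : ℕ} (hm : 0 < m) :
    Γ.e K (Γ.src d) * Γ.path K d m = Γ.path K d m := by
  obtain ⟨m, rfl⟩ := Nat.exists_eq_add_of_le' hm
  rw [path_succ', ← mul_assoc, e_src_mul_arrow]

theorem e_mul_path_of_ne {i : Γ.Edge} {d : Γ.Arrow} {m : ℕ} (hm : 0 < m) (h : i ≠ Γ.src d) :
    Γ.e K i * Γ.path K d m = 0 := by
  rw [← e_src_mul_path hm, ← mul_assoc, e_mul_e_of_ne _ _ h, zero_mul]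

theorem path_mul_e_src {d : Γ.Arrow} {m : ℕ} (hm : 0 < m) :
    Γ.path K d m * Γ.e K (Γ.src ((Γ.next ^ m) d)) = Γ.path K d m := by
  obtain ⟨m, rfl⟩ := Nat.exists_eq_add_of_le' hm
  rw [path_succ, mul_assoc, next_pow_succ]
  congr 1
  exact arrow_mul_e_tgt _ _ _

theorem path_mul_e_of_ne {i : Γ.Edge} {d : Γ.Arrow} {m : ℕ} (hm : 0 < m)
    (h : Γ.src ((Γ.next ^ m) d) ≠ i) : Γ.path K d m * Γ.e K i = 0 := by
  rw [← path_mul_e_src hm, mul_assoc, e_mul_e_of_ne _ _ h, mul_zero]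

/-- The full cycle at an edge can be written along either endpoint, and a given arrow continues at
most one of the two. So full cycles are socle elements. -/
theorem path_per_mul_arrow (d a : Γ.Arrow) : Γ.path K d (Γ.per d) * Γ.arrow K a = 0 := by
  by_cases h : a = d
  · rw [← path_per_symm]
    refine path_mul_arrow_of_ne (Γ.per_pos _) ?_
    rw [next_pow_per, h]
    exact Γ.ne_symm d
  · refine path_mul_arrow_of_ne (Γ.per_pos _) ?_
    rwa [next_pow_per]

theorem path_per_mul_path {d a : Γ.Arrow} {m : ℕ} (hm : 0 < m) :
    Γ.path K d (Γ.per d) * Γ.path K a m = 0 := by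
  obtain ⟨m, rfl⟩ := Nat.exists_eq_add_of_le' hm
  rw [path_succ', ← mul_assoc, path_per_mul_arrow, zero_mul]

theorem path_eq_zero_of_lt {d : Γ.Arrow} {m : ℕ} (h : Γ.per d < m) : Γ.path K d m = 0 := by
  obtain ⟨k, rfl⟩ := Nat.exists_eq_add_of_lt h
  rw [add_assoc, path_add, path_per_mul_path (Nat.succ_pos k)]

end Relations

/-! ### Augmentations at the vertices -/

section Augmentation

variable (K : Type u) [Field K] [Fintype V]

open Classical in
/-- The augmentation at a vertex: it kills the arrows and the other idempotents. -/
def aug (j : Γ.Edge) : Γ.Alg K →ₐ[K] K :=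
  RingQuot.liftAlgHom K ⟨FreeAlgebra.lift K
    (Sum.elim (fun i : Γ.Edge => if i = j then (1 : K) else 0) (fun _ : Γ.Arrow => 0)), by
    intro x y h
    induction h with
    | idem i => by_cases h : i = j <;> simp [genVertex, h]
    | orth i k h =>
      by_cases h1 : i = j
      · subst h1
        simp [genVertex, h.symm]
      · simp [genVertex, h1]
    | one => simp [genVertex]
    | src_mul d => simp [genVertex, genArrow]
    | mul_tgt d => simp [genVertex, genArrow]
    | alpha_beta d => simp [genArrow]
    | cycle d =>
      have h : ∀ d : Γ.Arrow, FreeAlgebra.lift K (Sum.elim (fun i : Γ.Edge =>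
          if i = j then (1 : K) else 0) (fun _ : Γ.Arrow => 0)) (Γ.genCycle K d) = 0 := by
        intro d
        obtain ⟨m, hm⟩ := Nat.exists_eq_add_of_le' (Γ.per_pos d)
        rw [genCycle_eq_trail, map_trail, hm, trail_succ]
        simp [genArrow]
      rw [h, h]⟩

theorem aug_toAlg (j : Γ.Edge) (x : FreeAlgebra K (Γ.Edge ⊕ Γ.Arrow)) [DecidableEq Γ.Edge] :
    Γ.aug K j (Γ.toAlg K x) = FreeAlgebra.lift K (Sum.elim (fun i : Γ.Edge =>
      if i = j then (1 : K) else 0) (fun _ : Γ.Arrow => 0)) x := by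
  refine (RingQuot.liftAlgHom_mkAlgHom_apply K _ _ x).trans ?_
  congr!

theorem aug_arrow (j : Γ.Edge) (d : Γ.Arrow) : Γ.aug K j (Γ.arrow K d) = 0 := by
  classical
  rw [arrow, aug_toAlg]
  simp [genArrow]

theorem aug_e_self (j : Γ.Edge) : Γ.aug K j (Γ.e K j) = 1 := by
  classical
  rw [e, aug_toAlg]
  simp [genVertex]

theorem aug_path (j : Γ.Edge) (d : Γ.Arrow) {m : ℕ} (hm : 0 < m) :
    Γ.aug K j (Γ.path K d m) = 0 := by
  obtain ⟨m, rfl⟩ := Nat.exists_eq_add_of_le' hm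
  rw [path_succ, map_mul, aug_arrow, mul_zero]

end Augmentation

end BrauerTree

namespace BrauerTree

variable {V : Type v} (Γ : BrauerTree V)

variable {Γ} in
/-- Two distinct edges have at most one common endpoint. -/
theorem eq_of_common_endpoints {d d' g g' : Γ.Arrow} (hne : Γ.src d ≠ Γ.src d')
    (h : d.fst = d'.fst) (h' : g.fst = g'.fst) (hd : Γ.src g = Γ.src d)
    (hd' : Γ.src g' = Γ.src d') : g = d ∧ g' = d' := by
  have key : g = d := by
    rcases Γ.src_eq_src_iff.1 hd with h1 | h1
    · exact h1
    · exfalso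
      subst h1
      rcases Γ.src_eq_src_iff.1 hd' with h2 | h2
      · subst h2
        exact Γ.fst_ne_fst_symm d (h.trans h'.symm)
      · subst h2
        exact hne (congrArg _ (Γ.eq_of_fst_eq_of_snd_eq h h'))
  subst key
  exact ⟨rfl, Γ.eq_of_src_eq_of_fst_eq hd' (h'.symm.trans h)⟩

/-! ### Full cycles are nonzero -/

section Representation

/-! The right module `e_i A` as a matrix representation: the basis vector `none` is the generator,
`some d₀` spans the socle, and every arrow acts by a single matrix unit. -/

variable (K : Type u) [Field K] (d₀ : Γ.Arrow)

instance arrowFintype [Fintype V] : Fintype Γ.Arrow := Fintype.ofFinite _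

instance arrowDecidableEq : DecidableEq Γ.Arrow := Classical.decEq _

open Classical in
/-- The basis vector on which an arrow acts. -/
def repSource (a : Γ.Arrow) : Option Γ.Arrow := if a = d₀ ∨ a = d₀.symm then none else some a

open Classical in
/-- The basis vector reached in front of an arrow. -/
def repTarget (a : Γ.Arrow) : Option Γ.Arrow :=
  if a = d₀ ∨ a = d₀.symm then some d₀ else some a

/-- The vertex of the quiver at which a basis vector is supported. -/
def repVertex (o : Option Γ.Arrow) : Γ.Edge := o.elim (Γ.src d₀) Γ.src

variable {Γ} in
theorem repVertex_repSource (a : Γ.Arrow) : Γ.repVertex d₀ (Γ.repSource d₀ a) = Γ.src a := by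
  unfold repSource
  split_ifs with h
  · exact (Γ.src_eq_src_iff.2 h).symm
  · rfl

variable {Γ} in
theorem repVertex_repTarget (a : Γ.Arrow) : Γ.repVertex d₀ (Γ.repTarget d₀ a) = Γ.src a := by
  unfold repTarget
  split_ifs with h
  · exact (Γ.src_eq_src_iff.2 h).symm
  · rfl

open Classical in
/-- The matrix of an arrow. -/
def repArrow (a : Γ.Arrow) : Matrix (Option Γ.Arrow) (Option Γ.Arrow) K :=
  if a.fst = d₀.fst ∨ a.fst = d₀.snd then
    Matrix.single (Γ.repSource d₀ a) (Γ.repTarget d₀ (Γ.next a)) 1 else 0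

open Classical in
/-- The matrix of an idempotent. -/
def repIdem (j : Γ.Edge) : Matrix (Option Γ.Arrow) (Option Γ.Arrow) K :=
  Matrix.diagonal (fun o => if Γ.repVertex d₀ o = j then 1 else 0)

variable {Γ} {K} {d₀} [Fintype V]

theorem repArrow_mul_repArrow_of_ne {a b : Γ.Arrow}
    (h : Γ.repTarget d₀ (Γ.next a) ≠ Γ.repSource d₀ b) :
    Γ.repArrow K d₀ a * Γ.repArrow K d₀ b = 0 := by
  unfold repArrow
  split_ifs
  · exact Matrix.single_mul_single_of_ne (α := K) _ _ _ _ h _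
  all_goals simp

theorem repArrow_mul_repArrow_next_symm (a : Γ.Arrow) :
    Γ.repArrow K d₀ a * Γ.repArrow K d₀ (Γ.next a).symm = 0 := by
  apply repArrow_mul_repArrow_of_ne
  unfold repSource repTarget
  have h := Γ.ne_symm (Γ.next a)
  split_ifs with h1 h2 h2
  · simp
  · exfalso
    rcases h1 with h1 | h1
    · exact h2 (Or.inr (by rw [h1]))
    · exact h2 (Or.inl (by rw [h1, SimpleGraph.Dart.symm_symm]))
  · simp
  · simpa using h

/-- The arrows leaving the edge of `d₀` act only on the generator `none`, which no arrow reaches. -/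
theorem repArrow_mul_repArrow_base (a : Γ.Arrow) {b : Γ.Arrow}
    (hb : b = d₀ ∨ b = d₀.symm) : Γ.repArrow K d₀ a * Γ.repArrow K d₀ b = 0 := by
  apply repArrow_mul_repArrow_of_ne
  unfold repSource repTarget
  rw [if_pos hb]
  split_ifs <;> simp

/-- The cycle carries the generator through its intermediate darts and comes back to the edge of
`d₀` only with its last arrow, which ends in the socle vector. The value is the same for both
endpoints. -/
theorem trail_repArrow_base {d : Γ.Arrow} (hd : d = d₀ ∨ d = d₀.symm) :
    trail (Γ.repArrow K d₀) d (Γ.per d) = Matrix.single none (some d₀) 1 := by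
  have hfst : d.fst = d₀.fst ∨ d.fst = d₀.snd := by
    rcases hd with rfl | rfl
    · exact Or.inl rfl
    · exact Or.inr rfl
  have key : ∀ m, 0 < m → m ≤ Γ.per d → trail (Γ.repArrow K d₀) d m =
      Matrix.single none (Γ.repTarget d₀ ((Γ.next ^ m) d)) 1 := by
    intro m hm
    induction m, hm using Nat.le_induction with
    | base =>
      intro _
      rw [Nat.succ_eq_add_one, zero_add, trail_one, repArrow, if_pos hfst, repSource, if_pos hd,
        pow_one]
    | succ m hm ih =>
      intro h
      rw [trail_succ, ih (by omega), repArrow, if_pos (by rwa [next_pow_fst])]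
      have h1 : ¬ ((Γ.next ^ m) d = d₀ ∨ (Γ.next ^ m) d = d₀.symm) := by
        have h2 : (Γ.next ^ m) d ≠ d := Γ.next_pow_ne hm (by omega)
        have h3 : (Γ.next ^ m) d ≠ d.symm := fun h3 => by
          have := congrArg (fun x : Γ.graph.Dart => x.fst) h3
          rw [next_pow_fst] at this
          exact Γ.fst_ne_fst_symm d this
        rcases hd with rfl | rfl
        · rintro (h4 | h4)
          · exact h2 h4
          · exact h3 h4
        · rintro (h4 | h4)
          · exact h3 (by rw [h4, SimpleGraph.Dart.symm_symm])
          · exact h2 h4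
      rw [repTarget, repSource, if_neg h1, if_neg h1, next_pow_succ]
      rw [Matrix.single_mul_single_same, mul_one]
  rw [key _ (Γ.per_pos d) le_rfl, next_pow_per, repTarget, if_pos hd]

/-- At an endpoint of `d₀`, a cycle begun at another edge has to enter and leave the edge of `d₀`,
which gives zero. At other tree vertices the arrows act by zero. -/
theorem trail_repArrow_of_ne {d : Γ.Arrow}
    (hd : ¬ (d = d₀ ∨ d = d₀.symm)) :
    trail (Γ.repArrow K d₀) d (Γ.per d) = 0 := by
  by_cases hl : d.fst = d₀.fst ∨ d.fst = d₀.snd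
  · obtain ⟨b, hb, hb'⟩ : ∃ b, (b = d₀ ∨ b = d₀.symm) ∧ d.fst = b.fst := by
      rcases hl with h | h
      · exact ⟨d₀, Or.inl rfl, h⟩
      · exact ⟨d₀.symm, Or.inr rfl, h⟩
    obtain ⟨m, hm, hm'⟩ := Γ.exists_next_pow_eq hb'
    have h0 : 0 < m := by
      rw [Nat.pos_iff_ne_zero]
      rintro rfl
      have : d = b := hm'
      rw [this] at hd
      exact hd hb
    obtain ⟨m, rfl⟩ := Nat.exists_eq_add_of_le' h0
    obtain ⟨k, hk⟩ := Nat.exists_eq_add_of_lt hm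
    rw [hk, add_assoc, trail_add, trail_succ, trail_succ', hm',
        mul_assoc, ← mul_assoc _ _ (trail _ _ _),
      repArrow_mul_repArrow_base _ hb, zero_mul, mul_zero]
  · obtain ⟨m, hm⟩ := Nat.exists_eq_add_of_le' (Γ.per_pos d)
    rw [hm, trail_succ', repArrow, if_neg hl, zero_mul]

theorem trail_repArrow_symm (d : Γ.Arrow) :
    trail (Γ.repArrow K d₀) d (Γ.per d) = trail (Γ.repArrow K d₀) d.symm (Γ.per d.symm) := by
  by_cases hd : d = d₀ ∨ d = d₀.symm
  · have hd' : d.symm = d₀ ∨ d.symm = d₀.symm := by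
      rcases hd with rfl | rfl
      · exact Or.inr rfl
      · exact Or.inl (SimpleGraph.Dart.symm_symm _)
    rw [trail_repArrow_base hd, trail_repArrow_base hd']
  · have hd' : ¬ (d.symm = d₀ ∨ d.symm = d₀.symm) := by
      rintro (h | h)
      · exact hd (Or.inr (by rw [← h, SimpleGraph.Dart.symm_symm]))
      · exact hd (Or.inl (by rw [← SimpleGraph.Dart.symm_symm d, h, SimpleGraph.Dart.symm_symm]))
    rw [trail_repArrow_of_ne hd, trail_repArrow_of_ne hd']

variable (Γ K d₀)

open Classical in
/-- The representation on generators. -/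
def repGen : FreeAlgebra K (Γ.Edge ⊕ Γ.Arrow) →ₐ[K] Matrix (Option Γ.Arrow) (Option Γ.Arrow) K :=
  FreeAlgebra.lift K (Sum.elim (Γ.repIdem K d₀) (Γ.repArrow K d₀))

open Classical in
theorem repGen_genVertex (j : Γ.Edge) :
    Γ.repGen K d₀ (Γ.genVertex K j) = Γ.repIdem K d₀ j := by
  simp [repGen, genVertex]

open Classical in
theorem repGen_genArrow (a : Γ.Arrow) :
    Γ.repGen K d₀ (Γ.genArrow K a) = Γ.repArrow K d₀ a := by
  simp [repGen, genArrow]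

open Classical in
theorem repGen_rel {x y : FreeAlgebra K (Γ.Edge ⊕ Γ.Arrow)} (h : Γ.Rel K x y) :
    Γ.repGen K d₀ x = Γ.repGen K d₀ y := by
  induction h with
  | idem i =>
    rw [map_mul, repGen_genVertex, repIdem, Matrix.diagonal_mul_diagonal]
    congr 1
    ext o
    split_ifs <;> simp
  | orth i j h =>
    rw [map_mul, repGen_genVertex, repGen_genVertex, repIdem, repIdem,
      Matrix.diagonal_mul_diagonal, map_zero, ← Matrix.diagonal_zero]
    congr 1
    ext o
    split_ifs with h1 h2
    · exact absurd (h1.symm.trans h2) h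
    all_goals simp
  | one =>
    rw [map_sum, map_one]
    simp only [repGen_genVertex, repIdem]
    ext a b
    rw [Matrix.sum_apply]
    by_cases hab : a = b
    · subst hab
      simp
    · simp [hab]
  | src_mul d =>
    rw [map_mul, repGen_genVertex, repGen_genArrow, repIdem, repArrow]
    split_ifs
    · ext a b
      rw [Matrix.diagonal_mul, Matrix.single_apply]
      by_cases h2 : Γ.repSource d₀ d = a ∧ Γ.repTarget d₀ (Γ.next d) = b
      · rw [if_pos (by rw [← h2.1, repVertex_repSource]), one_mul]
      · rw [if_neg h2, mul_zero]
    · simp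
  | mul_tgt d =>
    rw [map_mul, repGen_genVertex, repGen_genArrow, repIdem, repArrow]
    split_ifs
    · ext a b
      rw [Matrix.mul_diagonal, Matrix.single_apply]
      by_cases h2 : Γ.repSource d₀ d = a ∧ Γ.repTarget d₀ (Γ.next d) = b
      · have hv : Γ.repVertex d₀ b = Γ.tgt d := by
          rw [← h2.2]
          exact repVertex_repTarget _ _
        rw [if_pos hv, mul_one]
      · rw [if_neg h2, zero_mul]
    · simp
  | alpha_beta d =>
    rw [map_mul, repGen_genArrow, repGen_genArrow, map_zero, repArrow_mul_repArrow_next_symm]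
  | cycle d =>
    rw [genCycle_eq_trail, genCycle_eq_trail, map_trail, map_trail]
    simp only [repGen_genArrow]
    exact trail_repArrow_symm d

/-- Generators and relations alone bound the algebra only from above; the representation supplies
the nonvanishing on which all dimension counts rest. -/
theorem path_per_ne_zero : Γ.path K d₀ (Γ.per d₀) ≠ 0 := by
  classical
  intro h
  let ρ : Γ.Alg K →ₐ[K] _ := RingQuot.liftAlgHom K ⟨Γ.repGen K d₀, fun _ _ => Γ.repGen_rel K d₀⟩
  have h1 : ρ (Γ.path K d₀ (Γ.per d₀)) = Γ.repGen K d₀ (Γ.genCycle K d₀) := by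
    rw [← toAlg_genCycle]
    exact RingQuot.liftAlgHom_mkAlgHom_apply K _ _ _
  rw [h, map_zero, genCycle_eq_trail, map_trail] at h1
  simp only [repGen_genArrow] at h1
  rw [trail_repArrow_base (Or.inl rfl)] at h1
  have h2 := congrFun (congrFun h1 none) (some d₀)
  simp at h2

end Representation

/-! ### The spaces `e_i A e_j` and their dimensions -/

section Corners

variable {Γ} {K : Type u} [Field K] [Fintype V]

theorem path_ne_zero {d : Γ.Arrow} {m : ℕ} (h : m ≤ Γ.per d) : Γ.path K d m ≠ 0 := by
  intro h0
  obtain ⟨k, hk⟩ := Nat.exists_eq_add_of_le h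
  apply Γ.path_per_ne_zero K d
  rw [hk, path_add, h0, zero_mul]

variable (Γ K) in
/-- The standard basis of the algebra. -/
def basisSet : Set (Γ.Alg K) :=
  Set.range (Γ.e K) ∪ {y | ∃ d m, 0 < m ∧ m ≤ Γ.per d ∧ y = Γ.path K d m}

theorem mul_gen_mem_span_basisSet {y : Γ.Alg K} (hy : y ∈ Submodule.span K (Γ.basisSet K))
    (g : Γ.Edge ⊕ Γ.Arrow) :
    y * Γ.toAlg K (FreeAlgebra.ι K g) ∈ Submodule.span K (Γ.basisSet K) := by
  induction hy using Submodule.span_induction with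
  | zero => simp
  | add x y _ _ hx hy =>
    rw [add_mul]
    exact add_mem hx hy
  | smul c x _ hx =>
    rw [smul_mul_assoc]
    exact Submodule.smul_mem _ c hx
  | mem x hx =>
    rcases hx with ⟨i, rfl⟩ | ⟨d, m, h0, hm, rfl⟩
    · rcases g with j | a
      · change Γ.e K i * Γ.e K j ∈ _
        by_cases hij : i = j
        · rw [hij, e_mul_e_self]
          exact Submodule.subset_span (Or.inl ⟨j, rfl⟩)
        · rw [e_mul_e_of_ne _ _ hij]
          exact zero_mem _
      · change Γ.e K i * Γ.arrow K a ∈ _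
        by_cases h : i = Γ.src a
        · rw [h, e_src_mul_arrow]
          exact Submodule.subset_span (Or.inr ⟨a, 1, one_pos, Γ.per_pos a, (path_one a).symm⟩)
        · rw [e_mul_arrow_of_ne h]
          exact zero_mem _
    · rcases g with j | a
      · change Γ.path K d m * Γ.e K j ∈ _
        by_cases h : Γ.src ((Γ.next ^ m) d) = j
        · rw [← h, path_mul_e_src h0]
          exact Submodule.subset_span (Or.inr ⟨d, m, h0, hm, rfl⟩)
        · rw [path_mul_e_of_ne h0 h]
          exact zero_mem _
      · change Γ.path K d m * Γ.arrow K a ∈ _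
        by_cases h : a = (Γ.next ^ m) d
        · rw [h, ← path_succ]
          rcases hm.eq_or_lt with h1 | h1
          · rw [path_eq_zero_of_lt (by omega)]
            exact zero_mem _
          · exact Submodule.subset_span (Or.inr ⟨d, m + 1, by omega, h1, rfl⟩)
        · rw [path_mul_arrow_of_ne h0 h]
          exact zero_mem _

theorem mem_span_basisSet (x : Γ.Alg K) : x ∈ Submodule.span K (Γ.basisSet K) := by
  obtain ⟨x, rfl⟩ := RingQuot.mkAlgHom_surjective K (Γ.Rel K) x
  have key : ∀ y ∈ Submodule.span K (Γ.basisSet K),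
      y * Γ.toAlg K x ∈ Submodule.span K (Γ.basisSet K) := by
    induction x using FreeAlgebra.induction with
    | grade0 r =>
      intro y hy
      rw [AlgHom.commutes, ← Algebra.commutes, ← Algebra.smul_def]
      exact Submodule.smul_mem _ r hy
    | grade1 g => exact fun y hy => mul_gen_mem_span_basisSet hy g
    | mul a b ha hb =>
      intro y hy
      rw [map_mul, ← mul_assoc]
      exact hb _ (ha _ hy)
    | add a b ha hb =>
      intro y hy
      rw [map_add, mul_add]
      exact add_mem (ha _ hy) (hb _ hy)
  have h1 : (1 : Γ.Alg K) ∈ Submodule.span K (Γ.basisSet K) := by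
    rw [← sum_e]
    exact sum_mem fun i _ => Submodule.subset_span (Or.inl ⟨i, rfl⟩)
  have := key 1 h1
  rwa [one_mul] at this

instance : FiniteDimensional K (Γ.Alg K) := by
  have hfin : (Γ.basisSet K).Finite := by
    refine (Set.finite_range _).union ?_
    have : {y | ∃ d m, 0 < m ∧ m ≤ Γ.per d ∧ y = Γ.path K d m} ⊆
        ⋃ d : Γ.Arrow, (fun m => Γ.path K d m) '' Set.Iic (Γ.per d) := by
      rintro y ⟨d, m, -, hm, rfl⟩
      exact Set.mem_iUnion.2 ⟨d, m, hm, rfl⟩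
    exact (Set.finite_iUnion fun d => (Set.finite_Iic _).image _).subset this
  refine ⟨hfin.toFinset, ?_⟩
  rw [Set.Finite.coe_toFinset, eq_top_iff]
  exact fun x _ => mem_span_basisSet x

/-- Distinct edges share at most one tree vertex, so only one basis path runs from the first to the
second. -/
theorem exists_smul_path_of_common {d d' : Γ.Arrow} (h : d.fst = d'.fst)
    (hne : Γ.src d ≠ Γ.src d') (x : Γ.Alg K) :
    ∃ c : K, Γ.e K (Γ.src d) * x * Γ.e K (Γ.src d') = c • Γ.path K d (Γ.steps d d') := by
  induction mem_span_basisSet x using Submodule.span_induction with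
  | zero => exact ⟨0, by simp⟩
  | add x y _ _ hx hy =>
    obtain ⟨a, ha⟩ := hx
    obtain ⟨b, hb⟩ := hy
    exact ⟨a + b, by rw [mul_add, add_mul, ha, hb, add_smul]⟩
  | smul c x _ hx =>
    obtain ⟨a, ha⟩ := hx
    exact ⟨c * a, by rw [mul_smul_comm, smul_mul_assoc, ha, smul_smul]⟩
  | mem x hx =>
    rcases hx with ⟨i, rfl⟩ | ⟨a, m, h0, hm, rfl⟩
    · refine ⟨0, ?_⟩
      by_cases hi : Γ.src d = i
      · rw [← hi, e_mul_e_self, e_mul_e_of_ne _ _ hne, zero_smul]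
      · rw [e_mul_e_of_ne _ _ hi, zero_mul, zero_smul]
    · by_cases h1 : Γ.src d = Γ.src a
      · by_cases h2 : Γ.src ((Γ.next ^ m) a) = Γ.src d'
        · obtain ⟨rfl, h4⟩ := eq_of_common_endpoints hne h (Γ.next_pow_fst m a).symm h1.symm h2
          rcases hm.eq_or_lt with rfl | hm
          · rw [next_pow_per] at h4
            exact absurd (congrArg _ h4) hne
          · refine ⟨1, ?_⟩
            rw [← h4, steps_eq hm, e_src_mul_path h0, path_mul_e_src h0, one_smul]
        · exact ⟨0, by rw [mul_assoc, path_mul_e_of_ne h0 h2, mul_zero, zero_smul]⟩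
      · exact ⟨0, by rw [e_mul_path_of_ne h0 h1, zero_mul, zero_smul]⟩

theorem e_mul_mul_e_eq_zero {i j : Γ.Edge}
    (h : ∀ d d' : Γ.Arrow, Γ.src d = i → Γ.src d' = j → d.fst ≠ d'.fst) (x : Γ.Alg K) :
    Γ.e K i * x * Γ.e K j = 0 := by
  have hij : i ≠ j := by
    rintro rfl
    obtain ⟨d, hd⟩ := Γ.exists_src_eq i
    exact h d d hd hd rfl
  induction mem_span_basisSet x using Submodule.span_induction with
  | zero => simp
  | add x y _ _ hx hy => rw [mul_add, add_mul, hx, hy, add_zero]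
  | smul c x _ hx => rw [mul_smul_comm, smul_mul_assoc, hx, smul_zero]
  | mem x hx =>
    rcases hx with ⟨k, rfl⟩ | ⟨a, m, h0, hm, rfl⟩
    · by_cases hi : i = k
      · rw [← hi, e_mul_e_self, e_mul_e_of_ne _ _ hij]
      · rw [e_mul_e_of_ne _ _ hi, zero_mul]
    · by_cases h1 : i = Γ.src a
      · by_cases h2 : Γ.src ((Γ.next ^ m) a) = j
        · exact absurd (Γ.next_pow_fst m a).symm (h _ _ h1.symm h2)
        · rw [mul_assoc, path_mul_e_of_ne h0 h2, mul_zero]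
      · rw [e_mul_path_of_ne h0 h1, zero_mul]

/-- A basis path that returns to its edge is a full cycle, and the full cycles at the two endpoints
coincide. -/
theorem exists_smul_e_add_smul_path (d : Γ.Arrow) (x : Γ.Alg K) :
    ∃ a b : K, Γ.e K (Γ.src d) * x * Γ.e K (Γ.src d) =
      a • Γ.e K (Γ.src d) + b • Γ.path K d (Γ.per d) := by
  induction mem_span_basisSet x using Submodule.span_induction with
  | zero => exact ⟨0, 0, by simp⟩
  | add x y _ _ hx hy =>
    obtain ⟨a, b, ha⟩ := hx
    obtain ⟨a', b', hb⟩ := hy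
    refine ⟨a + a', b + b', ?_⟩
    rw [mul_add, add_mul, ha, hb, add_smul, add_smul]
    abel
  | smul c x _ hx =>
    obtain ⟨a, b, ha⟩ := hx
    refine ⟨c * a, c * b, ?_⟩
    rw [mul_smul_comm, smul_mul_assoc, ha, smul_add, smul_smul, smul_smul]
  | mem x hx =>
    rcases hx with ⟨k, rfl⟩ | ⟨a, m, h0, hm, rfl⟩
    · by_cases hi : Γ.src d = k
      · exact ⟨1, 0, by simp [← hi, e_mul_e_self]⟩
      · exact ⟨0, 0, by simp [e_mul_e_of_ne _ _ hi]⟩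
    · by_cases h1 : Γ.src d = Γ.src a
      · by_cases h2 : Γ.src ((Γ.next ^ m) a) = Γ.src d
        · have h3 : (Γ.next ^ m) a = a :=
            Γ.eq_of_src_eq_of_fst_eq (h2.trans h1) (Γ.next_pow_fst m a)
          have h4 : m = Γ.per a := by
            by_contra hne
            exact Γ.next_pow_ne h0 (lt_of_le_of_ne hm hne) h3
          subst h4
          refine ⟨0, 1, ?_⟩
          rw [zero_smul, zero_add, one_smul]
          have h5 : Γ.path K d (Γ.per d) = Γ.path K a (Γ.per a) := by
            rcases Γ.src_eq_src_iff.1 h1 with rfl | rfl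
            · rfl
            · exact path_per_symm _ _ _
          rw [h5, h1, e_src_mul_path h0]
          have h6 := path_mul_e_src (K := K) (d := a) h0
          rwa [h3] at h6
        · exact ⟨0, 0, by simp [mul_assoc, path_mul_e_of_ne h0 h2]⟩
      · exact ⟨0, 0, by simp [e_mul_path_of_ne h0 h1]⟩

variable (Γ K) in
/-- The space `e_i A e_j`. -/
def corner (i j : Γ.Edge) : Submodule K (Γ.Alg K) where
  carrier := {x | Γ.e K i * x * Γ.e K j = x}
  zero_mem' := by simp
  add_mem' := fun {x y} hx hy => by
    change _ * (x + y) * _ = x + y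
    rw [mul_add, add_mul, hx, hy]
  smul_mem' := fun c x hx => by
    change _ * (c • x) * _ = c • x
    rw [mul_smul_comm, smul_mul_assoc, hx]

theorem mem_corner {i j : Γ.Edge} {x : Γ.Alg K} :
    x ∈ Γ.corner K i j ↔ Γ.e K i * x * Γ.e K j = x := Iff.rfl

theorem e_mul_mul_e_mem_corner (i j : Γ.Edge) (x : Γ.Alg K) :
    Γ.e K i * x * Γ.e K j ∈ Γ.corner K i j := by
  rw [mem_corner, mul_assoc, mul_assoc _ (Γ.e K j), e_mul_e_self, ← mul_assoc, ← mul_assoc,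
    e_mul_e_self]

theorem path_mem_corner {d d' : Γ.Arrow} {m : ℕ} (hm : 0 < m) (h : (Γ.next ^ m) d = d') :
    Γ.path K d m ∈ Γ.corner K (Γ.src d) (Γ.src d') := by
  rw [mem_corner, e_src_mul_path hm, ← h, path_mul_e_src hm]

theorem path_per_mem_corner (d : Γ.Arrow) :
    Γ.path K d (Γ.per d) ∈ Γ.corner K (Γ.src d) (Γ.src d) :=
  path_mem_corner (Γ.per_pos d) (Γ.next_pow_per d)

theorem e_mem_corner (i : Γ.Edge) : Γ.e K i ∈ Γ.corner K i i := by
  rw [mem_corner, e_mul_e_self, e_mul_e_self]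

theorem e_mul_of_mem_corner {i j : Γ.Edge} {x : Γ.Alg K} (hx : x ∈ Γ.corner K i j) :
    Γ.e K i * x = x := by
  rw [← mem_corner.1 hx, ← mul_assoc, ← mul_assoc, e_mul_e_self]

theorem mul_e_of_mem_corner {i j : Γ.Edge} {x : Γ.Alg K} (hx : x ∈ Γ.corner K i j) :
    x * Γ.e K j = x := by
  rw [← mem_corner.1 hx, mul_assoc, e_mul_e_self]

theorem mem_corner_iff {i j : Γ.Edge} {x : Γ.Alg K} :
    x ∈ Γ.corner K i j ↔ Γ.e K i * x = x ∧ x * Γ.e K j = x := by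
  refine ⟨fun h => ⟨e_mul_of_mem_corner h, mul_e_of_mem_corner h⟩, fun h => ?_⟩
  rw [mem_corner, h.1, h.2]

theorem mul_mem_corner {i j k : Γ.Edge} {x y : Γ.Alg K} (hx : x ∈ Γ.corner K i j)
    (hy : y ∈ Γ.corner K j k) : x * y ∈ Γ.corner K i k := by
  rw [mem_corner_iff] at *
  rw [← mul_assoc, hx.1, mul_assoc, hy.2]
  exact ⟨rfl, rfl⟩

theorem exists_of_mem_corner_of_common {d d' : Γ.Arrow} (h : d.fst = d'.fst)
    (hne : Γ.src d ≠ Γ.src d') {x : Γ.Alg K} (hx : x ∈ Γ.corner K (Γ.src d) (Γ.src d')) :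
    ∃ c : K, x = c • Γ.path K d (Γ.steps d d') := by
  rw [← mem_corner.1 hx]
  exact exists_smul_path_of_common h hne x

theorem exists_common_of_mem_corner {i j : Γ.Edge} {x : Γ.Alg K} (hx : x ∈ Γ.corner K i j)
    (h0 : x ≠ 0) : ∃ d d' : Γ.Arrow, Γ.src d = i ∧ Γ.src d' = j ∧ d.fst = d'.fst := by
  by_contra! h
  exact h0 (by rw [← mem_corner.1 hx]; exact e_mul_mul_e_eq_zero h x)

theorem exists_of_mem_corner_self (d : Γ.Arrow) {x : Γ.Alg K}
    (hx : x ∈ Γ.corner K (Γ.src d) (Γ.src d)) :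
    ∃ a b : K, x = a • Γ.e K (Γ.src d) + b • Γ.path K d (Γ.per d) := by
  rw [← mem_corner.1 hx]
  exact exists_smul_e_add_smul_path d x

theorem exists_of_mem_corner_self_of_aug (d : Γ.Arrow) {x : Γ.Alg K}
    (hx : x ∈ Γ.corner K (Γ.src d) (Γ.src d)) (h : Γ.aug K (Γ.src d) x = 0) :
    ∃ b : K, x = b • Γ.path K d (Γ.per d) := by
  obtain ⟨a, b, rfl⟩ := exists_of_mem_corner_self d hx
  rw [map_add, map_smul, map_smul, aug_e_self, aug_path _ _ _ _ (Γ.per_pos d)] at h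
  exact ⟨b, by simp_all⟩

variable (Γ) in
/-- The half-edges of `i` at the endpoints of `p`. -/
def common (i p : Γ.Edge) : Set Γ.Arrow :=
  {d | Γ.src d = i ∧ ∃ q : Γ.Arrow, Γ.src q = p ∧ d.fst = q.fst}

/-- Both sides are 2 for equal edges (idempotent and full cycle; two ends), 1 for edges with one
common endpoint, and 0 otherwise. Counting ends allows a comparison of dimensions with a matching of
ends. -/
theorem finrank_corner (i p : Γ.Edge) :
    Module.finrank K (Γ.corner K i p) = (Γ.common i p).ncard := by
  by_cases hip : i = p
  · subst hip
    obtain ⟨d, rfl⟩ := Γ.exists_src_eq i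
    have h1 : Γ.common (Γ.src d) (Γ.src d) = {d, d.symm} := by
      ext g
      simp only [common, Set.mem_ofPred_eq, Set.mem_insert_iff, Set.mem_singleton_iff]
      rw [Γ.src_eq_src_iff]
      refine ⟨fun h => h.1, fun h => ⟨h, g, Γ.src_eq_src_iff.2 h, rfl⟩⟩
    rw [h1, Set.ncard_pair (Γ.ne_symm d)]
    have h2 : Γ.corner K (Γ.src d) (Γ.src d) =
        Submodule.span K (Set.range ![Γ.e K (Γ.src d), Γ.path K d (Γ.per d)]) := by
      rw [Matrix.range_cons, Matrix.range_cons, Matrix.range_empty, Set.union_empty,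
        Set.singleton_union]
      ext x
      rw [Submodule.mem_span_pair]
      refine ⟨fun h => ?_, ?_⟩
      · obtain ⟨a, b, h⟩ := exists_of_mem_corner_self d h
        exact ⟨a, b, h.symm⟩
      · rintro ⟨a, b, rfl⟩
        exact add_mem (Submodule.smul_mem _ _ (e_mem_corner _))
          (Submodule.smul_mem _ _ (path_per_mem_corner d))
    rw [h2, finrank_span_eq_card]
    · rfl
    · rw [LinearIndependent.pair_iff]
      intro a b hab
      have h3 := congrArg (Γ.aug K (Γ.src d)) hab
      rw [map_add, map_smul, map_smul, aug_e_self, aug_path _ _ _ _ (Γ.per_pos d), map_zero,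
        smul_zero, add_zero, smul_eq_mul, mul_one] at h3
      subst h3
      rw [zero_smul, zero_add] at hab
      exact ⟨rfl, (smul_eq_zero.1 hab).resolve_right (path_ne_zero le_rfl)⟩
  · by_cases hc : ∃ d d' : Γ.Arrow, Γ.src d = i ∧ Γ.src d' = p ∧ d.fst = d'.fst
    · obtain ⟨d, d', rfl, rfl, h⟩ := hc
      have h1 : Γ.common (Γ.src d) (Γ.src d') = {d} := by
        ext g
        simp only [common, Set.mem_ofPred_eq, Set.mem_singleton_iff]
        constructor
        · rintro ⟨h1, q, h2, h3⟩
          exact (eq_of_common_endpoints hip h h3 h1 h2).1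
        · rintro rfl
          exact ⟨rfl, d', rfl, h⟩
      have h0 : d ≠ d' := fun h => hip (congrArg _ h)
      have h2 : Γ.corner K (Γ.src d) (Γ.src d') =
          Submodule.span K {Γ.path K d (Γ.steps d d')} := by
        ext x
        rw [Submodule.mem_span_singleton]
        refine ⟨fun hx => ?_, ?_⟩
        · obtain ⟨c, hc⟩ := exists_of_mem_corner_of_common h hip hx
          exact ⟨c, hc.symm⟩
        · rintro ⟨c, rfl⟩
          exact Submodule.smul_mem _ _ (path_mem_corner (steps_pos h h0) (next_pow_steps h))
      rw [h1, Set.ncard_singleton, h2, finrank_span_singleton]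
      exact path_ne_zero (steps_lt h).le
    · push Not at hc
      have h1 : Γ.common i p = ∅ := by
        ext g
        simp only [common, Set.mem_ofPred_eq, Set.mem_empty_iff_false, iff_false, not_and,
          not_exists]
        exact fun h1 q h2 => hc g q h1 h2
      have h2 : Γ.corner K i p = ⊥ := by
        rw [eq_bot_iff]
        intro x hx
        rw [Submodule.mem_bot, ← mem_corner.1 hx]
        exact e_mul_mul_e_eq_zero hc x
      rw [h1, h2, Set.ncard_empty, finrank_bot]

end Corners

end BrauerTree

namespace BrauerTree

variable {V : Type v} [Fintype V] {Γ : BrauerTree V} {K : Type u} [Field K]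

theorem mem_Proj {p : Γ.Edge} {x : Γ.Alg K} : x ∈ Γ.Proj K p ↔ x * Γ.e K p = x := by
  rw [Submodule.mem_span_singleton]
  constructor
  · rintro ⟨a, rfl⟩
    rw [smul_eq_mul, mul_assoc, e_mul_e_self]
  · exact fun h => ⟨x, h⟩

instance (p : Γ.Edge) : FiniteDimensional K (Γ.Proj K p) :=
  Module.Finite.of_injective ((Γ.Proj K p).subtype.restrictScalars K) Subtype.val_injective

variable (Γ K) in
/-- The generator of `A e_p`. -/
def genProj (p : Γ.Edge) : Γ.Proj K p := ⟨Γ.e K p, Submodule.mem_span_singleton_self _⟩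

/-! ### Homomorphisms of projectives as matrices -/

section Coefficients

variable {ι κ : Type*} [Fintype ι] [DecidableEq ι] [Fintype κ] [DecidableEq κ]
  {I : ι → Γ.Edge} {J : κ → Γ.Edge} {p : Γ.Edge}

/-- The coefficient in `e_i A e_p` of a homomorphism to `A e_p` on the summand `A e_i`. -/
def coeff (g : (∀ s, Γ.Proj K (I s)) →ₗ[Γ.Alg K] Γ.Proj K p) (s : ι) : Γ.Alg K :=
  (g (Pi.single s (Γ.genProj K (I s))) : Γ.Alg K)

theorem smul_single_genProj (s : ι) (x : Γ.Proj K (I s)) :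
    (x : Γ.Alg K) • (Pi.single s (Γ.genProj K (I s)) : ∀ s, Γ.Proj K (I s)) = Pi.single s x := by
  rw [← Pi.single_smul]
  congr 1
  exact Subtype.ext (mem_Proj.1 x.2)

theorem coeff_mem_corner (g : (∀ s, Γ.Proj K (I s)) →ₗ[Γ.Alg K] Γ.Proj K p) (s : ι) :
    coeff g s ∈ Γ.corner K (I s) p := by
  rw [mem_corner_iff]
  refine ⟨?_, mem_Proj.1 (g _).2⟩
  have h := smul_single_genProj s (Γ.genProj K (I s))
  have h2 := congrArg (fun x => (g x : Γ.Alg K)) h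
  simp only [map_smul] at h2
  exact h2

theorem coe_apply_eq_sum (g : (∀ s, Γ.Proj K (I s)) →ₗ[Γ.Alg K] Γ.Proj K p)
    (x : ∀ s, Γ.Proj K (I s)) : (g x : Γ.Alg K) = ∑ s, (x s : Γ.Alg K) * coeff g s := by
  have h : x = ∑ s, (x s : Γ.Alg K) • (Pi.single s (Γ.genProj K (I s)) : ∀ s, Γ.Proj K (I s)) := by
    simp only [smul_single_genProj]
    exact (Finset.univ_sum_single x).symm
  conv_lhs => rw [h]
  simp only [map_sum, map_smul]
  rw [AddSubmonoidClass.coe_finsetSum]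
  rfl

/-- The homomorphism to `A e_p` with given coefficients. -/
def ofCoeff (c : ι → Γ.Alg K) (hc : ∀ s, c s ∈ Γ.corner K (I s) p) :
    (∀ s, Γ.Proj K (I s)) →ₗ[Γ.Alg K] Γ.Proj K p where
  toFun x := ⟨∑ s, (x s : Γ.Alg K) * c s, by
    rw [mem_Proj, Finset.sum_mul]
    exact Finset.sum_congr rfl fun s _ => by rw [mul_assoc, mul_e_of_mem_corner (hc s)]⟩
  map_add' x y := by
    ext
    simp [add_mul, Finset.sum_add_distrib]
  map_smul' a x := by
    ext
    simp [Finset.mul_sum, mul_assoc]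

theorem coe_ofCoeff (c : ι → Γ.Alg K) (hc : ∀ s, c s ∈ Γ.corner K (I s) p)
    (x : ∀ s, Γ.Proj K (I s)) :
    (ofCoeff c hc x : Γ.Alg K) = ∑ s, (x s : Γ.Alg K) * c s := rfl

theorem coeff_ofCoeff (c : ι → Γ.Alg K) (hc : ∀ s, c s ∈ Γ.corner K (I s) p) (s : ι) :
    coeff (ofCoeff c hc) s = c s := by
  rw [coeff, coe_ofCoeff, Finset.sum_eq_single s]
  · rw [Pi.single_eq_same]
    exact e_mul_of_mem_corner (hc s)
  · intro s' _ hs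
    rw [Pi.single_eq_of_ne hs]
    simp
  · simp

theorem coeff_ext {g g' : (∀ s, Γ.Proj K (I s)) →ₗ[Γ.Alg K] Γ.Proj K p}
    (h : ∀ s, coeff g s = coeff g' s) : g = g' := by
  refine LinearMap.ext fun x => Subtype.ext ?_
  simp only [coe_apply_eq_sum, h]

/-- The matrix entry in `e_i A e_j` of a homomorphism on the summands `A e_i` and `A e_j`. -/
def entry (f : (∀ s, Γ.Proj K (I s)) →ₗ[Γ.Alg K] (∀ t, Γ.Proj K (J t))) (s : ι) (t : κ) :
    Γ.Alg K := coeff (LinearMap.proj t ∘ₗ f) s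

theorem entry_mem_corner (f : (∀ s, Γ.Proj K (I s)) →ₗ[Γ.Alg K] (∀ t, Γ.Proj K (J t)))
    (s : ι) (t : κ) : entry f s t ∈ Γ.corner K (I s) (J t) := coeff_mem_corner _ s

theorem coe_apply_apply_eq_sum (f : (∀ s, Γ.Proj K (I s)) →ₗ[Γ.Alg K] (∀ t, Γ.Proj K (J t)))
    (x : ∀ s, Γ.Proj K (I s)) (t : κ) :
    (f x t : Γ.Alg K) = ∑ s, (x s : Γ.Alg K) * entry f s t :=
  coe_apply_eq_sum (LinearMap.proj t ∘ₗ f) x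

/-- The homomorphism with a given matrix. -/
def ofEntries (F : ι → κ → Γ.Alg K) (hF : ∀ s t, F s t ∈ Γ.corner K (I s) (J t)) :
    (∀ s, Γ.Proj K (I s)) →ₗ[Γ.Alg K] (∀ t, Γ.Proj K (J t)) :=
  LinearMap.pi fun t => ofCoeff (fun s => F s t) fun s => hF s t

theorem entry_ofEntries (F : ι → κ → Γ.Alg K) (hF : ∀ s t, F s t ∈ Γ.corner K (I s) (J t))
    (s : ι) (t : κ) : entry (ofEntries F hF) s t = F s t :=
  coeff_ofCoeff (fun s => F s t) (fun s => hF s t) s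

theorem entry_ext {f f' : (∀ s, Γ.Proj K (I s)) →ₗ[Γ.Alg K] (∀ t, Γ.Proj K (J t))}
    (h : ∀ s t, entry f s t = entry f' s t) : f = f' := by
  refine LinearMap.ext fun x => funext fun t => Subtype.ext ?_
  simp only [coe_apply_apply_eq_sum, h]

theorem coeff_comp (f : (∀ s, Γ.Proj K (I s)) →ₗ[Γ.Alg K] (∀ t, Γ.Proj K (J t)))
    (g : (∀ t, Γ.Proj K (J t)) →ₗ[Γ.Alg K] Γ.Proj K p) (s : ι) :
    coeff (g ∘ₗ f) s = ∑ t, entry f s t * coeff g t := by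
  rw [coeff, LinearMap.comp_apply, coe_apply_eq_sum]
  rfl

theorem entry_comp {μ : Type*} [Fintype μ] [DecidableEq μ] {L : μ → Γ.Edge}
    (f : (∀ s, Γ.Proj K (I s)) →ₗ[Γ.Alg K] (∀ t, Γ.Proj K (J t)))
    (g : (∀ t, Γ.Proj K (J t)) →ₗ[Γ.Alg K] (∀ r, Γ.Proj K (L r))) (s : ι) (r : μ) :
    entry (g ∘ₗ f) s r = ∑ t, entry f s t * entry g t r := by
  rw [entry, ← LinearMap.comp_assoc, coeff_comp]
  rfl

theorem entry_sub (f f' : (∀ s, Γ.Proj K (I s)) →ₗ[Γ.Alg K] (∀ t, Γ.Proj K (J t)))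
    (s : ι) (t : κ) : entry (f - f') s t = entry f s t - entry f' s t := rfl

theorem aug_eq_zero_of_mem_corner {i j : Γ.Edge} {x : Γ.Alg K} (hx : x ∈ Γ.corner K i j)
    (hij : i ≠ j) (k : Γ.Edge) : Γ.aug K k x = 0 := by
  rw [← mem_corner.1 hx, map_mul, map_mul, mul_right_comm, ← map_mul, e_mul_e_of_ne _ _ hij,
    map_zero, zero_mul]

/-- The elements whose component at `t` lies in the radical. -/
def augKer (t : κ) : Submodule (Γ.Alg K) (∀ t, Γ.Proj K (J t)) where
  carrier := {x | Γ.aug K (J t) (x t : Γ.Alg K) = 0}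
  zero_mem' := by simp
  add_mem' := fun {x y} hx hy => by
    change Γ.aug K (J t) ((x t : Γ.Alg K) + (y t : Γ.Alg K)) = 0
    rw [map_add, hx, hy, add_zero]
  smul_mem' := fun a x hx => by
    change Γ.aug K (J t) (a * (x t : Γ.Alg K)) = 0
    rw [map_mul, hx, mul_zero]

theorem mem_augKer {t : κ} {x : ∀ t, Γ.Proj K (J t)} :
    x ∈ augKer t ↔ Γ.aug K (J t) (x t : Γ.Alg K) = 0 := Iff.rfl

/-- A homomorphism with superfluous image is radical. -/
theorem aug_entry_eq_zero (f : (∀ s, Γ.Proj K (I s)) →ₗ[Γ.Alg K] (∀ t, Γ.Proj K (J t)))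
    (hf : IsSuperfluousSubmodule (LinearMap.range f)) (s : ι) (t : κ) :
    Γ.aug K (J t) (entry f s t) = 0 := by
  by_contra hne
  -- An entry with nonzero augmentation would make the image a complement up to the proper submodule
  -- `augKer t`.
  have h1 : LinearMap.range f ⊔ augKer t = ⊤ := by
    rw [eq_top_iff]
    intro x _
    let y := f (Pi.single s (Γ.genProj K (I s)))
    have hy : Γ.aug K (J t) (y t : Γ.Alg K) = Γ.aug K (J t) (entry f s t) := rfl
    let c := Γ.aug K (J t) (x t : Γ.Alg K) * (Γ.aug K (J t) (entry f s t))⁻¹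
    have h2 : x = (algebraMap K (Γ.Alg K) c) • y + (x - (algebraMap K (Γ.Alg K) c) • y) := by
      abel
    rw [h2]
    refine Submodule.add_mem_sup (Submodule.smul_mem _ _ ⟨_, rfl⟩) ?_
    rw [mem_augKer]
    change Γ.aug K (J t) ((x t : Γ.Alg K) - (algebraMap K (Γ.Alg K) c) * (y t : Γ.Alg K)) = 0
    rw [map_sub, map_mul, AlgHom.commutes, hy, Algebra.algebraMap_self_apply, mul_assoc,
      inv_mul_cancel₀ hne, mul_one, sub_self]
  have h3 : (Pi.single t (Γ.genProj K (J t)) : ∀ t, Γ.Proj K (J t)) ∈ augKer t := by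
    rw [hf _ h1]
    exact Submodule.mem_top
  rw [mem_augKer, Pi.single_eq_same] at h3
  have h4 : Γ.aug K (J t) (Γ.e K (J t)) = 0 := h3
  rw [aug_e_self] at h4
  exact one_ne_zero h4

/-- A homomorphism with superfluous kernel does not vanish on any summand. -/
theorem exists_entry_ne_zero (f : (∀ s, Γ.Proj K (I s)) →ₗ[Γ.Alg K] (∀ t, Γ.Proj K (J t)))
    (hf : IsSuperfluousSubmodule (LinearMap.ker f)) (s : ι) : ∃ t, entry f s t ≠ 0 := by
  by_contra! hz
  -- A zero row puts the whole summand `s` into the kernel, which is then not superfluous.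
  have h1 : LinearMap.ker f ⊔ augKer s = ⊤ := by
    rw [eq_top_iff]
    intro x _
    have h2 : x = Pi.single s (x s) + (x - Pi.single s (x s)) := by abel
    rw [h2]
    refine Submodule.add_mem_sup ?_ ?_
    · rw [LinearMap.mem_ker]
      funext t
      apply Subtype.ext
      rw [coe_apply_apply_eq_sum]
      refine Finset.sum_eq_zero fun s' _ => ?_
      by_cases hs : s' = s
      · rw [hs, hz t, mul_zero]
      · rw [Pi.single_eq_of_ne hs]
        simp
    · rw [mem_augKer]
      simp
  have h3 : (Pi.single s (Γ.genProj K (I s)) : ∀ t, Γ.Proj K (I t)) ∈ augKer s := by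
    rw [hf _ h1]
    exact Submodule.mem_top
  rw [mem_augKer, Pi.single_eq_same] at h3
  have h4 : Γ.aug K (I s) (Γ.e K (I s)) = 0 := h3
  rw [aug_e_self] at h4
  exact one_ne_zero h4

/-- A homomorphism `f` without nontrivial self-extensions (as a two-term complex). -/
def IsRigidHom {R P Q : Type*} [Ring R] [AddCommGroup P] [Module R P] [AddCommGroup Q]
    [Module R Q] (f : P →ₗ[R] Q) : Prop :=
  ∀ g : P →ₗ[R] Q, ∃ (φ : P →ₗ[R] P) (ψ : Q →ₗ[R] Q), g = f ∘ₗ φ - ψ ∘ₗ f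

/-- The two terms of a rigid radical homomorphism have no common summands. -/
theorem IsRigidHom.ne {f : (∀ s, Γ.Proj K (I s)) →ₗ[Γ.Alg K] (∀ t, Γ.Proj K (J t))}
    (hf : IsRigidHom f) (haug : ∀ s t, Γ.aug K (J t) (entry f s t) = 0) (s : ι) (t : κ) :
    I s ≠ J t := by
  intro hst
  have haug' : ∀ s' t', Γ.aug K (J t) (entry f s' t') = 0 := by
    intro s' t'
    by_cases h : J t' = J t
    · rw [← h]
      exact haug s' t'
    · rw [← mul_e_of_mem_corner (entry_mem_corner f s' t'), map_mul]
      have : Γ.aug K (J t) (Γ.e K (J t')) = 0 := by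
        have h1 := congrArg (Γ.aug K (J t)) (Γ.e_mul_e_of_ne K h)
        rw [map_mul, aug_e_self, mul_one, map_zero] at h1
        exact h1
      rw [this, mul_zero]
  -- Rigidity is tested on the identity of a common summand: it has augmentation 1, whereas `f φ - ψ
  -- f` has augmentation 0.
  obtain ⟨φ, ψ, h⟩ := hf (ofEntries (fun s' t' => if s' = s ∧ t' = t then Γ.e K (J t) else 0) (by
    intro s' t'
    split_ifs with h
    · obtain ⟨rfl, rfl⟩ := h
      rw [hst]
      exact e_mem_corner _
    · exact zero_mem _))
  have h1 := congrArg (fun g => Γ.aug K (J t) (entry g s t)) h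
  simp only [entry_ofEntries, entry_sub, entry_comp, map_sub, map_sum, map_mul, haug', and_self,
    if_true, aug_e_self, mul_zero, zero_mul, Finset.sum_const_zero, sub_zero] at h1
  exact one_ne_zero h1

end Coefficients

end BrauerTree

/-! ### Strand matchings and their rigid homomorphisms -/

namespace BrauerTree

variable {V : Type v} [Fintype V] {Γ : BrauerTree V} {K : Type u} [Field K] {m n : ℕ}

/-- An orientation of the edges, as a sign on darts. -/
def dartSign (d : Γ.Arrow) : ℤ :=
  if Fintype.equivFin V d.fst < Fintype.equivFin V d.snd then 1 else -1

theorem dartSign_symm (d : Γ.Arrow) : dartSign d.symm = -dartSign d := by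
  have h : Fintype.equivFin V d.fst ≠ Fintype.equivFin V d.snd :=
    (Fintype.equivFin V).injective.ne (Γ.fst_ne_snd d)
  unfold dartSign
  change (if Fintype.equivFin V d.snd < Fintype.equivFin V d.fst then (1 : ℤ) else -1) = _
  rcases lt_or_gt_of_ne h with h1 | h1
  · rw [if_neg h1.not_gt, if_pos h1]
  · rw [if_pos h1, if_neg h1.not_gt, neg_neg]

theorem dartSign_ne_zero (d : Γ.Arrow) : dartSign d ≠ 0 := by
  unfold dartSign
  split_ifs <;> simp

/-- The length of the arc from a half-strand to another, with parallel strands separated. -/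
def arcLength (x : Fin m × Γ.Arrow) (y : Fin n × Γ.Arrow) : ℕ ×ₗ ℤ :=
  toLex (Γ.steps x.2 y.2, dartSign y.2 * y.1 - dartSign x.2 * x.1)

theorem steps_le_of_arcLength_le {x x' : Fin m × Γ.Arrow} {y y' : Fin n × Γ.Arrow}
    (h : arcLength x y ≤ arcLength x' y') : Γ.steps x.2 y.2 ≤ Γ.steps x'.2 y'.2 := by
  rcases (Prod.Lex.toLex_le_toLex).1 h with h | h
  · exact h.le
  · exact h.1.le

theorem arcLength_le_right_iff {x : Fin m × Γ.Arrow} {t t' : Fin n} {d : Γ.Arrow} :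
    arcLength x (t, d) ≤ arcLength x (t', d) ↔ dartSign d * t ≤ dartSign d * t' := by
  simp [arcLength, Prod.Lex.toLex_le_toLex]

theorem arcLength_le_left_iff {y : Fin n × Γ.Arrow} {s s' : Fin m} {d : Γ.Arrow} :
    arcLength (s, d) y ≤ arcLength (s', d) y ↔ dartSign d * s' ≤ dartSign d * s := by
  simp only [arcLength, Prod.Lex.toLex_le_toLex, lt_irrefl, true_and, false_or]
  constructor <;> intro h <;> linarith

/-- Parallel strands appear in opposite cyclic order at the two ends of their edge; this is what the
sign change of `dartSign` encodes. -/
theorem arcLength_symm_right {x x' : Fin m × Γ.Arrow} {t t' : Fin n} {d : Γ.Arrow}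
    (h : arcLength x (t, d) ≤ arcLength x (t', d)) :
    arcLength x' (t', d.symm) ≤ arcLength x' (t, d.symm) := by
  rw [arcLength_le_right_iff] at h ⊢
  rw [dartSign_symm]
  linarith

theorem arcLength_symm_left {y y' : Fin n × Γ.Arrow} {s s' : Fin m} {d : Γ.Arrow}
    (h : arcLength (s, d) y ≤ arcLength (s', d) y) :
    arcLength (s', d.symm) y' ≤ arcLength (s, d.symm) y' := by
  rw [arcLength_le_left_iff] at h ⊢
  rw [dartSign_symm]
  linarith

theorem eq_of_arcLength_right {x : Fin m × Γ.Arrow} {t t' : Fin n} {d : Γ.Arrow}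
    (h : arcLength x (t, d) ≤ arcLength x (t', d)) (h' : arcLength x (t', d) ≤ arcLength x (t, d)) :
    t = t' := by
  rw [arcLength_le_right_iff] at h h'
  have := mul_left_cancel₀ (dartSign_ne_zero d) (le_antisymm h h')
  exact Fin.ext (by exact_mod_cast this)

theorem eq_of_arcLength_left {y : Fin n × Γ.Arrow} {s s' : Fin m} {d : Γ.Arrow}
    (h : arcLength (s, d) y ≤ arcLength (s', d) y) (h' : arcLength (s', d) y ≤ arcLength (s, d) y) :
    s = s' := by
  rw [arcLength_le_left_iff] at h h'
  have := mul_left_cancel₀ (dartSign_ne_zero d) (le_antisymm h' h)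
  exact Fin.ext (by exact_mod_cast this)

/-- A planar matching of the half-strands of two families of edges: the strands are parallel copies
of the edges, each with two ends, and ends at a common vertex are matched without crossings. -/
structure StrandMatching (I : Fin m → Γ.Edge) (J : Fin n → Γ.Edge) where
  /-- the matched pairs -/
  rel : Fin m × Γ.Arrow → Fin n × Γ.Arrow → Prop
  src_left : ∀ {x y}, rel x y → Γ.src x.2 = I x.1
  src_right : ∀ {x y}, rel x y → Γ.src y.2 = J y.1
  fst_eq : ∀ {x y}, rel x y → x.2.fst = y.2.fst
  right_unique : ∀ {x y y'}, rel x y → rel x y' → y = y'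
  left_unique : ∀ {x x' y}, rel x y → rel x' y → x = x'
  stable : ∀ x y, Γ.src x.2 = I x.1 → Γ.src y.2 = J y.1 → x.2.fst = y.2.fst →
    (∃ y', rel x y' ∧ arcLength x y' ≤ arcLength x y) ∨
      (∃ x', rel x' y ∧ arcLength x' y ≤ arcLength x y)

theorem nonempty_strandMatching (I : Fin m → Γ.Edge) (J : Fin n → Γ.Edge) :
    Nonempty (StrandMatching I J) := by
  obtain ⟨M, h1, h2, h3, h4⟩ := exists_stable_matching
    (fun (x : Fin m × Γ.Arrow) (y : Fin n × Γ.Arrow) =>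
      Γ.src x.2 = I x.1 ∧ Γ.src y.2 = J y.1 ∧ x.2.fst = y.2.fst) arcLength
  exact ⟨⟨M, fun h => (h1 _ _ h).1, fun h => (h1 _ _ h).2.1, fun h => (h1 _ _ h).2.2,
    fun h h' => h2 _ _ _ h h', fun h h' => h3 _ _ _ h h', fun x y a b c => h4 x y ⟨a, b, c⟩⟩⟩

namespace StrandMatching

variable {I : Fin m → Γ.Edge} {J : Fin n → Γ.Edge} (S : StrandMatching I J)

variable (K) in
open Classical in
/-- The matrix whose nonzero entries are the paths between matched strands. -/
def mat : Matrix (Fin m) (Fin n) (Γ.Alg K) := fun s t =>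
  if h : ∃ p : Γ.Arrow × Γ.Arrow, S.rel (s, p.1) (t, p.2) then
    Γ.path K h.choose.1 (Γ.steps h.choose.1 h.choose.2) else 0

theorem exists_rel_of_mat_ne_zero {s : Fin m} {t : Fin n} (h : S.mat K s t ≠ 0) :
    ∃ d d', S.rel (s, d) (t, d') := by
  unfold mat at h
  split_ifs at h with h1
  · exact ⟨_, _, h1.choose_spec⟩
  · exact absurd rfl h

theorem mat_eq_zero {s : Fin m} {t : Fin n} (h : ∀ d d', ¬ S.rel (s, d) (t, d')) :
    S.mat K s t = 0 := by
  by_contra h1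
  obtain ⟨d, d', h2⟩ := S.exists_rel_of_mat_ne_zero h1
  exact h d d' h2

variable {S}

/-- Strands on distinct edges share at most one tree vertex, so they are matched at most once and
the choice in `mat` is harmless. -/
theorem eq_of_rel (hIJ : ∀ s t, I s ≠ J t) {s : Fin m} {t : Fin n} {d d' g g' : Γ.Arrow}
    (h : S.rel (s, d) (t, d'))
    (h' : S.rel (s, g) (t, g')) : g = d ∧ g' = d' :=
  eq_of_common_endpoints (by rw [S.src_left h, S.src_right h]; exact hIJ s t) (S.fst_eq h)
    (S.fst_eq h') (by rw [S.src_left h, S.src_left h'])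
    (by rw [S.src_right h, S.src_right h'])

theorem mat_eq_path (hIJ : ∀ s t, I s ≠ J t) {s : Fin m} {t : Fin n} {d d' : Γ.Arrow}
    (h : S.rel (s, d) (t, d')) :
    S.mat K s t = Γ.path K d (Γ.steps d d') := by
  have h1 : ∃ p : Γ.Arrow × Γ.Arrow, S.rel (s, p.1) (t, p.2) := ⟨(d, d'), h⟩
  rw [mat, dif_pos h1]
  obtain ⟨h2, h3⟩ := eq_of_rel hIJ h h1.choose_spec
  rw [h2, h3]

theorem dart_ne (hIJ : ∀ s t, I s ≠ J t) {s : Fin m} {t : Fin n} {d d' : Γ.Arrow}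
    (hd : Γ.src d = I s)
    (hd' : Γ.src d' = J t) : d ≠ d' := by
  rintro rfl
  exact hIJ s t (hd.symm.trans hd')

variable (S K) in
/-- The null-homotopic matrices. -/
def nullHomotopic : Submodule K (Matrix (Fin m) (Fin n) (Γ.Alg K)) where
  carrier := {X | ∃ (φ : Matrix (Fin m) (Fin m) (Γ.Alg K)) (ψ : Matrix (Fin n) (Fin n) (Γ.Alg K)),
    X = φ * S.mat K - S.mat K * ψ}
  zero_mem' := ⟨0, 0, by simp⟩
  add_mem' := by
    rintro _ _ ⟨φ, ψ, rfl⟩ ⟨φ', ψ', rfl⟩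
    refine ⟨φ + φ', ψ + ψ', ?_⟩
    rw [Matrix.add_mul, Matrix.mul_add]
    abel
  smul_mem' := by
    rintro c _ ⟨φ, ψ, rfl⟩
    refine ⟨c • φ, c • ψ, ?_⟩
    rw [Matrix.smul_mul, Matrix.mul_smul, smul_sub]

theorem mul_mat_mem (φ : Matrix (Fin m) (Fin m) (Γ.Alg K)) :
    φ * S.mat K ∈ S.nullHomotopic K := ⟨φ, 0, by simp⟩

theorem mat_mul_mem (ψ : Matrix (Fin n) (Fin n) (Γ.Alg K)) :
    S.mat K * ψ ∈ S.nullHomotopic K := ⟨0, -ψ, by simp⟩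

/-- The path passes through `d''`, so it is the matched entry at `(s, t')` followed by the remaining
path. Any other entry of column `t'` arrives at the other end of the strand and is killed by the
remaining path. -/
theorem single_mem_of_right_path (hIJ : ∀ s t, I s ≠ J t) {s : Fin m} {t t' : Fin n}
    {d d' d'' : Γ.Arrow}
    (h : S.rel (s, d) (t', d'')) (hne : d'' ≠ d') (hfst : d.fst = d'.fst)
    (hle : Γ.steps d d'' ≤ Γ.steps d d') :
    Matrix.single s t (Γ.path K d (Γ.steps d d')) ∈ S.nullHomotopic K := by
  have hf := S.fst_eq h
  have hd : d ≠ d'' := dart_ne hIJ (S.src_left h) (S.src_right h)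
  have h1 : Matrix.single s t (Γ.path K d (Γ.steps d d')) =
      S.mat K * Matrix.single t' t (Γ.path K d'' (Γ.steps d'' d')) := by
    ext a b
    by_cases hb : b = t
    · subst hb
      rw [Matrix.mul_single_apply_same]
      by_cases ha : a = s
      · subst ha
        rw [Matrix.single_apply_same, mat_eq_path hIJ h, steps_add_of_le hfst hf hle, path_add,
          next_pow_steps hf]
      · rw [Matrix.single_apply_of_ne _ _ _ _ _ (by tauto)]
        by_cases h0 : S.mat K a t' = 0
        · rw [h0, zero_mul]
        · obtain ⟨g, g', hg⟩ := S.exists_rel_of_mat_ne_zero h0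
          rw [mat_eq_path hIJ hg]
          have hg' : g ≠ g' := dart_ne hIJ (S.src_left hg) (S.src_right hg)
          symm
          refine path_mul_path_of_ne (steps_pos (S.fst_eq hg) hg')
            (steps_pos (hf.symm.trans hfst) hne) ?_
          rw [next_pow_steps (S.fst_eq hg)]
          rintro rfl
          exact ha (congrArg Prod.fst (S.left_unique hg h))
    · rw [Matrix.mul_single_apply_of_ne _ _ _ _ _ hb,
        Matrix.single_apply_of_ne _ _ _ _ _ (by tauto)]
  rw [h1]
  exact mat_mul_mem _

/-- Dually, the path is an initial path to `d''` followed by a matched entry, and the initial path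
kills the other entries of row `s'`. -/
theorem single_mem_of_left_path (hIJ : ∀ s t, I s ≠ J t) {s s' : Fin m} {t : Fin n}
    {d d' d'' : Γ.Arrow}
    (h : S.rel (s', d'') (t, d')) (hne : d ≠ d'') (hfst : d.fst = d'.fst)
    (hle : Γ.steps d'' d' ≤ Γ.steps d d') :
    Matrix.single s t (Γ.path K d (Γ.steps d d')) ∈ S.nullHomotopic K := by
  have hf := S.fst_eq h
  have hd : d'' ≠ d' := dart_ne hIJ (S.src_left h) (S.src_right h)
  have hf' : d.fst = d''.fst := hfst.trans hf.symm
  have h1 : Matrix.single s t (Γ.path K d (Γ.steps d d')) =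
      Matrix.single s s' (Γ.path K d (Γ.steps d d'')) * S.mat K := by
    ext a b
    by_cases ha : a = s
    · subst ha
      rw [Matrix.single_mul_apply_same]
      by_cases hb : b = t
      · subst hb
        rw [Matrix.single_apply_same, mat_eq_path hIJ h, steps_add_of_le' hfst hf' hle, path_add,
          next_pow_steps hf']
      · rw [Matrix.single_apply_of_ne _ _ _ _ _ (by tauto)]
        by_cases h0 : S.mat K s' b = 0
        · rw [h0, mul_zero]
        · obtain ⟨g, g', hg⟩ := S.exists_rel_of_mat_ne_zero h0
          rw [mat_eq_path hIJ hg]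
          have hg' : g ≠ g' := dart_ne hIJ (S.src_left hg) (S.src_right hg)
          symm
          refine path_mul_path_of_ne (steps_pos hf' hne) (steps_pos (S.fst_eq hg) hg') ?_
          rw [next_pow_steps hf']
          rintro rfl
          exact hb (congrArg Prod.fst (S.right_unique hg h))
    · rw [Matrix.single_mul_apply_of_ne _ _ _ _ _ ha,
        Matrix.single_apply_of_ne _ _ _ _ _ (by tauto)]
  rw [h1]
  exact mul_mat_mem _

/-- Column `t'` of `mat`, moved to position `t`, is null-homotopic. Besides the entry in question it
has at most one nonzero entry, from the other end of strand `t'`, to which the problem is thereby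
transferred. -/
theorem single_mem_of_right_parallel (hIJ : ∀ s t, I s ≠ J t) {s : Fin m} {t t' : Fin n}
    {d d' : Γ.Arrow}
    (h : S.rel (s, d) (t', d'))
    (hother : ∀ s'' g, S.rel (s'', g) (t', d'.symm) →
      Matrix.single s'' t (Γ.path K g (Γ.steps g d'.symm)) ∈ S.nullHomotopic K) :
    Matrix.single s t (Γ.path K d (Γ.steps d d')) ∈ S.nullHomotopic K := by
  have key : ∀ a, S.mat K a t' ≠ 0 → a = s ∨ ∃ g, S.rel (a, g) (t', d'.symm) := by
    intro a ha
    obtain ⟨g, g', hg⟩ := S.exists_rel_of_mat_ne_zero ha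
    rcases Γ.src_eq_src_iff.1 ((S.src_right hg).trans (S.src_right h).symm) with h1 | h1
    · have h1 : g' = d' := h1
      subst h1
      exact Or.inl (congrArg Prod.fst (S.left_unique hg h))
    · have h1 : g' = d'.symm := h1
      subst h1
      exact Or.inr ⟨g, hg⟩
  have h1 : S.mat K * Matrix.single t' t (1 : Γ.Alg K) = ∑ a, Matrix.single a t (S.mat K a t') := by
    ext a b
    rw [Matrix.sum_apply]
    by_cases hb : b = t
    · subst hb
      rw [Matrix.mul_single_apply_same, mul_one, Finset.sum_eq_single a]
      · rw [Matrix.single_apply_same]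
      · intro a' _ ha'
        exact Matrix.single_apply_of_ne _ _ _ _ _ (by tauto)
      · simp
    · rw [Matrix.mul_single_apply_of_ne _ _ _ _ _ hb]
      exact (Finset.sum_eq_zero fun a' _ => Matrix.single_apply_of_ne _ _ _ _ _ (by tauto)).symm
  rw [← Finset.add_sum_erase _ _ (Finset.mem_univ s), mat_eq_path hIJ h] at h1
  have h2 : ∑ a ∈ Finset.univ.erase s, Matrix.single a t (S.mat K a t') ∈ S.nullHomotopic K := by
    refine sum_mem fun a ha => ?_
    by_cases h0 : S.mat K a t' = 0
    · rw [h0, Matrix.single_zero]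
      exact zero_mem _
    · rcases key a h0 with rfl | ⟨g, hg⟩
      · exact absurd rfl (Finset.ne_of_mem_erase ha)
      · rw [mat_eq_path hIJ hg]
        exact hother a g hg
  rw [eq_sub_of_add_eq h1.symm]
  exact sub_mem (mat_mul_mem _) h2

/-- The same transfer to the other end of a strand, with row `s'` in place of a column. -/
theorem single_mem_of_left_parallel (hIJ : ∀ s t, I s ≠ J t) {s s' : Fin m} {t : Fin n}
    {d d' : Γ.Arrow}
    (h : S.rel (s', d) (t, d'))
    (hother : ∀ t'' g, S.rel (s', d.symm) (t'', g) →
      Matrix.single s t'' (Γ.path K d.symm (Γ.steps d.symm g)) ∈ S.nullHomotopic K) :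
    Matrix.single s t (Γ.path K d (Γ.steps d d')) ∈ S.nullHomotopic K := by
  have key : ∀ b, S.mat K s' b ≠ 0 → b = t ∨ ∃ g, S.rel (s', d.symm) (b, g) := by
    intro b hb
    obtain ⟨g', g, hg⟩ := S.exists_rel_of_mat_ne_zero hb
    rcases Γ.src_eq_src_iff.1 ((S.src_left hg).trans (S.src_left h).symm) with h1 | h1
    · have h1 : g' = d := h1
      subst h1
      exact Or.inl (congrArg Prod.fst (S.right_unique hg h))
    · have h1 : g' = d.symm := h1
      subst h1
      exact Or.inr ⟨g, hg⟩
  have h1 : Matrix.single s s' (1 : Γ.Alg K) * S.mat K = ∑ b, Matrix.single s b (S.mat K s' b) := by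
    ext a b
    rw [Matrix.sum_apply]
    by_cases ha : a = s
    · subst ha
      rw [Matrix.single_mul_apply_same, one_mul, Finset.sum_eq_single b]
      · rw [Matrix.single_apply_same]
      · intro a' _ ha'
        exact Matrix.single_apply_of_ne _ _ _ _ _ (by tauto)
      · simp
    · rw [Matrix.single_mul_apply_of_ne _ _ _ _ _ ha]
      exact (Finset.sum_eq_zero fun a' _ => Matrix.single_apply_of_ne _ _ _ _ _ (by tauto)).symm
  rw [← Finset.add_sum_erase _ _ (Finset.mem_univ t), mat_eq_path hIJ h] at h1
  have h2 : ∑ b ∈ Finset.univ.erase t, Matrix.single s b (S.mat K s' b) ∈ S.nullHomotopic K := by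
    refine sum_mem fun b hb => ?_
    by_cases h0 : S.mat K s' b = 0
    · rw [h0, Matrix.single_zero]
      exact zero_mem _
    · rcases key b h0 with rfl | ⟨g, hg⟩
      · exact absurd rfl (Finset.ne_of_mem_erase hb)
      · rw [mat_eq_path hIJ hg]
        exact hother b g hg
  rw [eq_sub_of_add_eq h1.symm]
  exact sub_mem (mul_mat_mem _) h2

theorem dist_symm_of_rel {r : V} {d g : Γ.Arrow} (hfst : g.fst = d.fst) (hne : g ≠ d)
    (h : Γ.graph.dist r d.fst = Γ.graph.dist r d.snd + 1) :
    Γ.graph.dist r g.symm.fst = Γ.graph.dist r g.symm.snd + 1 := by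
  refine Γ.isTree.dist_eq_add_one_of_ne (a := d.snd) (b := g.fst) (c := g.snd) ?_ g.adj ?_ ?_
  · rw [hfst]
    exact d.adj.symm
  · intro h1
    exact hne (Γ.eq_of_fst_eq_of_snd_eq hfst h1)
  · rwa [hfst]

/-- The recursion along two parallel strings of strands. -/
theorem single_mem_of_parallel (hIJ : ∀ s t, I s ≠ J t) (r : V) (B : ℕ)
    (hB : ∀ x, Γ.graph.dist r x ≤ B) (k : ℕ) :
    (∀ s t t' g d, S.rel (s, g) (t', d) → Γ.src d = J t →
      arcLength (s, g) (t, d) ≤ arcLength (s, g) (t', d) →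
      Γ.graph.dist r d.fst = Γ.graph.dist r d.snd + 1 → B < Γ.graph.dist r d.fst + k →
      Matrix.single s t (Γ.path K g (Γ.steps g d)) ∈ S.nullHomotopic K) ∧
    (∀ s s' t g d, S.rel (s', g) (t, d) → Γ.src g = I s →
      arcLength (s, g) (t, d) ≤ arcLength (s', g) (t, d) →
      Γ.graph.dist r g.fst = Γ.graph.dist r g.snd + 1 → B < Γ.graph.dist r g.fst + k →
      Matrix.single s t (Γ.path K g (Γ.steps g d)) ∈ S.nullHomotopic K) := by
  -- `k` bounds the number of steps left before the distance from `r` exceeds the bound `B`. At `k =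
  -- 0` no tree vertex is far enough away.
  induction k with
  | zero =>
    constructor
    · intro _ _ _ _ d _ _ _ _ h
      exact absurd h (not_lt.2 (hB d.fst))
    · intro _ _ _ g _ _ _ _ _ h
      exact absurd h (not_lt.2 (hB g.fst))
  | succ k ih =>
    constructor
    · intro s t t' g d h hd hle hdist hk
      have hfst := S.fst_eq h
      -- Stability: if it is `(s, g)` that has the short arc, its partner is `(t', d)`, and the two
      -- inequalities give `t = t'`.
      obtain ⟨⟨s₃, g'⟩, h1, h2⟩ : ∃ x', S.rel x' (t, d) ∧
          arcLength x' (t, d) ≤ arcLength (s, g) (t, d) := by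
        rcases S.stable (s, g) (t, d) (S.src_left h) hd hfst with ⟨y, h1, h2⟩ | h1
        · have := S.right_unique h1 h
          subst this
          have := eq_of_arcLength_right hle h2
          subst this
          exact ⟨_, h1, le_rfl⟩
        · exact h1
      -- If `s₃` is parallel to `s`, the comparison passes with reversed order to the other end, one
      -- step farther from `r`. Otherwise the strings separate here and the path factors.
      by_cases hg : g = g'
      · subst hg
        refine single_mem_of_left_parallel hIJ h1 fun t₃ e he => ?_
        have hne : g ≠ d := dart_ne hIJ (S.src_left h) hd
        have hdist' := dist_symm_of_rel hfst hne hdist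
        refine ih.2 s s₃ t₃ g.symm e he ((Γ.src_symm g).trans (S.src_left h))
          (arcLength_symm_left h2) hdist' ?_
        have h3 : g.symm.snd = d.fst := hfst
        rw [hdist', h3]
        omega
      · exact single_mem_of_left_path hIJ h1 hg hfst (steps_le_of_arcLength_le h2)
    · intro s s' t g d h hg hle hdist hk
      have hfst := S.fst_eq h
      obtain ⟨⟨t₃, d'⟩, h1, h2⟩ : ∃ y', S.rel (s, g) y' ∧
          arcLength (s, g) y' ≤ arcLength (s, g) (t, d) := by
        rcases S.stable (s, g) (t, d) hg (S.src_right h) hfst with h1 | ⟨x, h1, h2⟩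
        · exact h1
        · have := S.left_unique h1 h
          subst this
          have := eq_of_arcLength_left hle h2
          subst this
          exact ⟨_, h1, le_rfl⟩
      by_cases hd : d' = d
      · subst hd
        refine single_mem_of_right_parallel hIJ h1 fun s₃ e he => ?_
        have hne : d' ≠ g := (dart_ne hIJ hg (S.src_right h)).symm
        have hdist' := dist_symm_of_rel hfst.symm hne hdist
        refine ih.1 s₃ t t₃ e d'.symm he ((Γ.src_symm d').trans (S.src_right h))
          (arcLength_symm_right h2) hdist' ?_
        have h3 : d'.symm.snd = g.fst := hfst.symm
        rw [hdist', h3]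
        omega
      · exact single_mem_of_right_path hIJ h1 hd hfst (steps_le_of_arcLength_le h2)

theorem exists_dist_le (r : V) : ∃ B : ℕ, ∀ x, Γ.graph.dist r x ≤ B := by
  obtain ⟨B, hB⟩ := (Set.finite_range (Γ.graph.dist r)).bddAbove
  exact ⟨B, fun x => hB ⟨x, rfl⟩⟩

theorem dist_fst_symm (d : Γ.Arrow) :
    Γ.graph.dist d.fst d.symm.fst = Γ.graph.dist d.fst d.symm.snd + 1 := by
  change Γ.graph.dist d.fst d.snd = Γ.graph.dist d.fst d.fst + 1
  rw [SimpleGraph.dist_self, SimpleGraph.dist_eq_one_iff_adj.2 d.adj]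

/-- Stability provides a partner along an arc that is no longer. On another edge it lets the path
factor; on a parallel strand it starts the recursion, rooted at the present tree vertex. -/
theorem single_path_mem (hIJ : ∀ s t, I s ≠ J t) {s : Fin m} {t : Fin n} {d d' : Γ.Arrow}
    (hd : Γ.src d = I s)
    (hd' : Γ.src d' = J t) (hfst : d.fst = d'.fst) :
    Matrix.single s t (Γ.path K d (Γ.steps d d')) ∈ S.nullHomotopic K := by
  rcases S.stable (s, d) (t, d') hd hd' hfst with ⟨⟨t', d''⟩, h1, h2⟩ | ⟨⟨s', d''⟩, h1, h2⟩
  · by_cases hne : d'' = d'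
    · subst hne
      refine single_mem_of_right_parallel hIJ h1 fun s₃ e he => ?_
      obtain ⟨B, hB⟩ := exists_dist_le (Γ := Γ) d''.fst
      exact (single_mem_of_parallel hIJ d''.fst B hB (B + 1)).1 s₃ t t' e d''.symm he
        ((Γ.src_symm d'').trans hd') (arcLength_symm_right h2) (dist_fst_symm d'') (by omega)
    · exact single_mem_of_right_path hIJ h1 hne hfst (steps_le_of_arcLength_le h2)
  · by_cases hne : d = d''
    · subst hne
      refine single_mem_of_left_parallel hIJ h1 fun t₃ e he => ?_
      obtain ⟨B, hB⟩ := exists_dist_le (Γ := Γ) d.fst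
      exact (single_mem_of_parallel hIJ d.fst B hB (B + 1)).2 s s' t₃ d.symm e he
        ((Γ.src_symm d).trans hd) (arcLength_symm_left h2) (dist_fst_symm d) (by omega)
    · exact single_mem_of_left_path hIJ h1 hne hfst (steps_le_of_arcLength_le h2)

theorem mem_nullHomotopic (hIJ : ∀ s t, I s ≠ J t) {X : Matrix (Fin m) (Fin n) (Γ.Alg K)}
    (hX : ∀ s t, X s t ∈ Γ.corner K (I s) (J t)) : X ∈ S.nullHomotopic K := by
  rw [Matrix.matrix_eq_sum_single X]
  refine sum_mem fun s _ => sum_mem fun t _ => ?_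
  by_cases h0 : X s t = 0
  · rw [h0, Matrix.single_zero]
    exact zero_mem _
  · obtain ⟨d, d', hd, hd', hfst⟩ := exists_common_of_mem_corner (hX s t) h0
    have h1 := hX s t
    rw [← hd, ← hd'] at h1
    obtain ⟨c, hc⟩ := exists_of_mem_corner_of_common hfst
      (by rw [hd, hd']; exact hIJ s t) h1
    rw [hc, ← Matrix.smul_single]
    exact Submodule.smul_mem _ c (single_path_mem hIJ hd hd' hfst)

theorem mat_mem_corner (hIJ : ∀ s t, I s ≠ J t) (s : Fin m) (t : Fin n) :
    S.mat K s t ∈ Γ.corner K (I s) (J t) := by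
  by_cases h : ∃ d d', S.rel (s, d) (t, d')
  · obtain ⟨d, d', h⟩ := h
    rw [mat_eq_path hIJ h, ← S.src_left h, ← S.src_right h]
    exact path_mem_corner (steps_pos (S.fst_eq h) (dart_ne hIJ (S.src_left h) (S.src_right h)))
      (next_pow_steps (S.fst_eq h))
  · push Not at h
    rw [S.mat_eq_zero h]
    exact zero_mem _

variable (S K) in
/-- The homomorphism attached to a planar matching. -/
def hom (hIJ : ∀ s t, I s ≠ J t) : (∀ s, Γ.Proj K (I s)) →ₗ[Γ.Alg K] (∀ t, Γ.Proj K (J t)) :=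
  ofEntries (S.mat K) (mat_mem_corner hIJ)

theorem entry_hom (hIJ : ∀ s t, I s ≠ J t) (s : Fin m) (t : Fin n) :
    entry (S.hom K hIJ) s t = S.mat K s t :=
  entry_ofEntries _ _ s t

theorem isRigidHom_hom (hIJ : ∀ s t, I s ≠ J t) : IsRigidHom (S.hom K hIJ) := by
  intro g
  obtain ⟨φ, ψ, h⟩ := mem_nullHomotopic (S := S) hIJ (X := fun s t => entry g s t)
    (entry_mem_corner g)
  -- The null-homotopy has arbitrary entries in the algebra; the idempotents cut it down to
  -- homomorphisms without changing the products.
  refine ⟨ofEntries (fun s s' => Γ.e K (I s) * φ s s' * Γ.e K (I s'))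
    (fun s s' => e_mul_mul_e_mem_corner _ _ _),
    ofEntries (fun t t' => Γ.e K (J t) * ψ t t' * Γ.e K (J t'))
    (fun t t' => e_mul_mul_e_mem_corner _ _ _), ?_⟩
  apply entry_ext
  intro s t
  rw [entry_sub, entry_comp, entry_comp]
  simp only [entry_ofEntries, entry_hom]
  have h1 : entry g s t = (∑ s', φ s s' * S.mat K s' t) - ∑ t', S.mat K s t' * ψ t' t := by
    have := congrFun (congrFun h s) t
    rwa [Matrix.sub_apply, Matrix.mul_apply, Matrix.mul_apply] at this
  rw [← mem_corner.1 (entry_mem_corner g s t), h1, mul_sub, sub_mul, Finset.mul_sum,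
    Finset.mul_sum, Finset.sum_mul, Finset.sum_mul]
  congr 1
  · refine Finset.sum_congr rfl fun s' _ => ?_
    have := mem_corner_iff.1 (mat_mem_corner (S := S) (K := K) hIJ s' t)
    rw [mul_assoc (Γ.e K (I s) * φ s s'), this.1, ← mul_assoc, mul_assoc _ _ (Γ.e K (J t)), this.2]
  · refine Finset.sum_congr rfl fun t' _ => ?_
    have := mem_corner_iff.1 (mat_mem_corner (S := S) (K := K) hIJ s t')
    rw [← mul_assoc (Γ.e K (I s)), this.1, ← mul_assoc, ← mul_assoc, this.2]

end StrandMatching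

end BrauerTree

theorem IsSuperfluousSubmodule.map_equiv {R M N : Type*} [Ring R] [AddCommGroup M] [Module R M]
    [AddCommGroup N] [Module R N] {U : Submodule R M} (hU : IsSuperfluousSubmodule U)
    (e : M ≃ₗ[R] N) : IsSuperfluousSubmodule (U.map e.toLinearMap) := by
  intro X hX
  have h1 : U ⊔ X.comap e.toLinearMap = ⊤ := by
    rw [eq_top_iff]
    intro x _
    have h2 : e x ∈ U.map e.toLinearMap ⊔ X := by
      rw [hX]
      exact Submodule.mem_top
    obtain ⟨y, ⟨y', hy', rfl⟩, z, hz, hyz⟩ := Submodule.mem_sup.1 h2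
    refine Submodule.mem_sup.2 ⟨y', hy', e.symm z, ?_, ?_⟩
    · rw [Submodule.mem_comap]
      simpa using hz
    · apply e.injective
      rw [← hyz]
      simp
  have h3 := hU _ h1
  rw [eq_top_iff]
  intro y _
  have h4 : e.symm y ∈ X.comap e.toLinearMap := by
    rw [h3]
    exact Submodule.mem_top
  simpa using h4

namespace BrauerTree

variable {V : Type v} [Fintype V] {Γ : BrauerTree V} {K : Type u} [Field K] {m n : ℕ}

/-! ### Block decompositions and indecomposability -/

section Splitting

variable {ι κ : Type*} [Fintype ι] [DecidableEq ι] [Fintype κ] [DecidableEq κ]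
  {I : ι → Γ.Edge} {J : κ → Γ.Edge}

open Classical in
/-- The projection onto the summands in a set. -/
def restr (Z : Set κ) (x : ∀ t, Γ.Proj K (J t)) : ∀ t, Γ.Proj K (J t) :=
  fun t => if t ∈ Z then x t else 0

/-- The submodule of the summands in a set. -/
def summand (Z : Set κ) : Submodule (Γ.Alg K) (∀ t, Γ.Proj K (J t)) where
  carrier := {x | ∀ t ∉ Z, x t = 0}
  zero_mem' := fun _ _ => rfl
  add_mem' := fun {x y} hx hy t ht => by
    rw [Pi.add_apply, hx t ht, hy t ht, add_zero]
  smul_mem' := fun a x hx t ht => by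
    rw [Pi.smul_apply, hx t ht, smul_zero]

theorem single_mem_summand {Z : Set κ} {t : κ} (ht : t ∈ Z) (y : Γ.Proj K (J t)) :
    (Pi.single t y : ∀ t, Γ.Proj K (J t)) ∈ summand Z := by
  intro t' ht'
  rw [Pi.single_eq_of_ne]
  rintro rfl
  exact ht' ht

/-- A block decomposition of a minimal presentation of an indecomposable module is trivial. -/
theorem eq_empty_or_eq_univ_of_isIndecomposableModule {M : Type*} [AddCommGroup M]
    [Module (Γ.Alg K) M] (hM : IsIndecomposableModule (Γ.Alg K) M)
    (f : (∀ s, Γ.Proj K (I s)) →ₗ[Γ.Alg K] (∀ t, Γ.Proj K (J t)))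
    (p : (∀ t, Γ.Proj K (J t)) →ₗ[Γ.Alg K] M) (hp : Function.Surjective p)
    (hfp : LinearMap.range f = LinearMap.ker p)
    (haug : ∀ s t, Γ.aug K (J t) (entry f s t) = 0) (hrow : ∀ s, ∃ t, entry f s t ≠ 0)
    (Z₀ : Set ι) (Z₁ : Set κ) (hZ : ∀ s t, entry f s t ≠ 0 → (s ∈ Z₀ ↔ t ∈ Z₁)) :
    (Z₀ = ∅ ∧ Z₁ = ∅) ∨ (Z₀ = Set.univ ∧ Z₁ = Set.univ) := by
  classical
  -- Since `f` respects the blocks, its image splits along them, and so does the cokernel.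
  have hcompl : IsCompl ((summand Z₁).map p) ((summand Z₁ᶜ).map p) := by
    constructor
    · rw [Submodule.disjoint_def]
      rintro _ ⟨a, ha, rfl⟩ ⟨b, hb, hab⟩
      have h1 : a - b ∈ LinearMap.range f := by
        rw [hfp, LinearMap.mem_ker, map_sub, hab, sub_self]
      obtain ⟨x, hx⟩ := h1
      have h2 : f (restr Z₀ x) = a := by
        funext t
        apply Subtype.ext
        rw [coe_apply_apply_eq_sum]
        by_cases ht : t ∈ Z₁
        · have h3 : b t = 0 := hb t (fun h => h ht)
          have h4 : a t = f x t := by rw [hx, Pi.sub_apply, h3, sub_zero]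
          rw [h4, coe_apply_apply_eq_sum]
          refine Finset.sum_congr rfl fun s _ => ?_
          by_cases h0 : entry f s t = 0
          · rw [h0, mul_zero, mul_zero]
          · rw [restr, if_pos ((hZ s t h0).2 ht)]
        · rw [ha t ht]
          refine Finset.sum_eq_zero fun s _ => ?_
          by_cases h0 : entry f s t = 0
          · rw [h0, mul_zero]
          · rw [restr, if_neg (fun h => ht ((hZ s t h0).1 h))]
            simp
      have h5 : a ∈ LinearMap.ker p := by
        rw [← hfp]
        exact ⟨_, h2⟩
      exact h5
    · rw [codisjoint_iff, eq_top_iff]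
      intro y _
      obtain ⟨x, rfl⟩ := hp y
      have h1 : x = restr Z₁ x + restr Z₁ᶜ x := by
        funext t
        by_cases ht : t ∈ Z₁ <;> simp [restr, ht]
      rw [h1, map_add]
      refine Submodule.add_mem_sup ⟨_, ?_, rfl⟩ ⟨_, ?_, rfl⟩
      · intro t ht
        simp [restr, ht]
      · intro t ht
        simp [restr] at ht ⊢
        tauto
  -- No generator of `P₁` dies in `M`, because the image of `f` is radical.
  have hno : ∀ Z : Set κ, (summand Z).map p = ⊥ → Z = ∅ := by
    intro Z h
    rw [Set.eq_empty_iff_forall_notMem]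
    intro t ht
    have h1 : p (Pi.single t (Γ.genProj K (J t))) = 0 := by
      have : p (Pi.single t (Γ.genProj K (J t))) ∈ (summand Z).map p :=
        ⟨_, single_mem_summand ht _, rfl⟩
      rwa [h, Submodule.mem_bot] at this
    have h2 : Pi.single t (Γ.genProj K (J t)) ∈ LinearMap.range f := by
      rw [hfp]
      exact h1
    obtain ⟨x, hx⟩ := h2
    have h3 := coe_apply_apply_eq_sum f x t
    rw [hx, Pi.single_eq_same] at h3
    have h4 := congrArg (Γ.aug K (J t)) h3
    simp only [map_sum, map_mul, haug, mul_zero, Finset.sum_const_zero] at h4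
    exact one_ne_zero ((Γ.aug_e_self K (J t)).symm.trans h4)
  rcases hM.2 _ _ hcompl with h | h
  · have h1 := hno _ h
    refine Or.inl ⟨?_, h1⟩
    rw [Set.eq_empty_iff_forall_notMem]
    intro s hs
    obtain ⟨t, ht⟩ := hrow s
    have := (hZ s t ht).1 hs
    rw [h1] at this
    exact this
  · have h1 : Z₁ = Set.univ := Set.compl_empty_iff.1 (hno _ h)
    refine Or.inr ⟨?_, h1⟩
    rw [Set.eq_univ_iff_forall]
    intro s
    obtain ⟨t, ht⟩ := hrow s
    refine (hZ s t ht).2 ?_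
    rw [h1]
    exact Set.mem_univ t

end Splitting

/-! ### Strings of linked strands and their free ends -/

namespace StrandMatching

variable {I : Fin m → Γ.Edge} {J : Fin n → Γ.Edge} (S : StrandMatching I J)

/-- The edge of a strand. -/
def label (I : Fin m → Γ.Edge) (J : Fin n → Γ.Edge) : Fin m ⊕ Fin n → Γ.Edge := Sum.elim I J

/-- The matching of the half-strands, made symmetric. -/
def linked : Fin m ⊕ Fin n → Γ.Arrow → Fin m ⊕ Fin n → Γ.Arrow → Prop
  | .inl s, d, .inr t, g => S.rel (s, d) (t, g)
  | .inr t, d, .inl s, g => S.rel (s, g) (t, d)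
  | _, _, _, _ => False

variable {S}

theorem linked_symm {a b : Fin m ⊕ Fin n} {d g : Γ.Arrow} (h : S.linked a d b g) :
    S.linked b g a d := by
  rcases a with s | t <;> rcases b with s' | t' <;> exact h

theorem linked_unique {a b b' : Fin m ⊕ Fin n} {d g g' : Γ.Arrow} (h : S.linked a d b g)
    (h' : S.linked a d b' g') : b = b' ∧ g = g' := by
  rcases a with s | t <;> rcases b with s₁ | t₁ <;> rcases b' with s₂ | t₂ <;>
    simp only [linked] at h h'
  · have := S.right_unique h h'
    simp_all
  · have := S.left_unique h h'
    simp_all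

theorem linked_src {a b : Fin m ⊕ Fin n} {d g : Γ.Arrow} (h : S.linked a d b g) :
    Γ.src d = label I J a := by
  rcases a with s | t <;> rcases b with s' | t' <;> simp only [linked] at h
  · exact S.src_left h
  · exact S.src_right h

theorem linked_fst {a b : Fin m ⊕ Fin n} {d g : Γ.Arrow} (h : S.linked a d b g) :
    d.fst = g.fst := by
  rcases a with s | t <;> rcases b with s' | t' <;> simp only [linked] at h
  · exact S.fst_eq h
  · exact (S.fst_eq h).symm

theorem linked_ne (hIJ : ∀ s t, I s ≠ J t) {a b : Fin m ⊕ Fin n} {d g : Γ.Arrow}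
    (h : S.linked a d b g) : g ≠ d := by
  rcases a with s | t <;> rcases b with s' | t' <;> simp only [linked] at h
  · exact (dart_ne hIJ (S.src_left h) (S.src_right h)).symm
  · exact dart_ne hIJ (S.src_left h) (S.src_right h)

variable (S) in
/-- The strands met on the way along a string, with the direction of travel. -/
inductive Reach (a₀ : Fin m ⊕ Fin n) (d₀ : Γ.Arrow) : ℕ → Fin m ⊕ Fin n → Γ.Arrow → Prop
  | base : Reach a₀ d₀ 0 a₀ d₀
  | step {k a d b g} : Reach a₀ d₀ k a d → S.linked a d.symm b g → Reach a₀ d₀ (k + 1) b g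

section Reach

variable {a₀ : Fin m ⊕ Fin n} {d₀ : Γ.Arrow}

theorem Reach.src (h₀ : Γ.src d₀ = label I J a₀) {k : ℕ} {a : Fin m ⊕ Fin n} {d : Γ.Arrow}
    (h : S.Reach a₀ d₀ k a d) : Γ.src d = label I J a := by
  cases h with
  | base => exact h₀
  | step _ h => exact linked_src (linked_symm h)

/-- Linked half-strands lie on different edges, so the string never backtracks; in a tree each step
then leads one farther from the start. -/
theorem Reach.dist (hIJ : ∀ s t, I s ≠ J t) {k : ℕ} {a : Fin m ⊕ Fin n} {d : Γ.Arrow}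
    (h : S.Reach a₀ d₀ k a d) :
    Γ.graph.dist d₀.fst d.fst = k ∧ Γ.graph.dist d₀.fst d.snd = k + 1 := by
  induction h with
  | base => exact ⟨SimpleGraph.dist_self, SimpleGraph.dist_eq_one_iff_adj.2 d₀.adj⟩
  | @step k a d b g _ h ih =>
    have h1 : d.snd = g.fst := linked_fst h
    have h2 : Γ.graph.dist d₀.fst g.fst = k + 1 := by rw [← h1, ih.2]
    refine ⟨h2, ?_⟩
    rw [← h2]
    refine Γ.isTree.dist_eq_add_one_of_ne (a := d.fst) (b := g.fst) ?_ g.adj ?_ ?_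
    · rw [← h1]
      exact d.adj
    · intro h3
      exact linked_ne hIJ h (Γ.eq_of_fst_eq_of_snd_eq h1.symm h3)
    · rw [h2, ih.1]

theorem Reach.eq_of_zero {a : Fin m ⊕ Fin n} {d : Γ.Arrow} (h : S.Reach a₀ d₀ 0 a d) :
    a = a₀ ∧ d = d₀ := by
  cases h
  exact ⟨rfl, rfl⟩

theorem Reach.linked_of_one {a : Fin m ⊕ Fin n} {d : Γ.Arrow} (h : S.Reach a₀ d₀ 1 a d) :
    S.linked a₀ d₀.symm a d := by
  cases h with
  | step h h' =>
    obtain ⟨rfl, rfl⟩ := h.eq_of_zero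
    exact h'

/-- Of the two ends of a reached strand, one leads back to the preceding strand and the other
onwards; the start has no way back because its end is free. -/
theorem exists_reach_of_linked (h₀ : Γ.src d₀ = label I J a₀)
    (hfree : ∀ b g, ¬ S.linked a₀ d₀ b g) {a b : Fin m ⊕ Fin n} {g e : Γ.Arrow}
    (h : S.linked a g b e) (ha : ∃ k d, S.Reach a₀ d₀ k a d) : ∃ k d, S.Reach a₀ d₀ k b d := by
  obtain ⟨k, d, hr⟩ := ha
  rcases Γ.src_eq_src_iff.1 ((linked_src h).trans (hr.src h₀).symm) with h1 | h1
  · have h1 : g = d := h1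
    subst h1
    cases hr with
    | base => exact absurd h (hfree b e)
    | @step k a' d' _ _ hr' h' =>
      obtain ⟨rfl, -⟩ := linked_unique h (linked_symm h')
      exact ⟨_, _, hr'⟩
  · have h1 : g = d.symm := h1
    subst h1
    exact ⟨_, _, hr.step h⟩

/-- The structure of the string that starts with a free half-strand, provided that it contains all
strands. -/
theorem free_end_structure (hIJ : ∀ s t, I s ≠ J t) (h₀ : Γ.src d₀ = label I J a₀)
    (hfree : ∀ b g, ¬ S.linked a₀ d₀ b g)
    (hconn : ∀ Z : Set (Fin m ⊕ Fin n),
      (∀ a g b e, S.linked a g b e → a ∈ Z → b ∈ Z) → Z.Nonempty → Z = Set.univ) :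
    (∀ a g, Γ.src g = label I J a → g.fst = d₀.fst → a = a₀) ∧
    (∀ a g, Γ.src g = label I J a → g.fst = d₀.snd → a = a₀ ∨ S.linked a₀ d₀.symm a g) ∧
    (∀ a g, Γ.src g = label I J a → Γ.graph.Adj d₀.fst g.fst → g.fst = d₀.snd) := by
  have hall : ∀ a, ∃ k d, S.Reach a₀ d₀ k a d := by
    have := hconn {a | ∃ k d, S.Reach a₀ d₀ k a d}
      (fun a g b e h ha => exists_reach_of_linked h₀ hfree h ha) ⟨a₀, 0, d₀, Reach.base⟩
    exact Set.eq_univ_iff_forall.1 this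
  have hcase : ∀ a g, Γ.src g = label I J a → ∃ k d,
      S.Reach a₀ d₀ k a d ∧ (g = d ∨ g = d.symm) := by
    intro a g hg
    obtain ⟨k, d, h⟩ := hall a
    exact ⟨k, d, h, Γ.src_eq_src_iff.1 (hg.trans (h.src h₀).symm)⟩
  -- At distance one from the free end there are only the far end of the first strand and the near
  -- end of the second.
  have hone : ∀ a g, Γ.src g = label I J a → Γ.graph.dist d₀.fst g.fst = 1 →
      (a = a₀ ∧ g = d₀.symm) ∨ S.linked a₀ d₀.symm a g := by
    intro a g hg h1
    obtain ⟨k, d, h, rfl | rfl⟩ := hcase a g hg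
    · have h2 := (h.dist hIJ).1
      obtain rfl : k = 1 := by omega
      exact Or.inr h.linked_of_one
    · have h2 := (h.dist hIJ).2
      change Γ.graph.dist d₀.fst d.snd = 1 at h1
      obtain rfl : k = 0 := by omega
      obtain ⟨rfl, rfl⟩ := h.eq_of_zero
      exact Or.inl ⟨rfl, rfl⟩
  refine ⟨?_, ?_, ?_⟩
  · intro a g hg hv
    obtain ⟨k, d, h, rfl | rfl⟩ := hcase a g hg
    · have h2 := (h.dist hIJ).1
      rw [hv, SimpleGraph.dist_self] at h2
      subst h2
      exact h.eq_of_zero.1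
    · have h2 := (h.dist hIJ).2
      change d.snd = d₀.fst at hv
      rw [hv, SimpleGraph.dist_self] at h2
      omega
  · intro a g hg hw
    rcases hone a g hg (by rw [hw]; exact SimpleGraph.dist_eq_one_iff_adj.2 d₀.adj) with h | h
    · exact Or.inl h.1
    · exact Or.inr h
  · intro a g hg hadj
    rcases hone a g hg (SimpleGraph.dist_eq_one_iff_adj.2 hadj) with ⟨-, rfl⟩ | h
    · rfl
    · exact (linked_fst h).symm

end Reach

/-- Connectedness of the matching attached to an indecomposable module. -/
theorem eq_univ_of_linked_closed {M : Type*} [AddCommGroup M]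
    [Module (Γ.Alg K) M] (hM : IsIndecomposableModule (Γ.Alg K) M) (hIJ : ∀ s t, I s ≠ J t)
    (f : (∀ s, Γ.Proj K (I s)) →ₗ[Γ.Alg K] (∀ t, Γ.Proj K (J t)))
    (p : (∀ t, Γ.Proj K (J t)) →ₗ[Γ.Alg K] M) (hp : Function.Surjective p)
    (hfp : LinearMap.range f = LinearMap.ker p) (hker : IsSuperfluousSubmodule (LinearMap.ker f))
    (φ : (∀ s, Γ.Proj K (I s)) ≃ₗ[Γ.Alg K] (∀ s, Γ.Proj K (I s)))
    (ψ : (∀ t, Γ.Proj K (J t)) ≃ₗ[Γ.Alg K] (∀ t, Γ.Proj K (J t)))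
    (hφψ : ψ.toLinearMap ∘ₗ f = S.hom K hIJ ∘ₗ φ.toLinearMap)
    (Z : Set (Fin m ⊕ Fin n)) (hZ : ∀ a g b e, S.linked a g b e → a ∈ Z → b ∈ Z)
    (hne : Z.Nonempty) : Z = Set.univ := by
  have hcomm : ∀ x, ψ (f x) = S.hom K hIJ (φ x) := fun x => LinearMap.congr_fun hφψ x
  -- The isomorphism makes the matching homomorphism a presentation of the same module, so the
  -- splitting argument applies with the links as blocks.
  have hker' : LinearMap.ker (S.hom K hIJ) = (LinearMap.ker f).map φ.toLinearMap := by
    ext x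
    rw [LinearMap.mem_ker]
    constructor
    · intro h
      refine ⟨φ.symm x, ?_, φ.apply_symm_apply x⟩
      change f (φ.symm x) = 0
      apply ψ.injective
      rw [hcomm, φ.apply_symm_apply, h, map_zero]
    · rintro ⟨y, hy, rfl⟩
      have hy : f y = 0 := hy
      change S.hom K hIJ (φ y) = 0
      rw [← hcomm, hy, map_zero]
  have hrange : LinearMap.range (S.hom K hIJ) = LinearMap.ker (p ∘ₗ ψ.symm.toLinearMap) := by
    ext x
    rw [LinearMap.mem_ker]
    constructor
    · rintro ⟨y, rfl⟩
      have h1 : ψ.symm (S.hom K hIJ y) = f (φ.symm y) := by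
        apply ψ.injective
        rw [hcomm, φ.apply_symm_apply, ψ.apply_symm_apply]
      change p (ψ.symm (S.hom K hIJ y)) = 0
      rw [h1, ← LinearMap.mem_ker, ← hfp]
      exact ⟨_, rfl⟩
    · intro h
      have h1 : ψ.symm x ∈ LinearMap.range f := by
        rw [hfp]
        exact h
      obtain ⟨y, hy⟩ := h1
      exact ⟨φ y, by rw [← hcomm, hy, ψ.apply_symm_apply]⟩
  have hsplit := eq_empty_or_eq_univ_of_isIndecomposableModule hM (S.hom K hIJ)
    (p ∘ₗ ψ.symm.toLinearMap) (hp.comp ψ.symm.surjective) hrange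
    (fun s t => aug_eq_zero_of_mem_corner (entry_mem_corner _ s t) (hIJ s t) _)
    (exists_entry_ne_zero _ (by rw [hker']; exact hker.map_equiv φ))
    {s | Sum.inl s ∈ Z} {t | Sum.inr t ∈ Z} (by
      intro s t h
      rw [entry_hom] at h
      obtain ⟨d, d', h⟩ := S.exists_rel_of_mat_ne_zero h
      exact ⟨fun hs => hZ (Sum.inl s) d (Sum.inr t) d' h hs,
        fun ht => hZ (Sum.inr t) d' (Sum.inl s) d h ht⟩)
  rcases hsplit with ⟨h1, h2⟩ | ⟨h1, h2⟩
  · exfalso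
    obtain ⟨s | t, ha⟩ := hne
    · exact Set.eq_empty_iff_forall_notMem.1 h1 s ha
    · exact Set.eq_empty_iff_forall_notMem.1 h2 t ha
  · rw [Set.eq_univ_iff_forall]
    rintro (s | t)
    · exact Set.eq_univ_iff_forall.1 h1 s
    · exact Set.eq_univ_iff_forall.1 h2 t

/-- Links stay at one tree vertex. If every `I`-end at an endpoint of `p` were linked, the matching
would inject these ends into the `J`-ends there. -/
theorem exists_free_left (p : Γ.Edge)
    (h : ∑ t, (Γ.common (J t) p).ncard < ∑ s, (Γ.common (I s) p).ncard) :
    ∃ s, ∃ d ∈ Γ.common (I s) p, ∀ b g, ¬ S.linked (Sum.inl s) d b g := by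
  by_contra! hno
  have key : ∀ x : Σ s, Γ.common (I s) p, ∃ y : Σ t, Γ.common (J t) p,
      S.rel (x.1, x.2.1) (y.1, y.2.1) := by
    rintro ⟨s, d, hd⟩
    obtain ⟨b, g, hb⟩ := hno s d hd
    rcases b with s' | t
    · exact absurd hb (by simp [linked])
    · obtain ⟨-, q, hq, hq'⟩ := hd
      exact ⟨⟨t, g, S.src_right hb, q, hq, (S.fst_eq hb).symm.trans hq'⟩, hb⟩
  choose F hF using key
  have hinj : Function.Injective F := by
    intro x x' hxx
    have h1 := hF x
    rw [hxx] at h1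
    have h2 := S.left_unique h1 (hF x')
    obtain ⟨s, d, hd⟩ := x
    obtain ⟨s', d', hd'⟩ := x'
    simp only [Prod.mk.injEq] at h2
    obtain ⟨rfl, rfl⟩ := h2
    rfl
  have h3 := Nat.card_le_card_of_injective F hinj
  rw [Nat.card_sigma, Nat.card_sigma] at h3
  exact absurd h (not_lt.2 h3)

theorem exists_free_right (p : Γ.Edge)
    (h : ∑ s, (Γ.common (I s) p).ncard < ∑ t, (Γ.common (J t) p).ncard) :
    ∃ t, ∃ d ∈ Γ.common (J t) p, ∀ b g, ¬ S.linked (Sum.inr t) d b g := by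
  by_contra! hno
  have key : ∀ x : Σ t, Γ.common (J t) p, ∃ y : Σ s, Γ.common (I s) p,
      S.rel (y.1, y.2.1) (x.1, x.2.1) := by
    rintro ⟨t, d, hd⟩
    obtain ⟨b, g, hb⟩ := hno t d hd
    rcases b with s | t'
    · obtain ⟨-, q, hq, hq'⟩ := hd
      exact ⟨⟨s, g, S.src_left hb, q, hq, (S.fst_eq hb).trans hq'⟩, hb⟩
    · exact absurd hb (by simp [linked])
  choose F hF using key
  have hinj : Function.Injective F := by
    intro x x' hxx
    have h1 := hF x
    rw [hxx] at h1
    have h2 := S.right_unique h1 (hF x')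
    obtain ⟨s, d, hd⟩ := x
    obtain ⟨s', d', hd'⟩ := x'
    simp only [Prod.mk.injEq] at h2
    obtain ⟨rfl, rfl⟩ := h2
    rfl
  have h3 := Nat.card_le_card_of_injective F hinj
  rw [Nat.card_sigma, Nat.card_sigma] at h3
  exact absurd h (not_lt.2 h3)

end StrandMatching

/-! ### From morphisms to a surplus of half-edges -/

section Dimensions

variable {I : Fin m → Γ.Edge} {J : Fin n → Γ.Edge} {p : Γ.Edge}
  (f : (∀ s, Γ.Proj K (I s)) →ₗ[Γ.Alg K] (∀ t, Γ.Proj K (J t)))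

/-- Composition with `f`, in terms of coefficients. -/
def precompCoeff (p : Γ.Edge) :
    (∀ t, Γ.corner K (J t) p) →ₗ[K] (∀ s, Γ.corner K (I s) p) where
  toFun h s := ⟨∑ t, entry f s t * (h t : Γ.Alg K),
    sum_mem fun t _ => mul_mem_corner (entry_mem_corner f s t) (h t).2⟩
  map_add' x y := by
    funext s
    ext
    simp [mul_add, Finset.sum_add_distrib]
  map_smul' c x := by
    funext s
    ext
    simp [Finset.smul_sum]

theorem finrank_pi_corner {ι : Type*} [Fintype ι] (I : ι → Γ.Edge) (p : Γ.Edge) :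
    Module.finrank K (∀ s, Γ.corner K (I s) p) = ∑ s, (Γ.common (I s) p).ncard := by
  rw [Module.finrank_pi_fintype]
  exact Finset.sum_congr rfl fun s _ => finrank_corner _ _

theorem precompCoeff_injective
    (h : ∀ g : (∀ t, Γ.Proj K (J t)) →ₗ[Γ.Alg K] Γ.Proj K p, g ∘ₗ f = 0 → g = 0) :
    Function.Injective (precompCoeff f p) := by
  rw [← LinearMap.ker_eq_bot, eq_bot_iff]
  intro x hx
  have h1 := h (ofCoeff (fun t => (x t : Γ.Alg K)) fun t => (x t).2) (coeff_ext fun s => by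
    rw [coeff_comp]
    simp only [coeff_ofCoeff]
    exact congrArg Subtype.val (congrFun hx s))
  rw [Submodule.mem_bot]
  funext t
  apply Subtype.ext
  have := congrArg (fun g => coeff g t) h1
  simp only [coeff_ofCoeff] at this
  exact this

theorem precompCoeff_surjective
    (h : ∀ g : (∀ s, Γ.Proj K (I s)) →ₗ[Γ.Alg K] Γ.Proj K p, ∃ k, g = k ∘ₗ f) :
    Function.Surjective (precompCoeff f p) := by
  intro x
  obtain ⟨k, hk⟩ := h (ofCoeff (fun s => (x s : Γ.Alg K)) fun s => (x s).2)
  refine ⟨fun t => ⟨coeff k t, coeff_mem_corner k t⟩, ?_⟩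
  funext s
  apply Subtype.ext
  have := congrArg (fun g => coeff g s) hk
  simp only [coeff_ofCoeff, coeff_comp] at this
  exact this.symm

/-- An injection between spaces of equal dimension would be onto, and `g` would factor. -/
theorem sum_common_lt_of_not_factor
    (h : ∀ g : (∀ t, Γ.Proj K (J t)) →ₗ[Γ.Alg K] Γ.Proj K p, g ∘ₗ f = 0 → g = 0)
    (g : (∀ s, Γ.Proj K (I s)) →ₗ[Γ.Alg K] Γ.Proj K p) (hg : ∀ k, g ≠ k ∘ₗ f) :
    ∑ t, (Γ.common (J t) p).ncard < ∑ s, (Γ.common (I s) p).ncard := by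
  rw [← finrank_pi_corner (K := K), ← finrank_pi_corner (K := K)]
  have hinj := precompCoeff_injective f h
  refine lt_of_le_of_ne (LinearMap.finrank_le_finrank_of_injective hinj) fun heq => ?_
  obtain ⟨y, hy⟩ := (LinearMap.injective_iff_surjective_of_finrank_eq_finrank heq).1 hinj
    (fun s => ⟨coeff g s, coeff_mem_corner g s⟩)
  refine hg (ofCoeff (fun t => (y t : Γ.Alg K)) fun t => (y t).2) (coeff_ext fun s => ?_)
  rw [coeff_comp]
  simp only [coeff_ofCoeff]
  exact (congrArg Subtype.val (congrFun hy s)).symm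

/-- A surjection between spaces of equal dimension would be injective, and `g` would vanish. -/
theorem sum_common_lt_of_comp_eq_zero
    (h : ∀ g : (∀ s, Γ.Proj K (I s)) →ₗ[Γ.Alg K] Γ.Proj K p, ∃ k, g = k ∘ₗ f)
    (g : (∀ t, Γ.Proj K (J t)) →ₗ[Γ.Alg K] Γ.Proj K p) (hg : g ≠ 0) (hgf : g ∘ₗ f = 0) :
    ∑ s, (Γ.common (I s) p).ncard < ∑ t, (Γ.common (J t) p).ncard := by
  rw [← finrank_pi_corner (K := K), ← finrank_pi_corner (K := K)]
  have hsurj := precompCoeff_surjective f h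
  refine lt_of_le_of_ne (LinearMap.finrank_le_finrank_of_surjective hsurj) fun heq => hg ?_
  have hinj := (LinearMap.injective_iff_surjective_of_finrank_eq_finrank heq.symm).2 hsurj
  have h1 : (fun t => ⟨coeff g t, coeff_mem_corner g t⟩ : ∀ t, Γ.corner K (J t) p) = 0 := by
    apply hinj
    rw [map_zero]
    funext s
    apply Subtype.ext
    have := congrArg (fun k => coeff k s) hgf
    rw [coeff_comp] at this
    exact this
  refine coeff_ext fun t => ?_
  have h2 : coeff g t = 0 := congrArg Subtype.val (congrFun h1 t)
  rw [h2]
  rfl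

end Dimensions

end BrauerTree

namespace BrauerTree

variable {V : Type v} [Fintype V] {Γ : BrauerTree V} {K : Type u} [Field K]

/-! ### The `A`-cycles are the cycles around the tree vertices -/

section Cycles

variable (Γ) in
/-- The arrows of the cycle through `d`, in order. -/
def cycleList (d : Γ.Arrow) : List Γ.Arrow := (List.range (Γ.per d)).map fun k => (Γ.next ^ k) d

theorem mem_cycleList {d a : Γ.Arrow} : a ∈ Γ.cycleList d ↔ a.fst = d.fst := by
  rw [cycleList, List.mem_map]
  constructor
  · rintro ⟨k, -, rfl⟩
    exact Γ.next_pow_fst k d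
  · intro h
    obtain ⟨k, hk, h⟩ := Γ.exists_next_pow_eq h.symm
    exact ⟨k, List.mem_range.2 hk, h⟩

theorem nodup_cycleList (d : Γ.Arrow) : (Γ.cycleList d).Nodup :=
  List.Nodup.map_on (fun _ hk _ hl h =>
    Γ.next_pow_injOn (List.mem_range.1 hk) (List.mem_range.1 hl) h) List.nodup_range

theorem isArrowChain_cycleList (d : Γ.Arrow) : Γ.IsArrowChain K (Γ.cycleList d) := by
  refine ⟨List.ne_nil_of_mem (mem_cycleList.2 rfl), nodup_cycleList d, ?_⟩
  rw [List.isChain_iff_getElem]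
  intro k hk
  have hk' : k + 1 < Γ.per d := by simpa [cycleList] using hk
  simp only [cycleList, List.getElem_map, List.getElem_range]
  rw [next_pow_succ]
  have h : Γ.path K ((Γ.next ^ k) d) 2 ≠ 0 := path_ne_zero (by rw [per_next_pow]; omega)
  rwa [path_succ', path_one] at h

/-- Each arrow has only one possible successor, so a chain is determined by its first arrow and its
length. -/
theorem eq_map_range_of_isChain {d : Γ.Arrow} {l : List Γ.Arrow}
    (h : (d :: l).IsChain fun a b => Γ.arrow K a * Γ.arrow K b ≠ 0) :
    d :: l = (List.range (l.length + 1)).map fun k => (Γ.next ^ k) d := by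
  induction l generalizing d with
  | nil => rfl
  | cons b l ih =>
    rw [List.isChain_cons_cons] at h
    have hb : b = Γ.next d := by
      by_contra hne
      exact h.1 (arrow_mul_arrow_of_ne hne)
    subst hb
    rw [List.range_succ_eq_map, List.map_cons, List.map_map]
    exact congrArg (List.cons d) (ih h.2)

theorem fst_eq_of_mem_of_isArrowChain {d a : Γ.Arrow} {l : List Γ.Arrow}
    (h : Γ.IsArrowChain K (d :: l)) (ha : a ∈ d :: l) : a.fst = d.fst := by
  rw [eq_map_range_of_isChain h.2.2, List.mem_map] at ha
  obtain ⟨k, -, rfl⟩ := ha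
  exact Γ.next_pow_fst k d

/-- A chain containing this one stays at the same tree vertex and has no repetitions, so it cannot
be longer. -/
theorem isACycle_cycleList (d : Γ.Arrow) : Γ.IsACycle K (Γ.cycleList d) := by
  refine ⟨isArrowChain_cycleList d, fun c' hc' hinf => (hinf.eq_of_length_le ?_).symm⟩
  refine (List.subperm_of_subset hc'.2.1 fun a ha => ?_).length_le
  rw [mem_cycleList]
  cases c' with
  | nil => exact absurd rfl hc'.1
  | cons b l =>
    have hd : d ∈ b :: l := hinf.subset (mem_cycleList.2 rfl)
    rw [fst_eq_of_mem_of_isArrowChain hc' ha, fst_eq_of_mem_of_isArrowChain hc' hd]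

theorem IsACycle.exists_eq_cycleList {c : List Γ.Arrow} (hc : Γ.IsACycle K c) :
    ∃ d, c = Γ.cycleList d := by
  obtain ⟨hc, hmax⟩ := hc
  cases c with
  | nil => exact absurd rfl hc.1
  | cons d l =>
    refine ⟨d, (hmax _ (isArrowChain_cycleList d) (List.IsPrefix.isInfix ?_)).symm⟩
    have hlen : l.length + 1 ≤ Γ.per d := by
      have h1 : (d :: l).length ≤ (Γ.cycleList d).length :=
        (List.subperm_of_subset hc.2.1 fun a ha =>
          mem_cycleList.2 (fst_eq_of_mem_of_isArrowChain hc ha)).length_le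
      simpa [cycleList] using h1
    rw [eq_map_range_of_isChain hc.2.2, cycleList]
    refine List.IsPrefix.map _ ?_
    obtain ⟨k, hk⟩ := Nat.exists_eq_add_of_le hlen
    rw [hk, List.range_add (n := l.length + 1)]
    exact List.prefix_append _ _

theorem onCycle_cycleList {d : Γ.Arrow} {x : Γ.Edge} :
    Γ.OnCycle (Γ.cycleList d) x ↔ ∃ a : Γ.Arrow, Γ.src a = x ∧ a.fst = d.fst := by
  constructor
  · rintro ⟨a, ha, rfl | rfl⟩
    · exact ⟨a, rfl, mem_cycleList.1 ha⟩
    · exact ⟨Γ.next a, rfl, (Γ.next_fst a).trans (mem_cycleList.1 ha)⟩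
  · rintro ⟨a, rfl, ha⟩
    exact ⟨a, mem_cycleList.2 ha, Or.inl rfl⟩

/-- The condition on `A`-cycles in terms of half-edges. -/
theorem exists_isACycle_iff {x j : Γ.Edge} {D : Set Γ.Edge} :
    (∃ c, Γ.IsACycle K c ∧ Γ.OnCycle c x ∧ Γ.OnCycle c j ∧ ∀ y ∈ D, Γ.OnCycle c y → y = x) ↔
      ∃ d ∈ Γ.common x j, ∀ a : Γ.Arrow, a.fst = d.fst → Γ.src a ∈ D → Γ.src a = x := by
  constructor
  · rintro ⟨c, hc, hx, hj, h⟩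
    obtain ⟨d, rfl⟩ := hc.exists_eq_cycleList
    obtain ⟨a, ha, had⟩ := onCycle_cycleList.1 hx
    obtain ⟨b, hb, hbd⟩ := onCycle_cycleList.1 hj
    exact ⟨a, ⟨ha, b, hb, had.trans hbd.symm⟩, fun g hg hD =>
      h _ hD (onCycle_cycleList.2 ⟨g, rfl, hg.trans had⟩)⟩
  · rintro ⟨d, ⟨hx, q, hq, hdq⟩, h⟩
    refine ⟨Γ.cycleList d, isACycle_cycleList d, onCycle_cycleList.2 ⟨d, hx, rfl⟩,
      onCycle_cycleList.2 ⟨q, hq, hdq.symm⟩, fun y hy hyc => ?_⟩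
    obtain ⟨a, rfl, ha⟩ := onCycle_cycleList.1 hyc
    exact h a ha hy

end Cycles

/-! ### An isolated cycle supplies a morphism -/

section Products

/-- For `j ≠ i`, a nonzero product would run through `j` along the cycle at the only common endpoint
of `i` and `p`, which `hj` excludes. For `j = i` the radical element `x` is a multiple of the full
cycle and kills paths. -/
theorem mul_eq_zero_of_common {i j p : Γ.Edge} {d q : Γ.Arrow} {x y : Γ.Alg K}
    (hd : Γ.src d = i) (hq : Γ.src q = p) (hdq : d.fst = q.fst) (hip : i ≠ p)
    (hx : x ∈ Γ.corner K i j) (hy : y ∈ Γ.corner K j p) (haug : Γ.aug K j x = 0)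
    (hj : ∀ a : Γ.Arrow, Γ.src a = j → a.fst = d.fst → j = i) : x * y = 0 := by
  subst hd
  subst hq
  by_cases hij : j = Γ.src d
  · subst hij
    obtain ⟨b, rfl⟩ := exists_of_mem_corner_self_of_aug d hx haug
    obtain ⟨c, rfl⟩ := exists_of_mem_corner_of_common hdq hip hy
    rw [smul_mul_smul_comm, path_per_mul_path (steps_pos hdq fun h => hip (by rw [h])), smul_zero]
  by_contra h0
  obtain ⟨g, g', hg, hg', hgg⟩ := exists_common_of_mem_corner hx (left_ne_zero_of_mul h0)
  obtain ⟨h, h', hh, hh', hhh⟩ := exists_common_of_mem_corner hy (right_ne_zero_of_mul h0)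
  have hjp : j ≠ Γ.src q := fun h1 => hij (hj q h1.symm hdq.symm)
  have hne : Γ.src g ≠ Γ.src g' := by
    rw [hg, hg']
    exact fun h => hij h.symm
  have hne' : Γ.src h ≠ Γ.src h' := by
    rw [hh, hh']
    exact hjp
  obtain ⟨b, rfl⟩ := exists_of_mem_corner_of_common hgg hne (by rwa [hg, hg'])
  obtain ⟨c, rfl⟩ := exists_of_mem_corner_of_common hhh hne' (by rwa [hh, hh'])
  have h1 : h = g' := by
    by_contra h1
    apply h0
    rw [smul_mul_smul_comm, path_mul_path_of_ne (steps_pos hgg fun e => hne (by rw [e]))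
      (steps_pos hhh fun e => hne' (by rw [e])) (by rwa [next_pow_steps hgg]), smul_zero]
  subst h1
  obtain ⟨rfl, -⟩ := eq_of_common_endpoints hip hdq (hgg.trans hhh) hg hh'
  exact hij (hj h hh hgg.symm)

/-- A nonzero product requires `x` to arrive along the cycle of `d`, so `i` would lie on that cycle.
What remains is `i = src d`, with `x` a multiple of the full cycle. -/
theorem mul_path_eq_zero_of_common {i : Γ.Edge} {d : Γ.Arrow} {m : ℕ} (hm : 0 < m) {x : Γ.Alg K}
    (hx : x ∈ Γ.corner K i (Γ.src d)) (haug : Γ.aug K (Γ.src d) x = 0)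
    (hi : ∀ a : Γ.Arrow, Γ.src a = i → a.fst = d.fst → i = Γ.src d) : x * Γ.path K d m = 0 := by
  by_cases hij : i = Γ.src d
  · subst hij
    obtain ⟨b, rfl⟩ := exists_of_mem_corner_self_of_aug d hx haug
    rw [smul_mul_assoc, path_per_mul_path hm, smul_zero]
  by_contra h0
  obtain ⟨g, g', hg, hg', hgg⟩ := exists_common_of_mem_corner hx (left_ne_zero_of_mul h0)
  have hne : Γ.src g ≠ Γ.src g' := by
    rw [hg, hg']
    exact hij
  obtain ⟨b, rfl⟩ := exists_of_mem_corner_of_common hgg hne (by rwa [hg, hg'])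
  have h1 : d = g' := by
    by_contra h1
    apply h0
    rw [smul_mul_assoc, path_mul_path_of_ne (steps_pos hgg fun e => hne (by rw [e])) hm
      (by rwa [next_pow_steps hgg]), smul_zero]
  subst h1
  exact hij (hi g hg hgg)

end Products

section Isolated

variable {ι κ : Type*} [Fintype ι] [DecidableEq ι] [Fintype κ] [DecidableEq κ]
  {I : ι → Γ.Edge} {J : κ → Γ.Edge} {p : Γ.Edge}
  (f : (∀ s, Γ.Proj K (I s)) →ₗ[Γ.Alg K] (∀ t, Γ.Proj K (J t)))

/-- The witness is the idempotent for `p = I s`, detected by the augmentation, and otherwise the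
path along the isolated cycle; every product through `P₁` misses it. -/
theorem exists_not_factor_of_isolated (haug : ∀ s t, Γ.aug K (J t) (entry f s t) = 0)
    {s : ι} {d : Γ.Arrow} (hd : d ∈ Γ.common (I s) p)
    (hJ : ∀ t (a : Γ.Arrow), Γ.src a = J t → a.fst = d.fst → J t = I s) :
    ∃ g : (∀ s, Γ.Proj K (I s)) →ₗ[Γ.Alg K] Γ.Proj K p, ∀ k, g ≠ k ∘ₗ f := by
  obtain ⟨hds, q, hq, hdq⟩ := hd
  have key : ∃ c ∈ Γ.corner K (I s) p, ∀ k : (∀ t, Γ.Proj K (J t)) →ₗ[Γ.Alg K] Γ.Proj K p,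
      c ≠ ∑ t, entry f s t * coeff k t := by
    by_cases hp : I s = p
    · subst hp
      refine ⟨Γ.e K (I s), e_mem_corner _, fun k hk => ?_⟩
      have h1 := congrArg (Γ.aug K (I s)) hk
      rw [aug_e_self, map_sum] at h1
      refine one_ne_zero (h1.trans (Finset.sum_eq_zero fun t _ => ?_))
      rw [map_mul]
      by_cases ht : I s = J t
      · have := haug s t
        rw [← ht] at this
        rw [this, zero_mul]
      · rw [aug_eq_zero_of_mem_corner (entry_mem_corner f s t) ht, zero_mul]
    · have hne : d ≠ q := fun h => hp (by rw [← hds, ← hq, h])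
      refine ⟨Γ.path K d (Γ.steps d q), ?_, fun k hk => ?_⟩
      · rw [← hds, ← hq]
        exact path_mem_corner (steps_pos hdq hne) (next_pow_steps hdq)
      · refine path_ne_zero (steps_lt hdq).le (hk.trans (Finset.sum_eq_zero fun t _ => ?_))
        exact mul_eq_zero_of_common hds hq hdq hp (entry_mem_corner f s t) (coeff_mem_corner k t)
          (haug s t) (hJ t)
  obtain ⟨c, hc, hk⟩ := key
  refine ⟨ofCoeff (Function.update (fun _ => 0) s c) fun s' => ?_, fun k h => hk k ?_⟩
  · by_cases hs : s' = s
    · subst hs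
      rwa [Function.update_self]
    · rw [Function.update_of_ne hs]
      exact zero_mem _
  · have h1 := congrArg (fun g => coeff g s) h
    simpa only [coeff_ofCoeff, coeff_comp, Function.update_self] using h1

/-- The witness is a path of positive length along the isolated cycle. For `p = J t` the full cycle
is taken, since radical entries kill it. -/
theorem exists_comp_eq_zero_of_isolated (haug : ∀ s t, Γ.aug K (J t) (entry f s t) = 0)
    {t : κ} {d : Γ.Arrow} (hd : d ∈ Γ.common (J t) p)
    (hI : ∀ s (a : Γ.Arrow), Γ.src a = I s → a.fst = d.fst → I s = J t) :
    ∃ g : (∀ t, Γ.Proj K (J t)) →ₗ[Γ.Alg K] Γ.Proj K p, g ≠ 0 ∧ g ∘ₗ f = 0 := by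
  obtain ⟨hdt, q, hq, hdq⟩ := hd
  obtain ⟨m, hm, hm', hc⟩ : ∃ m, 0 < m ∧ m ≤ Γ.per d ∧ Γ.path K d m ∈ Γ.corner K (J t) p := by
    by_cases hp : J t = p
    · refine ⟨Γ.per d, Γ.per_pos d, le_rfl, ?_⟩
      rw [← hp, ← hdt]
      exact path_per_mem_corner d
    · have hne : d ≠ q := fun h => hp (by rw [← hdt, ← hq, h])
      refine ⟨Γ.steps d q, steps_pos hdq hne, (steps_lt hdq).le, ?_⟩
      rw [← hdt, ← hq]
      exact path_mem_corner (steps_pos hdq hne) (next_pow_steps hdq)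
  refine ⟨ofCoeff (Function.update (fun _ => 0) t (Γ.path K d m)) fun t' => ?_, fun h => ?_, ?_⟩
  · by_cases ht : t' = t
    · subst ht
      rwa [Function.update_self]
    · rw [Function.update_of_ne ht]
      exact zero_mem _
  · have h1 := congrArg (fun g => coeff g t) h
    simp only [coeff_ofCoeff, Function.update_self] at h1
    exact path_ne_zero hm' h1
  · refine coeff_ext fun s => ?_
    rw [coeff_comp]
    change _ = (0 : Γ.Alg K)
    refine Finset.sum_eq_zero fun t' _ => ?_
    rw [coeff_ofCoeff]
    by_cases ht : t' = t
    · subst ht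
      rw [Function.update_self]
      have h1 := entry_mem_corner f s t'
      have h2 := haug s t'
      have h3 := hI s
      rw [← hdt] at h1 h2 h3
      exact mul_path_eq_zero_of_common hm h1 h2 h3
    · rw [Function.update_of_ne ht, mul_zero]

end Isolated

end BrauerTree

namespace BrauerTree

variable {V : Type v} [Fintype V] {Γ : BrauerTree V}

theorem mem_pathArrows_iff {i j : Γ.Edge} {a : Γ.Arrow} :
    a ∈ Γ.pathArrows i j ↔ ∃ d g : Γ.Arrow, Γ.src d = i ∧ Γ.src g = j ∧ d.fst = g.fst ∧
      ∃ k < Γ.steps d g, a = (Γ.next ^ k) d := by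
  constructor
  · rintro ⟨d, m, hd, hg, hfirst, k, hk, rfl⟩
    have hfst : d.fst = ((Γ.next ^ m) d).fst := (Γ.next_pow_fst m d).symm
    refine ⟨d, _, hd, hg, hfst, k, ?_, rfl⟩
    by_contra hle
    refine hfirst _ ((not_lt.1 hle).trans_lt hk) ?_
    rw [next_pow_steps hfst, hg]
  · rintro ⟨d, g, hd, hg, hfst, k, hk, rfl⟩
    refine ⟨d, Γ.steps d g, hd, by rw [next_pow_steps hfst, hg], fun l hl h => ?_, k, hk, rfl⟩
    have h1 : (Γ.next ^ l) d = g :=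
      Γ.eq_of_src_eq_of_fst_eq (h.trans hg.symm) ((Γ.next_pow_fst l d).trans hfst)
    have h2 := steps_eq (hl.trans (steps_lt hfst))
    rw [h1] at h2
    omega

end BrauerTree

/-! ### The diagram near a free end -/

namespace TwoTerm

open BrauerTree BrauerTree.StrandMatching

variable {V : Type v} [Fintype V] {Γ : BrauerTree V} {K : Type u} [Field K] {T : TwoTerm Γ K}

theorem component_eq_zero_iff {s : Fin T.m} {t : Fin T.n} :
    T.component s t = 0 ↔ entry T.f s t = 0 := by
  constructor
  · intro h
    exact congrArg Subtype.val (LinearMap.congr_fun h (Γ.genProj K (T.I s)))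
  · intro h
    refine LinearMap.ext fun y => Subtype.ext ?_
    change ((T.f (Pi.single s y) t : Γ.Proj K (T.J t)) : Γ.Alg K) = 0
    rw [coe_apply_apply_eq_sum]
    refine Finset.sum_eq_zero fun s' _ => ?_
    by_cases hs : s' = s
    · rw [hs, h, mul_zero]
    · rw [Pi.single_eq_of_ne hs]
      simp

theorem mem_diagramArrows_iff {a : Γ.Arrow} :
    a ∈ T.diagramArrows ↔ ∃ s t d g, entry T.f s t ≠ 0 ∧ Γ.src d = T.I s ∧ Γ.src g = T.J t ∧
      d.fst = g.fst ∧ ∃ k < Γ.steps d g, a = (Γ.next ^ k) d := by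
  constructor
  · rintro ⟨s, t, h, ha⟩
    obtain ⟨d, g, hd, hg, hdg, hk⟩ := mem_pathArrows_iff.1 ha
    exact ⟨s, t, d, g, fun h0 => h (component_eq_zero_iff.2 h0), hd, hg, hdg, hk⟩
  · rintro ⟨s, t, d, g, h, hd, hg, hdg, hk⟩
    exact ⟨s, t, fun h0 => h (component_eq_zero_iff.1 h0),
      mem_pathArrows_iff.2 ⟨d, g, hd, hg, hdg, hk⟩⟩

/-- A diagram path around `d₀.fst` would need two different strands there. A path around another
tree vertex can meet an edge at `d₀.fst` only if it runs around a neighbour; `h3` makes this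
neighbour `d₀.snd`, so the edge is that of `d₀`. -/
theorem src_eq_of_isolated {a₀ : Fin T.m ⊕ Fin T.n} {d₀ : Γ.Arrow}
    (h₀ : Γ.src d₀ = label T.I T.J a₀)
    (h1 : ∀ a g, Γ.src g = label T.I T.J a → g.fst = d₀.fst → a = a₀)
    (h3 : ∀ a g, Γ.src g = label T.I T.J a → Γ.graph.Adj d₀.fst g.fst → g.fst = d₀.snd)
    (b : Γ.Arrow) (hb : b.fst = d₀.fst) (hy : Γ.src b ∈ T.diagramVertices) :
    Γ.src b = label T.I T.J a₀ := by
  rcases hy with (⟨s, hs⟩ | ⟨t, ht⟩) | ⟨a, ha, hab⟩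
  · rw [← h1 (Sum.inl s) b hs.symm hb]
    exact hs.symm
  · rw [← h1 (Sum.inr t) b ht.symm hb]
    exact ht.symm
  · obtain ⟨s, t, d, g, -, hd, hg, hdg, k, -, rfl⟩ := mem_diagramArrows_iff.1 ha
    obtain ⟨c, hc, hcd⟩ : ∃ c : Γ.Arrow, Γ.src c = Γ.src b ∧ c.fst = d.fst := by
      rcases hab with h | h
      · exact ⟨_, h, Γ.next_pow_fst k d⟩
      · exact ⟨_, h, (Γ.next_fst _).trans (Γ.next_pow_fst k d)⟩
    rcases Γ.src_eq_src_iff.1 hc with rfl | rfl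
    · have h4 := h1 (Sum.inl s) d hd (hcd.symm.trans hb)
      have h5 := h1 (Sum.inr t) g hg (hdg.symm.trans (hcd.symm.trans hb))
      rw [← h5] at h4
      simp at h4
    · have hbd : b.snd = d.fst := hcd
      have h4 := h3 (Sum.inl s) d hd (by rw [← hb, ← hbd]; exact b.adj)
      rw [Γ.eq_of_fst_eq_of_snd_eq hb (hbd.trans h4), h₀]

/-- Around `d₀.snd` the strand `s` is the only one from `I`, so all diagram paths there start with
`d₀.symm` and do not return to its edge; around `d₀.fst` there are none. -/
theorem isDegreeOneSource_of_isolated {s : Fin T.m} {d₀ : Γ.Arrow} (h₀ : Γ.src d₀ = T.I s)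
    (hIJ : ∀ s t, T.I s ≠ T.J t) (hrow : ∃ t, entry T.f s t ≠ 0) {S : StrandMatching T.I T.J}
    (h1 : ∀ a g, Γ.src g = label T.I T.J a → g.fst = d₀.fst → a = Sum.inl s)
    (h2 : ∀ a g, Γ.src g = label T.I T.J a → g.fst = d₀.snd →
      a = Sum.inl s ∨ S.linked (Sum.inl s) d₀.symm a g) :
    T.IsDegreeOneSource (T.I s) := by
  refine ⟨⟨s, rfl⟩, d₀.symm, ⟨mem_diagramArrows_iff.2 ?_, Or.inl ((Γ.src_symm d₀).trans h₀)⟩, ?_⟩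
  · obtain ⟨t, ht⟩ := hrow
    obtain ⟨d, g, hd, hg, hdg⟩ := exists_common_of_mem_corner (entry_mem_corner T.f s t) ht
    rcases Γ.src_eq_src_iff.1 (hd.trans h₀.symm) with rfl | rfl
    · have := h1 (Sum.inr t) g hg hdg.symm
      simp at this
    · exact ⟨s, t, _, g, ht, hd, hg, hdg, 0,
        steps_pos hdg fun h => hIJ s t (by rw [← hd, ← hg, h]), rfl⟩
  · rintro a ⟨ha, hax⟩
    obtain ⟨s', t, d, g, -, hd, hg, hdg, k, hk, rfl⟩ := mem_diagramArrows_iff.1 ha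
    have hper := steps_lt hdg
    -- `l` is the position on the path at which the edge of `d₀` is met, as the start or the end of
    -- the arrow.
    obtain ⟨l, hl, hl', hlx⟩ : ∃ l, (l = k ∨ l = k + 1) ∧ l < Γ.per d ∧
        Γ.src ((Γ.next ^ l) d) = Γ.src d₀ := by
      rcases hax with h | h
      · exact ⟨k, Or.inl rfl, hk.trans hper, h.trans h₀.symm⟩
      · exact ⟨k + 1, Or.inr rfl, by omega, by rw [next_pow_succ]; exact h.trans h₀.symm⟩
    have hfst := Γ.next_pow_fst l d
    rcases Γ.src_eq_src_iff.1 hlx with h | h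
    · rw [h] at hfst
      have := h1 (Sum.inr t) g hg (hdg.symm.trans hfst.symm)
      simp at this
    · rw [h] at hfst
      have h3 : d = d₀.symm := by
        rcases h2 (Sum.inl s') d hd hfst.symm with h4 | h4
        · rw [Sum.inl.injEq] at h4
          subst h4
          exact Γ.eq_of_src_eq_of_fst_eq (hd.trans (h₀.symm.trans (Γ.src_symm d₀).symm)) hfst.symm
        · exact h4.elim
      subst h3
      have h4 : l = 0 := Γ.next_pow_injOn hl' (Γ.per_pos _) h
      obtain rfl : k = 0 := by omega
      rfl

/-- All diagram paths around `d₀.snd` now end at `d₀.symm`, so the only incident arrow is the one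
preceding it in the cyclic order. -/
theorem isDegreeOneSink_of_isolated {t : Fin T.n} {d₀ : Γ.Arrow} (h₀ : Γ.src d₀ = T.J t)
    (hIJ : ∀ s t, T.I s ≠ T.J t) (hcol : ∃ s, entry T.f s t ≠ 0) {S : StrandMatching T.I T.J}
    (h1 : ∀ a g, Γ.src g = label T.I T.J a → g.fst = d₀.fst → a = Sum.inr t)
    (h2 : ∀ a g, Γ.src g = label T.I T.J a → g.fst = d₀.snd →
      a = Sum.inr t ∨ S.linked (Sum.inr t) d₀.symm a g) :
    T.IsDegreeOneSink (T.J t) := by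
  refine ⟨⟨t, rfl⟩, Γ.next.symm d₀.symm, ⟨mem_diagramArrows_iff.2 ?_, Or.inr ?_⟩, ?_⟩
  · obtain ⟨s, hs⟩ := hcol
    obtain ⟨d, g, hd, hg, hdg⟩ := exists_common_of_mem_corner (entry_mem_corner T.f s t) hs
    rcases Γ.src_eq_src_iff.1 (hg.trans h₀.symm) with rfl | rfl
    · have := h1 (Sum.inl s) d hd hdg
      simp at this
    · have hpos := steps_pos hdg fun h => hIJ s t (by rw [← hd, ← hg, h])
      refine ⟨s, t, d, _, hs, hd, hg, hdg, Γ.steps d d₀.symm - 1, by omega, ?_⟩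
      rw [Equiv.symm_apply_eq, ← next_pow_succ, Nat.sub_add_cancel hpos, next_pow_steps hdg]
  · rw [tgt, Equiv.apply_symm_apply, src_symm, h₀]
  · rintro a ⟨ha, hax⟩
    obtain ⟨s, t', d, g, -, hd, hg, hdg, k, hk, rfl⟩ := mem_diagramArrows_iff.1 ha
    obtain ⟨l, hl, hl', hlx⟩ : ∃ l, (l = k ∨ l = k + 1) ∧ l ≤ Γ.steps d g ∧
        Γ.src ((Γ.next ^ l) d) = Γ.src d₀ := by
      rcases hax with h | h
      · exact ⟨k, Or.inl rfl, hk.le, h.trans h₀.symm⟩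
      · exact ⟨k + 1, Or.inr rfl, hk, by rw [next_pow_succ]; exact h.trans h₀.symm⟩
    have hfst := Γ.next_pow_fst l d
    rcases Γ.src_eq_src_iff.1 hlx with h | h
    · rw [h] at hfst
      have := h1 (Sum.inl s) d hd hfst.symm
      simp at this
    · rw [h] at hfst
      have h3 : g = d₀.symm := by
        rcases h2 (Sum.inr t') g hg (hdg.symm.trans hfst.symm) with h4 | h4
        · rw [Sum.inr.injEq] at h4
          subst h4
          exact Γ.eq_of_src_eq_of_fst_eq (hg.trans (h₀.symm.trans (Γ.src_symm d₀).symm))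
            (hdg.symm.trans hfst.symm)
        · exact h4.elim
      subst h3
      have h4 := steps_eq (hl'.trans_lt (steps_lt hdg))
      rw [h] at h4
      obtain rfl : l = k + 1 := by omega
      rw [Equiv.eq_symm_apply, ← next_pow_succ, h]

/-! ### Consequences of partial tilting for the homomorphism `f` -/

section Tilting

variable {j : Γ.Edge} {k : ℤ} [HasDerivedCategory.{w} (ModuleCat.{max u v} (Γ.Alg K))]

theorem isRigidHom_of_isPartialTilting (h : IsPartialTilting (T.complex ⊞ Γ.stalk K j k)) :
    IsRigidHom T.f := by
  intro g
  have := h.1.isKProjective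
  obtain ⟨φ, ψ, hg⟩ := twoTermComplex_rigid (ModuleCat.ofHom T.f)
    (fun z => CochainComplex.exists_cochain_of_retracts (h.2 1 one_ne_zero)
      biprod.inl biprod.fst biprod.inl_fst biprod.inl biprod.fst biprod.inl_fst z 0 rfl)
    (ModuleCat.ofHom g)
  exact ⟨φ.hom, ψ.hom, congrArg ModuleCat.Hom.hom hg⟩

theorem eq_zero_of_isPartialTilting (h : IsPartialTilting (T.complex ⊞ Γ.stalk K j 0))
    (g : (∀ t, Γ.Proj K (T.J t)) →ₗ[Γ.Alg K] Γ.Proj K j) (hg : g ∘ₗ T.f = 0) : g = 0 := by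
  have := h.1.isKProjective
  have h1 := twoTermComplex_stalk_zero (ModuleCat.ofHom T.f)
    (fun z => CochainComplex.exists_cochain_of_retracts (h.2 (-1) (by decide))
      biprod.inl biprod.fst biprod.inl_fst biprod.inr biprod.snd biprod.inr_snd z (-2) rfl)
    (ModuleCat.ofHom g) (congrArg ModuleCat.ofHom hg)
  exact congrArg ModuleCat.Hom.hom h1

theorem exists_factor_of_isPartialTilting (h : IsPartialTilting (T.complex ⊞ Γ.stalk K j 1))
    (g : (∀ s, Γ.Proj K (T.I s)) →ₗ[Γ.Alg K] Γ.Proj K j) : ∃ k, g = k ∘ₗ T.f := by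
  have := h.1.isKProjective
  obtain ⟨k, hk⟩ := twoTermComplex_stalk_one (ModuleCat.ofHom T.f)
    (fun z => CochainComplex.exists_cochain_of_retracts (h.2 1 one_ne_zero)
      biprod.inl biprod.fst biprod.inl_fst biprod.inr biprod.snd biprod.inr_snd z 0 rfl)
    (ModuleCat.ofHom g)
  exact ⟨k.hom, congrArg ModuleCat.Hom.hom hk⟩

end Tilting

theorem homotopyHomNonzero_zero_iff {j : Γ.Edge} :
    HomotopyHomNonzero T.complex (Γ.stalk K j 0) ↔
      ∃ g : (∀ s, Γ.Proj K (T.I s)) →ₗ[Γ.Alg K] Γ.Proj K j, ∀ k, g ≠ k ∘ₗ T.f := by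
  refine (homotopy_hom_stalk_zero_iff (ModuleCat.ofHom T.f)).trans ⟨?_, ?_⟩
  · rintro ⟨g, hg⟩
    exact ⟨g.hom, fun k hk => hg (ModuleCat.ofHom k) (ModuleCat.hom_ext hk)⟩
  · rintro ⟨g, hg⟩
    exact ⟨ModuleCat.ofHom g, fun k hk => hg k.hom (congrArg ModuleCat.Hom.hom hk)⟩

theorem homotopyHomNonzero_one_iff {j : Γ.Edge} :
    HomotopyHomNonzero T.complex (Γ.stalk K j 1) ↔
      ∃ g : (∀ t, Γ.Proj K (T.J t)) →ₗ[Γ.Alg K] Γ.Proj K j, g ≠ 0 ∧ g ∘ₗ T.f = 0 := by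
  refine (homotopy_hom_stalk_one_iff (ModuleCat.ofHom T.f)).trans ⟨?_, ?_⟩
  · rintro ⟨g, hg, hgf⟩
    exact ⟨g.hom, fun h => hg (ModuleCat.hom_ext h), congrArg ModuleCat.Hom.hom hgf⟩
  · rintro ⟨g, hg, hgf⟩
    exact ⟨ModuleCat.ofHom g, fun h => hg (congrArg ModuleCat.Hom.hom h), ModuleCat.hom_ext hgf⟩

/-! ### Minimal presentations of indecomposable modules -/

section Presentation

variable {M : Type*} [AddCommGroup M] [Module (Γ.Alg K) M]

theorem IsMinimalPresentation.aug_entry (hT : T.IsMinimalPresentation M) (s : Fin T.m)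
    (t : Fin T.n) : Γ.aug K (T.J t) (entry T.f s t) = 0 := by
  obtain ⟨p, -, hfp, hsup, -⟩ := hT
  rw [← hfp] at hsup
  exact aug_entry_eq_zero T.f hsup s t

theorem IsMinimalPresentation.exists_row_ne_zero (hT : T.IsMinimalPresentation M) (s : Fin T.m) :
    ∃ t, entry T.f s t ≠ 0 := by
  obtain ⟨p, -, -, -, hker⟩ := hT
  exact exists_entry_ne_zero T.f hker s

/-- A zero column makes `{t}` a block by itself. By indecomposability it is everything, so `P₀ = 0`
and `M` would be projective. -/
theorem IsMinimalPresentation.exists_col_ne_zero (hT : T.IsMinimalPresentation M)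
    (hM : IsIndecomposableModule (Γ.Alg K) M) (hM' : ¬ Module.Projective (Γ.Alg K) M)
    (t : Fin T.n) : ∃ s, entry T.f s t ≠ 0 := by
  by_contra! hz
  have haug := hT.aug_entry
  have hrow := hT.exists_row_ne_zero
  obtain ⟨p, hp, hfp, -, -⟩ := hT
  rcases eq_empty_or_eq_univ_of_isIndecomposableModule hM T.f p hp hfp haug hrow ∅ {t}
    (fun s t' h => ⟨False.elim, fun h' => h (by rw [Set.mem_singleton_iff.1 h']; exact hz s)⟩)
    with ⟨-, h⟩ | ⟨h, -⟩
  · exact Set.singleton_ne_empty t h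
  · refine hM' ?_
    have hempty : IsEmpty (Fin T.m) := ⟨fun s => by
      have : s ∈ (∅ : Set (Fin T.m)) := by
        rw [h]
        trivial
      exact this⟩
    have hinj : Function.Injective p := by
      rw [← LinearMap.ker_eq_bot, ← hfp, eq_bot_iff]
      rintro _ ⟨x, rfl⟩
      rw [Subsingleton.elim x 0, map_zero]
      exact zero_mem _
    have hproj : ∀ i, Module.Projective (Γ.Alg K) (Γ.Proj K i) := fun i => by
      refine Module.Projective.of_split (Γ.Proj K i).subtype
        ((LinearMap.toSpanSingleton (Γ.Alg K) (Γ.Alg K) (Γ.e K i)).codRestrict (Γ.Proj K i)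
          fun x => Submodule.mem_span_singleton.2 ⟨x, rfl⟩) ?_
      ext x
      exact mem_Proj.1 x.2
    exact Module.Projective.of_equiv ((DirectSum.linearEquivFunOnFintype (Γ.Alg K) (Fin T.n)
      fun t => Γ.Proj K (T.J t)).trans (LinearEquiv.ofBijective p ⟨hinj, hp⟩))

variable [IsAlgClosed K]

theorem IsMinimalPresentation.eq_univ_of_linked_closed (hT : T.IsMinimalPresentation M)
    (hM : IsIndecomposableModule (Γ.Alg K) M) (hf : IsRigidHom T.f)
    (hIJ : ∀ s t, T.I s ≠ T.J t) (S : StrandMatching T.I T.J) (Z : Set (Fin T.m ⊕ Fin T.n))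
    (hZ : ∀ a g b e, S.linked a g b e → a ∈ Z → b ∈ Z) (hne : Z.Nonempty) : Z = Set.univ := by
  obtain ⟨p, hp, hfp, -, hker⟩ := hT
  have := IsAlgClosed.instInfinite (K := K)
  obtain ⟨φ, ψ, h⟩ := exists_equiv_of_rigid K T.f (S.hom K hIJ) hf (isRigidHom_hom hIJ)
  exact StrandMatching.eq_univ_of_linked_closed hM hIJ T.f p hp hfp hker φ ψ h Z hZ hne

/-- The matching only decides where strands lie near the free end; the arrows of the diagram are
then read off from the entries of `T.f` itself. -/
theorem IsMinimalPresentation.exists_isDegreeOneSource (hT : T.IsMinimalPresentation M)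
    (hM : IsIndecomposableModule (Γ.Alg K) M) (hf : IsRigidHom T.f) {j : Γ.Edge}
    (hinj : ∀ g : (∀ t, Γ.Proj K (T.J t)) →ₗ[Γ.Alg K] Γ.Proj K j, g ∘ₗ T.f = 0 → g = 0)
    (g : (∀ s, Γ.Proj K (T.I s)) →ₗ[Γ.Alg K] Γ.Proj K j) (hg : ∀ k, g ≠ k ∘ₗ T.f) :
    ∃ x, T.IsDegreeOneSource x ∧ ∃ d ∈ Γ.common x j,
      ∀ a : Γ.Arrow, a.fst = d.fst → Γ.src a ∈ T.diagramVertices → Γ.src a = x := by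
  have hIJ := hf.ne hT.aug_entry
  obtain ⟨S⟩ := nonempty_strandMatching T.I T.J
  obtain ⟨s, d, hd, hfree⟩ := S.exists_free_left j (sum_common_lt_of_not_factor T.f hinj g hg)
  obtain ⟨h1, h2, h3⟩ := free_end_structure (a₀ := Sum.inl s) hIJ hd.1 hfree
    (hT.eq_univ_of_linked_closed hM hf hIJ S)
  exact ⟨T.I s, isDegreeOneSource_of_isolated hd.1 hIJ (hT.exists_row_ne_zero s) h1 h2, d, hd,
    src_eq_of_isolated (a₀ := Sum.inl s) hd.1 h1 h3⟩

theorem IsMinimalPresentation.exists_isDegreeOneSink (hT : T.IsMinimalPresentation M)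
    (hM : IsIndecomposableModule (Γ.Alg K) M) (hM' : ¬ Module.Projective (Γ.Alg K) M)
    (hf : IsRigidHom T.f) {j : Γ.Edge}
    (hsurj : ∀ g : (∀ s, Γ.Proj K (T.I s)) →ₗ[Γ.Alg K] Γ.Proj K j, ∃ k, g = k ∘ₗ T.f)
    (g : (∀ t, Γ.Proj K (T.J t)) →ₗ[Γ.Alg K] Γ.Proj K j) (hg : g ≠ 0) (hgf : g ∘ₗ T.f = 0) :
    ∃ x, T.IsDegreeOneSink x ∧ ∃ d ∈ Γ.common x j,
      ∀ a : Γ.Arrow, a.fst = d.fst → Γ.src a ∈ T.diagramVertices → Γ.src a = x := by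
  have hIJ := hf.ne hT.aug_entry
  obtain ⟨S⟩ := nonempty_strandMatching T.I T.J
  obtain ⟨t, d, hd, hfree⟩ := S.exists_free_right j
      (sum_common_lt_of_comp_eq_zero T.f hsurj g hg hgf)
  obtain ⟨h1, h2, h3⟩ := free_end_structure (a₀ := Sum.inr t) hIJ hd.1 hfree
    (hT.eq_univ_of_linked_closed hM hf hIJ S)
  exact ⟨T.J t, isDegreeOneSink_of_isolated hd.1 hIJ (hT.exists_col_ne_zero hM hM' t) h1 h2, d, hd,
    src_eq_of_isolated (a₀ := Sum.inr t) hd.1 h1 h3⟩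

end Presentation

end TwoTerm

theorem proposition2 {K : Type u} [Field K] [IsAlgClosed K] {V : Type v} [Fintype V]
    (Γ : BrauerTree V) [HasDerivedCategory.{w} (ModuleCat.{max u v} (Γ.Alg K))]
    (M : Type*) [AddCommGroup M] [Module (Γ.Alg K) M]
    (hM : IsIndecomposableModule (Γ.Alg K) M) (hM' : ¬ Module.Projective (Γ.Alg K) M)
    (T : TwoTerm Γ K) (hT : T.IsMinimalPresentation M) (j : Γ.Edge) :
    (IsPartialTilting (T.complex ⊞ Γ.stalk K j 0) →
      (HomotopyHomNonzero T.complex (Γ.stalk K j 0) ↔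
        ∃ x, T.IsDegreeOneSource x ∧ ∃ c, Γ.IsACycle K c ∧ Γ.OnCycle c x ∧ Γ.OnCycle c j ∧
          ∀ y ∈ T.diagramVertices, Γ.OnCycle c y → y = x)) ∧
    (IsPartialTilting (T.complex ⊞ Γ.stalk K j 1) →
      (HomotopyHomNonzero T.complex (Γ.stalk K j 1) ↔
        ∃ x, T.IsDegreeOneSink x ∧ ∃ c, Γ.IsACycle K c ∧ Γ.OnCycle c x ∧ Γ.OnCycle c j ∧
          ∀ y ∈ T.diagramVertices, Γ.OnCycle c y → y = x)) := by
  simp only [BrauerTree.exists_isACycle_iff]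
  refine ⟨fun h => ?_, fun h => ?_⟩
  · rw [TwoTerm.homotopyHomNonzero_zero_iff]
    constructor
    · rintro ⟨g, hg⟩
      exact hT.exists_isDegreeOneSource hM (TwoTerm.isRigidHom_of_isPartialTilting h)
        (TwoTerm.eq_zero_of_isPartialTilting h) g hg
    · rintro ⟨_, ⟨⟨s, rfl⟩, -⟩, d, hd, hx⟩
      refine BrauerTree.exists_not_factor_of_isolated T.f hT.aug_entry hd fun t a ha had => ?_
      rw [← ha]
      exact hx a had (Or.inl (Or.inr ⟨t, ha.symm⟩))
  · rw [TwoTerm.homotopyHomNonzero_one_iff]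
    constructor
    · rintro ⟨g, hg, hgf⟩
      exact hT.exists_isDegreeOneSink hM hM' (TwoTerm.isRigidHom_of_isPartialTilting h)
        (TwoTerm.exists_factor_of_isPartialTilting h) g hg hgf
    · rintro ⟨_, ⟨⟨t, rfl⟩, -⟩, d, hd, hx⟩
      refine BrauerTree.exists_comp_eq_zero_of_isolated T.f hT.aug_entry hd fun s a ha had => ?_
      rw [← ha]
      exact hx a had (Or.inl (Or.inl ⟨s, ha.symm⟩))

end
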